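/- Let $\mathbb T=\mathbb R/\mathbb Z$, $L^2=L^2(\mathbb T;\mathbb C)$ with norm $\|\cdot\|$, $\phi_k(x)=e^{2\pi ikx}$, $\lambda_k=(2\pi k)^2$ for $k\in\mathbb Z$, and, for $u=\sum_k u_k\phi_k\in L^2$, $\|u\|_{\dot H^\alpha}^2=\sum_{k}(1+\lambda_k)^\alpha|u_k|^2$ ($\dot H^\alpha$ is the set of $u$ for which this is finite, $\alpha\ge 0$). Let $R>0$, $\nu,\mu\in\mathbb R$, $T>0$, let $e^{tA}$ be the semigroup generated by $A=(1+i\nu)\Delta$ on $L^2$, i.e. $e^{tA}\phi_k=e^{-(1+i\nu)\lambda_kt}\phi_k$, and let $\Psi_0(z)=Rz-(1+i\mu)|z|^2z$. Let $r\ge 0$, $\sigma\in\mathbb R$, and let $W$ be a complex $\dot H^r$-valued noise on a filtered probability space: an adapted process with continuous paths in $L^2$ of the form $W(t)=\sum_{k\in\mathbb Z}\sqrt{q_k}\,(\beta^r_k(t)+i\beta^i_k(t))\phi_k$, where $\beta^r_k,\beta^i_k$ $(k\in\mathbb Z)$ are independent real Brownian motions and, for some $\varepsilon\in(0,\frac32)$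 and some $K$, $0<q_k\le K|k|^{-2r-1-2\varepsilon}$ for $k\ne0$, and $q_0>0$. Let $$\eta(t)=\sigma\int_0^te^{(t-s)A}\,dW(s)=\sigma\sum_{k\in\mathbb Z}\sqrt{q_k}\Big(\int_0^te^{-(t-s)(1+i\nu)\lambda_k}d\beta^r_k(s)+i\int_0^te^{-(t-s)(1+i\nu)\lambda_k}d\beta^i_k(s)\Big)\phi_k$$ be the stochastic convolution, where the integrals of these smooth deterministic integrands are taken path by path, as limits of the sums $\sum_{j<n} f(s_j)(\beta(s_{j+1})-\beta(s_j))$ with $s_j=jt/n$. A mild solution on $[0,T]$ of the random PDE $$\partial_tv=(1+i\nu)\Delta v+\Psi_0(v+\eta),\qquad v(0)=u_0,$$ for a given path of $\eta$, is a $v\in C([0,T];L^2)$ such that $s\mapsto\Psi_0(v(s)+\eta(s))$ belongs to $L^1(0,T;L^2)$ and $$v(t)=e^{tA}u_0+\int_0^te^{(t-s)A}\Psi_0(v(s)+\eta(s))\,ds\qquad\text{for all }t\in[0,T].$$ **Theorem.** For every $M$ there is a constant $C_T>0$, which depends only on $T,R,\nu,\mu$ and $M$, such that for every $u_0\in\dot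 H^1$ with $\|u_0\|\le M$ and for all $r$, $\sigma$ and $W$ as above the following holds almost surely. The series defining $\eta(t)$ converges in $L^2$ for all $t\in[0,T]$, $\sup_{t\in[0,T]}\|\eta(t)\|<\infty$ and $\|\eta\|_{L^2(0,T;\dot H^1)}<\infty$; and there is exactly one mild solution $v$ on $[0,T]$, and it satisfies $$\sup_{t\in[0,T]}\|v(t)\|_{\dot H^1}^2+\|v\|_{L^2(0,T;\dot H^2)}^2\le C_T\Big[1+\|u_0\|_{\dot H^1}^2+\sup_{t\in[0,T]}\|\eta(t)\|^{12}+\|\eta\|_{L^2(0,T;\dot H^1)}^{12}\Big].$$ -/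

import Mathlib

open MeasureTheory ProbabilityTheory Filter Topology Set
open scoped NNReal ENNReal

noncomputable section

namespace CGL

/-! ### The torus, the Fourier basis and Sobolev norms -/

/-- `L²(𝕋; ℂ)` on the torus `𝕋 = ℝ / ℤ`, with the Lebesgue (probability) measure. -/
abbrev L2T : Type := Lp ℂ 2 (AddCircle.haarAddCircle : Measure UnitAddCircle)

/-- The eigenvalue `λ_k = (2πk)²` of `-Δ` for the eigenfunction `φ_k(x) = exp(2πikx)`. -/
def lam (k : ℤ) : ℝ := (2 * Real.pi * k) ^ 2

/-- The eigenfunction `φ_k(x) = exp(2πikx)`, as an element of `L²`. -/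
abbrev phi (k : ℤ) : L2T := fourierLp 2 k

/-- The `k`-th Fourier coefficient `⟨u, φ_k⟩` of `u ∈ L²`. -/
def coeff (u : L2T) (k : ℤ) : ℂ := fourierCoeff (⇑u) k

/-- The function `∑_k a_k φ_k`; the series converges in `L²` whenever `∑_k |a_k|² < ∞`. -/
def ofCoeff (a : ℤ → ℂ) : L2T := ∑' k : ℤ, a k • phi k

/-- `‖u‖²_{Ḣ^α} = ⟨(I - Δ)^{α/2} u, (I - Δ)^{α/2} u⟩ = ∑_k (1 + λ_k)^α |u_k|²`,
equal to `∞` when `u` is not in the domain `Ḣ^α` of `(I - Δ)^{α/2}`. -/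
def sobolevSq (α : ℝ) (u : L2T) : ℝ≥0∞ :=
  ∑' k : ℤ, ENNReal.ofReal ((1 + lam k) ^ α * ‖coeff u k‖ ^ 2)

/-- The semigroup `e^{tA}`, `A = (1 + iν)Δ`, which acts on `φ_k` as `exp(-(1 + iν) λ_k t)`. -/
def semigroup (ν t : ℝ) (u : L2T) : L2T :=
  ofCoeff fun k => Complex.exp (-((1 + ν * Complex.I) * lam k * t)) * coeff u k

lemma hasSum_ofCoeff {a : ℤ → ℂ} (ha : Summable fun k => ‖a k‖ ^ 2) :
    HasSum (fun k => a k • phi k) (ofCoeff a) := by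
  have h2 : Memℓp a 2 := by
    rw [memℓp_gen_iff (by norm_num)]
    simpa using ha
  have h := (fourierBasis (T := (1 : ℝ))).hasSum_repr_symm ⟨a, h2⟩
  rw [coe_fourierBasis] at h
  exact h.summable.hasSum

lemma coeff_ofCoeff {a : ℤ → ℂ} (ha : Summable fun k => ‖a k‖ ^ 2) (k : ℤ) :
    coeff (ofCoeff a) k = a k := by
  have h2 : Memℓp a 2 := by
    rw [memℓp_gen_iff (by norm_num)]
    simpa using ha
  have h := (fourierBasis (T := (1 : ℝ))).hasSum_repr_symm ⟨a, h2⟩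
  rw [coe_fourierBasis] at h
  have e := (hasSum_ofCoeff ha).unique h
  rw [coeff, ← fourierBasis_repr, e]
  simp

/-! ### Noise and stochastic convolution -/

/-- The sum `∑_j f(s_j) (B(s_{j+1}) - B(s_j))` over the uniform partition `s_j = jt/n` of `[0, t]`,
which approximates the integral `∫₀ᵗ f(s) dB(s)` of a deterministic function `f` against a path `B`.
If `B` is a Brownian motion, these sums converge to the Itô integral of `f` in mean square as
`n → ∞`. If moreover `f` is of class `C¹`, they converge along every continuous path
(`tendsto_itoSum`), so that the limit is the Itô (Wiener) integral, in a version that is defined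
path by path. -/
def itoSum (f : ℝ → ℂ) (B : ℝ → ℂ) (t : ℝ) (n : ℕ) : ℂ :=
  ∑ j ∈ Finset.range n, f (j * t / n) * (B ((j + 1) * t / n) - B (j * t / n))

/-- The path-by-path integral `∫₀ᵗ f(s) dB(s)`, the limit of `itoSum f B t n` as `n → ∞`. -/
def pathIntegral (f : ℝ → ℂ) (B : ℝ → ℂ) (t : ℝ) : ℂ := limUnder atTop (itoSum f B t)

lemma tendsto_itoSum {f f' B : ℝ → ℂ} {t : ℝ} (ht : 0 ≤ t) (hf : ∀ s, HasDerivAt f (f' s) s)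
    (hf' : Continuous f') (hB : Continuous B) :
    Tendsto (itoSum f B t) atTop
      (𝓝 (f t * B t - f 0 * B 0 - ∫ s in (0 : ℝ)..t, f' s * B s)) := by
  obtain ⟨K, hK⟩ := isCompact_Icc.exists_bound_of_continuousOn (s := Icc 0 t) hf'.continuousOn
  have hK0 : 0 ≤ K := (norm_nonneg _).trans (hK 0 ⟨le_rfl, ht⟩)
  have huc := isCompact_Icc.uniformContinuousOn_of_continuous (s := Icc 0 t) hB.continuousOn
  rw [Metric.uniformContinuousOn_iff] at huc
  rw [Metric.tendsto_atTop]
  intro ε hε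
  obtain ⟨δ, hδ, hδB⟩ := huc (ε / (K * t + 1)) (by positivity)
  obtain ⟨N, hN⟩ := exists_nat_gt (t / δ)
  refine ⟨N + 1, fun n hn => ?_⟩
  have hn0 : (0 : ℝ) < n := by exact_mod_cast (by omega : 0 < n)
  have hnN : (N : ℝ) ≤ n := by exact_mod_cast (by omega : N ≤ n)
  have hmesh : t / n < δ := by
    rw [div_lt_iff₀ hn0]
    rw [div_lt_iff₀ hδ] at hN
    nlinarith
  set p : ℕ → ℝ := fun j => j * t / n with hp
  have hp1 (j : ℕ) : ((j : ℝ) + 1) * t / n = p (j + 1) := by simp [hp]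
  have hp0 : p 0 = 0 := by simp [hp]
  have hpn : p n = t := by simp only [hp]; field_simp
  have hstep (j : ℕ) : p (j + 1) - p j = t / n := by simp only [hp]; push_cast; ring
  have htn : 0 ≤ t / n := by positivity
  have hint : ∫ s in (0 : ℝ)..t, f' s * B s =
      ∑ j ∈ Finset.range n, ∫ s in p j..p (j + 1), f' s * B s := by
    rw [intervalIntegral.sum_integral_adjacent_intervals (f := fun s => f' s * B s)
      (fun k _ => (hf'.mul hB).intervalIntegrable _ _), hp0, hpn]
  have hdf (j : ℕ) : f (p (j + 1)) - f (p j) = ∫ s in p j..p (j + 1), f' s :=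
    (intervalIntegral.integral_eq_sub_of_hasDerivAt (fun s _ => hf s)
      (hf'.intervalIntegrable _ _)).symm
  have htel : f t * B t - f 0 * B 0 =
      ∑ j ∈ Finset.range n, (f (p (j + 1)) * B (p (j + 1)) - f (p j) * B (p j)) := by
    rw [Finset.sum_range_sub (fun j => f (p j) * B (p j)), hp0, hpn]
  have key : itoSum f B t n - (f t * B t - f 0 * B 0 - ∫ s in (0 : ℝ)..t, f' s * B s) =
      ∑ j ∈ Finset.range n, ∫ s in p j..p (j + 1), f' s * (B s - B (p (j + 1))) := by
    rw [hint, htel, itoSum, ← Finset.sum_sub_distrib, ← Finset.sum_sub_distrib]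
    refine Finset.sum_congr rfl fun j _ => ?_
    simp_rw [mul_sub]
    rw [intervalIntegral.integral_sub (f := fun s => f' s * B s)
      (g := fun s => f' s * B (p (j + 1))) ((hf'.mul hB).intervalIntegrable _ _)
      ((hf'.mul continuous_const).intervalIntegrable _ _),
      intervalIntegral.integral_mul_const, ← hdf, hp1]
    simp only [hp]
    ring
  rw [dist_eq_norm, key]
  have hbound : ∀ j ∈ Finset.range n,
      ‖∫ s in p j..p (j + 1), f' s * (B s - B (p (j + 1)))‖ ≤
        K * (ε / (K * t + 1)) * (t / n) := by
    intro j hj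
    have hjn : j + 1 ≤ n := by simpa using hj
    have hle : p j ≤ p (j + 1) := by linarith [hstep j]
    have hpj : 0 ≤ p j := by simp only [hp]; positivity
    have hpj1 : p (j + 1) ≤ t := by
      have : ((j + 1 : ℕ) : ℝ) ≤ n := by exact_mod_cast hjn
      simp only [hp]
      rw [div_le_iff₀ hn0]
      nlinarith
    have := intervalIntegral.norm_integral_le_of_norm_le_const (a := p j) (b := p (j + 1))
      (f := fun s => f' s * (B s - B (p (j + 1)))) (C := K * (ε / (K * t + 1))) (by
        intro s hs
        rw [uIoc_of_le hle] at hs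
        rw [norm_mul]
        have h1 := hK s ⟨hpj.trans hs.1.le, hs.2.trans hpj1⟩
        have h2 := hδB s ⟨hpj.trans hs.1.le, hs.2.trans hpj1⟩ (p (j + 1)) ⟨hpj.trans hle, hpj1⟩ (by
          rw [Real.dist_eq, abs_sub_comm, abs_of_nonneg (by linarith [hs.2])]
          linarith [hstep j, hs.1])
        rw [dist_eq_norm] at h2
        exact mul_le_mul h1 h2.le (norm_nonneg _) hK0)
    rwa [hstep, abs_of_nonneg htn] at this
  refine (norm_sum_le_of_le _ hbound).trans_lt ?_
  rw [Finset.sum_const, Finset.card_range, nsmul_eq_mul]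
  have hKt : 0 < K * t + 1 := by positivity
  calc (n : ℝ) * (K * (ε / (K * t + 1)) * (t / n)) = ε * (K * t / (K * t + 1)) := by field_simp
    _ < ε * 1 := by
        refine mul_lt_mul_of_pos_left ?_ hε
        rw [div_lt_one hKt]
        linarith
    _ = ε := mul_one ε

/-- `W` is a complex `Ḣ^r`-valued noise on the filtered probability space `(Ω, 𝓕, P)`:
an adapted continuous process with `W(t) = ∑_k √q_k (β^r_k(t) + i β^i_k(t)) φ_k` for independent
real Brownian motions `β^r_k = β (k, 0)`, `β^i_k = β (k, 1)` and positive
`q_k ≤ K |k|^{-2r-1-2ε}`, `ε ∈ (0, 3/2)`. -/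
structure IsComplexNoise {Ω : Type*} [mΩ : MeasurableSpace Ω] (P : Measure Ω)
    (𝓕 : Filtration ℝ≥0 mΩ) (r : ℝ)
    (W : ℝ≥0 → Ω → L2T) : Prop where
  adapted : StronglyAdapted 𝓕 W
  continuous_paths : ∀ᵐ ω ∂P, Continuous fun t => W t ω
  representation : ∃ ε ∈ Ioo (0 : ℝ) (3 / 2), ∃ q : ℤ → ℝ, (∀ k, 0 < q k) ∧
    (∃ K : ℝ, ∀ k : ℤ, k ≠ 0 → q k ≤ K * |(k : ℝ)| ^ (-2 * r - 1 - 2 * ε)) ∧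
    ∃ β : ℤ × Fin 2 → ℝ≥0 → Ω → ℝ,
      (∀ j, IsBrownianReal (β j) P) ∧
      iIndepFun (fun j ω t => β j t ω) P ∧
      ∀ t, ∀ᵐ ω ∂P, HasSum
        (fun k : ℤ => ((Real.sqrt (q k) : ℂ) *
          ((β (k, 0) t ω : ℂ) + Complex.I * (β (k, 1) t ω : ℂ))) • phi k) (W t ω)

/-- The `k`-th Fourier coefficient `σ ∫₀ᵗ exp(-(1 + iν) λ_k (t - s)) dW_k(s)` of the stochastic
convolution, where `W_k = ⟨W, φ_k⟩ = √q_k (β^r_k + i β^i_k)`. -/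
def stochConvCoeff {Ω : Type*} (ν σ : ℝ) (W : ℝ≥0 → Ω → L2T) (ω : Ω) (t : ℝ) (k : ℤ) : ℂ :=
  σ * pathIntegral (fun s => Complex.exp (-((1 + ν * Complex.I) * lam k * (t - s))))
    (fun s => coeff (W s.toNNReal ω) k) t

/-- The stochastic convolution `η(t) = σ ∫₀ᵗ e^{(t-s)A} dW(s)`, as a Fourier series. -/
def stochConv {Ω : Type*} (ν σ : ℝ) (W : ℝ≥0 → Ω → L2T) (ω : Ω) (t : ℝ) : L2T :=
  ofCoeff (stochConvCoeff ν σ W ω t)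

/-! ### The random PDE -/

/-- The nonlinearity `Ψ₀(z) = R z - (1 + iμ) |z|² z`. -/
def psi (R μ : ℝ) (z : ℂ) : ℂ := R * z - (1 + μ * Complex.I) * (‖z‖ : ℂ) ^ 2 * z

open Classical in
/-- `Ψ₀ ∘ w` as an element of `L²` (with the value `0` if `Ψ₀ ∘ w` is not in `L²`). -/
def psiL2 (R μ : ℝ) (w : L2T) : L2T :=
  if h : MemLp (fun x => psi R μ (w x)) 2 AddCircle.haarAddCircle then h.toLp _ else 0

/-- `v` is a mild solution in `L²` on `[0, T]`, with forcing path `η`, of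
`∂ₜ v = (1 + iν)Δv + Ψ₀(v + η)`, `v(0) = u₀`: a continuous `L²`-valued path such that
`s ↦ Ψ₀(v(s) + η(s))` is (almost everywhere) `L²`-valued and Bochner integrable on `(0, T)`, and
`v(t) = e^{tA} u₀ + ∫₀ᵗ e^{(t-s)A} Ψ₀(v(s) + η(s)) ds` for `0 ≤ t ≤ T`. -/
structure IsMildSolution (R ν μ T : ℝ) (u₀ : L2T) (η v : ℝ → L2T) : Prop where
  continuousOn : ContinuousOn v (Icc 0 T)
  memLp : ∀ᵐ s ∂(volume.restrict (Ioc 0 T)),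
    MemLp (fun x => psi R μ ((v s + η s : L2T) x)) 2 AddCircle.haarAddCircle
  integrableOn : IntegrableOn (fun s => psiL2 R μ (v s + η s)) (Ioc 0 T)
  mild : ∀ t ∈ Icc 0 T,
    v t = semigroup ν t u₀ + ∫ s in (0 : ℝ)..t, semigroup ν (t - s) (psiL2 R μ (v s + η s))

end CGL

end

open CGL

/-!
The argument separates a deterministic part, for a fixed forcing path `η`, from a probabilistic
part, which shows that almost every path of the stochastic convolution is admissible.

*Deterministic part.* Let the Fourier coefficients of `η` be continuous in time and dominated by a
square-summable sequence, and let `η ∈ L²(0, T; H¹)` (`IsForcing`). Solutions are limits of Galerkin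
approximations `a`, which exist globally because `Ψ₀` is dissipative
(`exists_solution_of_dissipative`). Let `S = sup ‖η‖`, `I = ∫ ‖η‖²_{H¹}` and `θ = 1 + S⁴ + I²`.
* The cubic term absorbs everything that contains `a`, so the energy identity leaves `∫ ‖η‖_{L⁴}⁴`,
  which Agmon's inequality `‖u‖_∞² ≤ 10 ‖u‖ ‖u‖_{H¹}` bounds by `S³ ‖η‖_{H¹}`. Thus `sup ‖a‖²` and
  `∫ ‖∇a‖²` are at most a multiple of `θ` (`IsGalerkin.energy_le`). The initial value enters through
  a bound `M` for `‖u₀‖`.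
* By Agmon's inequality again, `‖Ψ₀(a + η)‖²` is at most a multiple of
  `1 + ‖a‖⁴ ‖a‖²_{H¹} + S⁴ ‖η‖²_{H¹}`, whose integral is at most a multiple of `θ³`. Testing the
  equation with `-Δa` then bounds `‖∇a‖² + ∫ ‖Δa‖²` (`IsGalerkin.gradSq_le`). As
  `θ³ ≤ 9 (1 + S¹² + I⁶)`, this is the source of the power `12` of the norms of `η`.
* `Ψ₀` is locally Lipschitz from `L²` to `L¹`, with a factor controlled by `‖w‖_{L⁴}²`. Since
  `‖w‖_{L⁴}⁴ ≤ ‖w‖ (‖Ψ₀(w)‖ + R ‖w‖)`, this factor is in `L⁴` in time along approximations and in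
  `L²` along every mild solution, in which `‖Ψ₀(w)‖` is only integrable. An `L¹` bound controls
  all Fourier coefficients at once, and the heat kernel with an exponential weight makes the resulting
  sum over the modes small. The Gronwall inequality `exists_gronwall_const` that results gives both
  the uniform convergence of the Galerkin approximations and the uniqueness of mild solutions
  (`IsMildSolution.eqOn`).

*Probabilistic part.* An integration by parts expresses each mode of the stochastic convolution by
the path of the noise (`convPath`), so it is continuous and at most a multiple of the running
supremum of that mode of the noise. Doob's inequality, in its pathwise form `runMax_sq_le`, bounds
the second moment of this supremum by a multiple of `q_k`. The isometry for the approximating sums and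
Fatou's lemma bound the second moment of `(1 + λ_k)^{1/2}` times the `k`-th mode in `L²(0, T)` by a
multiple of `q_k` as well. Since `∑ q_k < ∞`, both series of random variables converge almost surely
(`ae_stochConv_regularity`). Every expectation is taken of a quantity that involves the noise at
countably many times only, so that no joint measurability in time and chance is needed.
-/

noncomputable section

namespace CGL

/-! ### Fourier coefficients -/

lemma lam_nonneg (k : ℤ) : 0 ≤ lam k := sq_nonneg _

lemma lam_zero : lam 0 = 0 := by simp [lam]

lemma sq_le_lam (k : ℤ) : (k : ℝ) ^ 2 ≤ lam k := by
  rw [lam, mul_pow]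
  have : (1 : ℝ) ≤ (2 * Real.pi) ^ 2 := by nlinarith [Real.pi_gt_three]
  nlinarith [sq_nonneg (k : ℝ)]

lemma coeff_eq_repr (u : L2T) (k : ℤ) : coeff u k = fourierBasis.repr u k :=
  (fourierBasis_repr u k).symm

lemma coeff_eq_inner (u : L2T) (k : ℤ) : coeff u k = inner ℂ (phi k) u := by
  rw [coeff_eq_repr, HilbertBasis.repr_apply_apply, coe_fourierBasis]

/-- The `k`-th Fourier coefficient as a continuous linear functional. -/
def coeffL (k : ℤ) : L2T →L[ℂ] ℂ := innerSL ℂ (phi k)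

lemma coeffL_apply (k : ℤ) (u : L2T) : coeffL k u = coeff u k := (coeff_eq_inner u k).symm

lemma coeff_add (u v : L2T) (k : ℤ) : coeff (u + v) k = coeff u k + coeff v k := by
  simp only [← coeffL_apply, map_add]

lemma coeff_sub (u v : L2T) (k : ℤ) : coeff (u - v) k = coeff u k - coeff v k := by
  simp only [← coeffL_apply, map_sub]

lemma coeff_smul (c : ℂ) (u : L2T) (k : ℤ) : coeff (c • u) k = c * coeff u k := by
  simp only [← coeffL_apply, map_smul, smul_eq_mul]

lemma coeff_zero (k : ℤ) : coeff 0 k = 0 := by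
  simp only [← coeffL_apply, map_zero]

lemma coeff_sum {ι : Type*} (s : Finset ι) (u : ι → L2T) (k : ℤ) :
    coeff (∑ i ∈ s, u i) k = ∑ i ∈ s, coeff (u i) k := by
  simp only [← coeffL_apply, map_sum]

lemma coeff_phi (j k : ℤ) : coeff (phi j) k = if j = k then 1 else 0 := by
  have := (orthonormal_iff_ite.1 (orthonormal_fourier (T := (1 : ℝ)))) k j
  rw [coeff_eq_inner, this]
  simp only [eq_comm]

lemma norm_phi (k : ℤ) : ‖phi k‖ = 1 := (orthonormal_fourier (T := (1 : ℝ))).1 k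

lemma continuous_coeff (k : ℤ) : Continuous fun u : L2T => coeff u k := by
  simp only [← coeffL_apply]
  exact (coeffL k).continuous

lemma norm_coeff_le (u : L2T) (k : ℤ) : ‖coeff u k‖ ≤ ‖u‖ := by
  rw [coeff_eq_inner]
  simpa [norm_phi] using norm_inner_le_norm (𝕜 := ℂ) (phi k) u

lemma coeff_ext {u v : L2T} (h : ∀ k, coeff u k = coeff v k) : u = v := by
  apply fourierBasis.repr.injective
  ext k
  rw [← coeff_eq_repr, ← coeff_eq_repr, h]

/-- Parseval's identity. -/
lemma hasSum_norm_coeff_sq (u : L2T) : HasSum (fun k => ‖coeff u k‖ ^ 2) (‖u‖ ^ 2) := by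
  have h := lp.hasSum_norm (p := 2) (by norm_num) (fourierBasis.repr u)
  simp only [LinearIsometryEquiv.norm_map, ENNReal.toReal_ofNat, Real.rpow_ofNat,
    ← coeff_eq_repr] at h
  exact h

lemma summable_norm_coeff_sq (u : L2T) : Summable fun k => ‖coeff u k‖ ^ 2 :=
  (hasSum_norm_coeff_sq u).summable

lemma ofCoeff_coeff (u : L2T) : ofCoeff (coeff u) = u :=
  coeff_ext fun k => coeff_ofCoeff (summable_norm_coeff_sq u) k

lemma enorm_sq_eq_tsum (u : L2T) : ‖u‖ₑ ^ 2 = ∑' k, ‖coeff u k‖ₑ ^ 2 := by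
  have h := hasSum_norm_coeff_sq u
  rw [← ofReal_norm, ← ENNReal.ofReal_pow (norm_nonneg _), ← h.tsum_eq,
    ENNReal.ofReal_tsum_of_nonneg (fun _ => by positivity) h.summable]
  simp_rw [ENNReal.ofReal_pow (norm_nonneg _), ofReal_norm]

lemma hasSum_coeff_smul_phi (u : L2T) : HasSum (fun k => coeff u k • phi k) u := by
  have := hasSum_ofCoeff (summable_norm_coeff_sq u)
  rwa [ofCoeff_coeff] at this

lemma norm_sq_eq_integral (u : L2T) :
    ‖u‖ ^ 2 = ∫ x, ‖u x‖ ^ 2 ∂AddCircle.haarAddCircle := by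
  rw [← tsum_sq_fourierCoeff, ← (hasSum_norm_coeff_sq u).tsum_eq]
  rfl

lemma enorm_sq_eq_lintegral (u : L2T) :
    ‖u‖ₑ ^ 2 = ∫⁻ x, ‖u x‖ₑ ^ 2 ∂AddCircle.haarAddCircle := by
  rw [Lp.enorm_def, eLpNorm_eq_lintegral_rpow_enorm_toReal (by norm_num) (by norm_num)]
  simp only [ENNReal.toReal_ofNat, ENNReal.rpow_ofNat]
  rw [← ENNReal.rpow_natCast, ← ENNReal.rpow_mul]
  norm_num

/-- Weak measurability with respect to the Fourier basis implies strong measurability. -/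
lemma aestronglyMeasurable_of_coeff {X : Type*} [MeasurableSpace X] {μ : Measure X} {f : X → L2T}
    (h : ∀ k, AEStronglyMeasurable (fun s => coeff (f s) k) μ) : AEStronglyMeasurable f μ := by
  refine aestronglyMeasurable_of_tendsto_ae (u := atTop)
    (f := fun (s : Finset ℤ) x => ∑ k ∈ s, coeff (f x) k • phi k) (fun s => ?_)
    (ae_of_all _ fun x => hasSum_coeff_smul_phi (f x))
  refine Finset.aestronglyMeasurable_fun_sum _ fun k _ => ?_
  exact (h k).smul_const _

/-! ### The semigroup -/

lemma norm_exp_semigroup (ν t : ℝ) (k : ℤ) :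
    ‖Complex.exp (-((1 + ν * Complex.I) * lam k * t))‖ = Real.exp (-(lam k * t)) := by
  rw [Complex.norm_exp]
  congr 1
  simp [Complex.mul_re, Complex.mul_im]

lemma norm_exp_semigroup_le_one {ν t : ℝ} (ht : 0 ≤ t) (k : ℤ) :
    ‖Complex.exp (-((1 + ν * Complex.I) * lam k * t))‖ ≤ 1 := by
  rw [norm_exp_semigroup, Real.exp_le_one_iff]
  have := mul_nonneg (lam_nonneg k) ht
  linarith

lemma summable_semigroup {ν t : ℝ} (ht : 0 ≤ t) (u : L2T) :
    Summable fun k => ‖Complex.exp (-((1 + ν * Complex.I) * lam k * t)) * coeff u k‖ ^ 2 := by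
  refine (summable_norm_coeff_sq u).of_nonneg_of_le (fun _ => by positivity) fun k => ?_
  rw [norm_mul]
  gcongr
  exact mul_le_of_le_one_left (norm_nonneg _) (norm_exp_semigroup_le_one ht k)

lemma coeff_semigroup {ν t : ℝ} (ht : 0 ≤ t) (u : L2T) (k : ℤ) :
    coeff (semigroup ν t u) k =
      Complex.exp (-((1 + ν * Complex.I) * lam k * t)) * coeff u k :=
  coeff_ofCoeff (summable_semigroup ht u) k

lemma enorm_semigroup_le {ν t : ℝ} (ht : 0 ≤ t) (u : L2T) : ‖semigroup ν t u‖ₑ ≤ ‖u‖ₑ := by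
  rw [← ENNReal.pow_le_pow_left_iff two_ne_zero, enorm_sq_eq_tsum, enorm_sq_eq_tsum]
  refine ENNReal.tsum_le_tsum fun k => ?_
  gcongr
  rw [coeff_semigroup ht, enorm_mul]
  refine mul_le_of_le_one_left zero_le ?_
  rw [← ofReal_norm]
  exact ENNReal.ofReal_le_one.2 (norm_exp_semigroup_le_one ht k)

/-- The Duhamel integrand `s ↦ e^{(t-s)A} f(s)` is integrable on `(0, t]` when `f` is. -/
lemma integrableOn_semigroup {ν T t : ℝ} (ht : t ∈ Icc 0 T) {f : ℝ → L2T}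
    (hf : IntegrableOn f (Ioc 0 T)) :
    IntegrableOn (fun s => semigroup ν (t - s) (f s)) (Ioc 0 t) := by
  have hf' : IntegrableOn f (Ioc 0 t) := hf.mono_set (Ioc_subset_Ioc_right ht.2)
  refine Integrable.mono' hf'.norm ?_ ?_
  · refine aestronglyMeasurable_of_coeff fun k => ?_
    have : AEStronglyMeasurable (fun s => Complex.exp (-((1 + ν * Complex.I) * lam k *
        ((t - s : ℝ) : ℂ))) * coeff (f s) k) (volume.restrict (Ioc 0 t)) := by
      refine AEStronglyMeasurable.mul ?_ ?_
      · exact (by fun_prop : Continuous fun s : ℝ => Complex.exp (-((1 + ν * Complex.I) * lam k *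
          ((t - s : ℝ) : ℂ)))).aestronglyMeasurable
      · exact (continuous_coeff k).comp_aestronglyMeasurable hf'.aestronglyMeasurable
    refine this.congr ?_
    filter_upwards [ae_restrict_mem measurableSet_Ioc] with s hs
    rw [coeff_semigroup (by linarith [hs.2])]
  · filter_upwards [ae_restrict_mem measurableSet_Ioc] with s hs
    have := enorm_semigroup_le (ν := ν) (t := t - s) (by linarith [hs.2]) (f s)
    exact enorm_le_iff_norm_le.1 this

/-- The Fourier coefficients of the Duhamel integral. -/
lemma coeff_duhamel {ν T t : ℝ} (ht : t ∈ Icc 0 T) {f : ℝ → L2T}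
    (hf : IntegrableOn f (Ioc 0 T)) (k : ℤ) :
    coeff (∫ s in (0 : ℝ)..t, semigroup ν (t - s) (f s)) k =
      ∫ s in (0 : ℝ)..t, Complex.exp (-((1 + ν * Complex.I) * lam k * ((t - s : ℝ) : ℂ))) *
        coeff (f s) k := by
  rw [← coeffL_apply, intervalIntegral.integral_of_le ht.1, intervalIntegral.integral_of_le ht.1,
    ← ContinuousLinearMap.integral_comp_comm _ (integrableOn_semigroup ht hf)]
  refine setIntegral_congr_fun measurableSet_Ioc fun s hs => ?_
  simp only [coeffL_apply]
  rw [coeff_semigroup (by linarith [hs.2])]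

/-! ### Sobolev norms and the sup norm -/

lemma sobolevSq_one (u : L2T) :
    sobolevSq 1 u = ∑' k, ENNReal.ofReal ((1 + lam k) * ‖coeff u k‖ ^ 2) := by
  simp [sobolevSq]

lemma sobolevSq_two (u : L2T) :
    sobolevSq 2 u = ∑' k, ENNReal.ofReal ((1 + lam k) ^ 2 * ‖coeff u k‖ ^ 2) := by
  simp [sobolevSq]

lemma sum_range_inv_sq_le {b : ℝ} (hb : 0 < b) (n : ℕ) :
    ∑ j ∈ Finset.range n, 1 / (b + (j + 1)) ^ 2 ≤ 1 / b - 1 / (b + n) := by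
  induction n with
  | zero => simp
  | succ n ih =>
    rw [Finset.sum_range_succ]
    push_cast
    have h1 : 0 < b + n := by positivity
    have h2 : 0 < b + (n + 1) := by positivity
    have : 1 / (b + (n + 1)) ^ 2 ≤ 1 / (b + n) - 1 / (b + (n + 1)) := by
      rw [div_sub_div _ _ h1.ne' h2.ne', div_le_div_iff₀ (by positivity) (by positivity)]
      nlinarith
    linarith

/-- The weights in Agmon's inequality: `∑_k (a + λ_k)⁻¹` decays like `a^{-1/2}`. -/
lemma sum_inv_add_lam_le {a : ℝ} (ha : 1 ≤ a) (s : Finset ℤ) :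
    ∑ k ∈ s, 1 / (a + lam k) ≤ 5 / √a := by
  set b := √a with hb
  have hb1 : 1 ≤ b := Real.one_le_sqrt.2 ha
  have hab : a = b ^ 2 := (Real.sq_sqrt (by linarith)).symm
  -- `a + k² ≥ (b + |k|)² / 2`, and `∑ (b + j)⁻²` is dominated by a telescoping sum
  have hterm : ∀ j : ℕ, ∀ k : ℤ, k.natAbs = j + 1 →
      1 / (a + lam k) ≤ 2 * (1 / (b + (j + 1)) ^ 2) := by
    intro j k hk
    have hk2 : (k : ℝ) ^ 2 = ((j : ℝ) + 1) ^ 2 := by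
      have : ((k.natAbs : ℕ) : ℝ) ^ 2 = (k : ℝ) ^ 2 := by
        rw [Nat.cast_natAbs]; push_cast; rw [sq_abs]
      rw [← this, hk]; push_cast; ring
    have h1 := sq_le_lam k
    rw [← mul_div_assoc, div_le_div_iff₀ (by nlinarith) (by positivity)]
    nlinarith [sq_nonneg (b - (j + 1))]
  set n := s.sup Int.natAbs with hn
  have hsub : s ⊆ insert 0 ((Finset.range n).image (fun j : ℕ => ((j : ℤ) + 1)) ∪
      (Finset.range n).image (fun j : ℕ => (-((j : ℤ) + 1)))) := by
    intro k hk
    have hkn : k.natAbs ≤ n := Finset.le_sup (f := Int.natAbs) hk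
    simp only [Finset.mem_insert, Finset.mem_union, Finset.mem_image, Finset.mem_range]
    rcases lt_trichotomy k 0 with h | h | h
    · exact Or.inr (Or.inr ⟨k.natAbs - 1, by omega, by omega⟩)
    · exact Or.inl h
    · exact Or.inr (Or.inl ⟨k.natAbs - 1, by omega, by omega⟩)
  have hnn : ∀ k : ℤ, 0 ≤ 1 / (a + lam k) := fun k => by
    have := lam_nonneg k
    positivity
  have hsum := sum_range_inv_sq_le (b := b) (by linarith) n
  have hle : ∑ j ∈ Finset.range n, 1 / (b + ((j : ℝ) + 1)) ^ 2 ≤ 1 / b := by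
    have : 0 ≤ 1 / (b + n) := by positivity
    linarith
  calc ∑ k ∈ s, 1 / (a + lam k)
      ≤ ∑ k ∈ insert 0 ((Finset.range n).image (fun j : ℕ => ((j : ℤ) + 1)) ∪
      (Finset.range n).image (fun j : ℕ => (-((j : ℤ) + 1)))), 1 / (a + lam k) :=
        Finset.sum_le_sum_of_subset_of_nonneg hsub fun k _ _ => hnn k
    _ ≤ 1 / (a + lam 0) + ∑ k ∈ (Finset.range n).image (fun j : ℕ => ((j : ℤ) + 1)) ∪
      (Finset.range n).image (fun j : ℕ => (-((j : ℤ) + 1))), 1 / (a + lam k) := by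
        rw [Finset.sum_insert]
        simp only [Finset.mem_union, Finset.mem_image, Finset.mem_range, not_or, not_exists]
        exact ⟨fun j => by omega, fun j => by omega⟩
    _ ≤ 1 / (a + lam 0) + (∑ k ∈ (Finset.range n).image (fun j : ℕ => ((j : ℤ) + 1)),
          1 / (a + lam k) + ∑ k ∈ (Finset.range n).image (fun j : ℕ => (-((j : ℤ) + 1))),
          1 / (a + lam k)) := by
        gcongr
        rw [← Finset.sum_union_inter]
        have := Finset.sum_nonneg (s := (Finset.range n).image (fun j : ℕ => ((j : ℤ) + 1)) ∩
          (Finset.range n).image (fun j : ℕ => (-((j : ℤ) + 1)))) fun k _ => hnn k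
        linarith
    _ ≤ 1 / b + (2 * (1 / b) + 2 * (1 / b)) := by
        gcongr
        · rw [lam_zero, add_zero, hab]; nlinarith
        · rw [Finset.sum_image (fun i _ j _ h => by simpa using h)]
          refine le_trans (Finset.sum_le_sum fun j _ => hterm j _ (by omega)) ?_
          rw [← Finset.mul_sum]
          gcongr
        · rw [Finset.sum_image (fun i _ j _ h => by simpa using h)]
          refine le_trans (Finset.sum_le_sum fun j _ => hterm j _ (by omega)) ?_
          rw [← Finset.mul_sum]
          gcongr
    _ = 5 / b := by ring

/-- `∑ (1 + λ_k) |u_k|²` as a real number (with the value `0` when it is infinite). -/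
def h1Sq (u : L2T) : ℝ := (sobolevSq 1 u).toReal

lemma hasSum_h1Sq {u : L2T} (hu : sobolevSq 1 u < ∞) :
    HasSum (fun k => (1 + lam k) * ‖coeff u k‖ ^ 2) (h1Sq u) := by
  have hnn : ∀ k, 0 ≤ (1 + lam k) * ‖coeff u k‖ ^ 2 := fun k => by
    have := lam_nonneg k; positivity
  rw [h1Sq, sobolevSq_one]
  rw [sobolevSq_one] at hu
  have hs : Summable fun k => (1 + lam k) * ‖coeff u k‖ ^ 2 := by
    have := ENNReal.summable_toReal hu.ne
    simpa only [ENNReal.toReal_ofReal (hnn _)] using this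
  rw [← ENNReal.ofReal_tsum_of_nonneg hnn hs, ENNReal.toReal_ofReal (tsum_nonneg hnn)]
  exact hs.hasSum

lemma h1Sq_nonneg (u : L2T) : 0 ≤ h1Sq u := ENNReal.toReal_nonneg

lemma ofReal_h1Sq {u : L2T} (hu : sobolevSq 1 u < ∞) : ENNReal.ofReal (h1Sq u) = sobolevSq 1 u :=
  ENNReal.ofReal_toReal hu.ne

lemma norm_sq_le_h1Sq {u : L2T} (hu : sobolevSq 1 u < ∞) : ‖u‖ ^ 2 ≤ h1Sq u :=
  hasSum_le (fun k => by nlinarith [lam_nonneg k, sq_nonneg ‖coeff u k‖])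
    (hasSum_norm_coeff_sq u) (hasSum_h1Sq hu)

/-- Agmon's inequality for finite sums of Fourier coefficients: Cauchy-Schwarz with the weights
`a + λ_k`, optimized in `a`. -/
lemma sum_norm_coeff_sq_le {u : L2T} (hu : sobolevSq 1 u < ∞) (s : Finset ℤ) :
    (∑ k ∈ s, ‖coeff u k‖) ^ 2 ≤ 10 * (‖u‖ * √(h1Sq u)) := by
  rcases eq_or_ne u 0 with rfl | hu0
  · simp [coeff_zero]
  have hpos : 0 < ‖u‖ := norm_pos_iff.2 hu0
  have hle := norm_sq_le_h1Sq hu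
  set h := √(h1Sq u) with hh
  have hh2 : h ^ 2 = h1Sq u := Real.sq_sqrt (h1Sq_nonneg u)
  have hhpos : 0 < h := Real.sqrt_pos.2 (lt_of_lt_of_le (by positivity) hle)
  have hnh : ‖u‖ ≤ h := Real.le_sqrt_of_sq_le hle
  set a := (h / ‖u‖) ^ 2 with ha
  have ha1 : 1 ≤ a := one_le_pow₀ ((one_le_div hpos).2 hnh)
  have hsa : √a = h / ‖u‖ := Real.sqrt_sq (by positivity)
  have hcs : (∑ k ∈ s, ‖coeff u k‖) ^ 2 ≤
      (∑ k ∈ s, 1 / (a + lam k)) * ∑ k ∈ s, (a + lam k) * ‖coeff u k‖ ^ 2 := by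
    refine Finset.sum_sq_le_sum_mul_sum_of_sq_le_mul s (fun k _ => ?_) (fun k _ => ?_) fun k _ => ?_
    · have := lam_nonneg k; positivity
    · have := lam_nonneg k; positivity
    · have := lam_nonneg k
      have : a + lam k ≠ 0 := by positivity
      refine le_of_eq ?_
      field_simp
  have h2 : ∑ k ∈ s, (a + lam k) * ‖coeff u k‖ ^ 2 ≤ a * ‖u‖ ^ 2 + h ^ 2 := by
    have h3 := ((hasSum_norm_coeff_sq u).mul_left a).add (hasSum_h1Sq hu)
    rw [hh2]
    refine le_trans (Finset.sum_le_sum fun k _ => ?_) (sum_le_hasSum s (fun k _ => ?_) h3)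
    · nlinarith [lam_nonneg k, sq_nonneg ‖coeff u k‖]
    · have := lam_nonneg k; positivity
  calc _ ≤ (5 / √a) * (a * ‖u‖ ^ 2 + h ^ 2) := by
        refine hcs.trans (mul_le_mul (sum_inv_add_lam_le ha1 s) h2 ?_ (by positivity))
        exact Finset.sum_nonneg fun k _ => by have := lam_nonneg k; positivity
    _ = 10 * (‖u‖ * h) := by
        rw [hsa, ha]
        field_simp
        ring

lemma summable_norm_coeff {u : L2T} (hu : sobolevSq 1 u < ∞) : Summable fun k => ‖coeff u k‖ := by
  refine summable_of_sum_le (c := √(10 * (‖u‖ * √(h1Sq u)))) (fun _ => norm_nonneg _) fun s => ?_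
  exact Real.le_sqrt_of_sq_le (sum_norm_coeff_sq_le hu s)

/-- A function with absolutely summable Fourier coefficients is bounded by their sum. -/
lemma ae_norm_le_tsum_coeff {u : L2T} (hu : Summable fun k => ‖coeff u k‖) :
    ∀ᵐ x ∂AddCircle.haarAddCircle, ‖u x‖ ≤ ∑' k, ‖coeff u k‖ := by
  have hs : Summable fun k => coeff u k • (fourier k : C(UnitAddCircle, ℂ)) := by
    refine Summable.of_norm ?_
    simpa [norm_smul, fourier_norm] using hu
  set g : C(UnitAddCircle, ℂ) := ∑' k, coeff u k • fourier k with hg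
  have h1 : HasSum (fun k => coeff u k • phi k)
      (ContinuousMap.toLp (E := ℂ) 2 AddCircle.haarAddCircle ℂ g) := by
    have := (ContinuousMap.toLp (E := ℂ) 2 AddCircle.haarAddCircle ℂ).hasSum hs.hasSum
    simpa [phi, fourierLp] using this
  have h2 : u = ContinuousMap.toLp (E := ℂ) 2 AddCircle.haarAddCircle ℂ g :=
    (hasSum_coeff_smul_phi u).unique h1
  have h3 := ContinuousMap.coeFn_toLp (p := 2) (𝕜 := ℂ) AddCircle.haarAddCircle g
  rw [← h2] at h3
  filter_upwards [h3] with x hx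
  rw [hx]
  refine (g.norm_coe_le_norm x).trans ?_
  refine (norm_tsum_le_tsum_norm ?_).trans (le_of_eq ?_)
  · simpa [norm_smul, fourier_norm] using hu
  · simp [norm_smul, fourier_norm]

/-- **Agmon's inequality** `‖u‖_∞² ≤ C ‖u‖ ‖u‖_{H¹}` on the torus. -/
lemma ae_norm_sq_le {u : L2T} (hu : sobolevSq 1 u < ∞) :
    ∀ᵐ x ∂AddCircle.haarAddCircle, ‖u x‖ ^ 2 ≤ 10 * (‖u‖ * √(h1Sq u)) := by
  filter_upwards [ae_norm_le_tsum_coeff (summable_norm_coeff hu)] with x hx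
  refine (pow_le_pow_left₀ (norm_nonneg _) hx 2).trans ?_
  have h := (summable_norm_coeff hu).hasSum.pow 2
  exact le_of_tendsto' h fun s => sum_norm_coeff_sq_le hu s

/-! ### Pointwise bounds for the nonlinearity -/

/-- The modulus `|1 + iμ|` of the coefficient of the cubic term. -/
def cubicNorm (μ : ℝ) : ℝ := ‖(1 + μ * Complex.I : ℂ)‖

lemma one_le_cubicNorm (μ : ℝ) : 1 ≤ cubicNorm μ := by
  have := Complex.abs_re_le_norm (1 + μ * Complex.I : ℂ)
  simpa [cubicNorm] using this

lemma continuous_psi (R μ : ℝ) : Continuous (psi R μ) := by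
  unfold psi
  fun_prop

/-- A Lipschitz constant for `psi`, up to the factor `1 + |z|² + |z'|²`. -/
def psiLip (R μ : ℝ) : ℝ := |R| + 2 * cubicNorm μ

lemma psiLip_nonneg (R μ : ℝ) : 0 ≤ psiLip R μ := by
  have := one_le_cubicNorm μ
  have := abs_nonneg R
  unfold psiLip
  linarith

lemma norm_psi_sub_le (R μ : ℝ) (z w : ℂ) :
    ‖psi R μ z - psi R μ w‖ ≤ psiLip R μ * (1 + ‖z‖ ^ 2 + ‖w‖ ^ 2) * ‖z - w‖ := by
  have hm := one_le_cubicNorm μ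
  have e : psi R μ z - psi R μ w = R * (z - w) - (1 + μ * Complex.I) *
      ((‖z‖ : ℂ) ^ 2 * (z - w) + (((‖z‖ - ‖w‖) * (‖z‖ + ‖w‖) : ℝ) : ℂ) * w) := by
    unfold psi
    push_cast
    ring
  have h1 : ‖(‖z‖ : ℂ) ^ 2 * (z - w) + (((‖z‖ - ‖w‖) * (‖z‖ + ‖w‖) : ℝ) : ℂ) * w‖ ≤
      2 * (‖z‖ ^ 2 + ‖w‖ ^ 2) * ‖z - w‖ := by
    refine (norm_add_le _ _).trans ?_
    rw [norm_mul, norm_mul, norm_pow, Complex.norm_real, Complex.norm_real, norm_norm,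
      Real.norm_eq_abs, abs_mul, abs_of_nonneg (a := ‖z‖ + ‖w‖) (by positivity)]
    have h2 := abs_norm_sub_norm_le z w
    have h3 : |‖z‖ - ‖w‖| * (‖z‖ + ‖w‖) * ‖w‖ ≤ ‖z - w‖ * (‖z‖ + ‖w‖) * ‖w‖ := by gcongr
    nlinarith [norm_nonneg (z - w), sq_nonneg (‖z‖ - ‖w‖), norm_nonneg z, norm_nonneg w,
      mul_nonneg (norm_nonneg (z - w)) (sq_nonneg (‖z‖ - ‖w‖)),
      mul_nonneg (norm_nonneg (z - w)) (sq_nonneg ‖z‖),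
      mul_nonneg (norm_nonneg (z - w)) (sq_nonneg ‖w‖)]
  rw [e]
  refine (norm_sub_le _ _).trans ?_
  rw [norm_mul, norm_mul, Complex.norm_real, Real.norm_eq_abs]
  change |R| * ‖z - w‖ + cubicNorm μ * _ ≤ _
  have h4 := mul_le_mul_of_nonneg_left h1 (by linarith : 0 ≤ cubicNorm μ)
  unfold psiLip
  have h5 : 0 ≤ |R| * ((‖z‖ ^ 2 + ‖w‖ ^ 2) * ‖z - w‖) := by positivity
  have h6 : 0 ≤ cubicNorm μ * ‖z - w‖ := by positivity
  nlinarith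

/-- The nonlinearity controls the cube of its argument, so that `psi ∘ w ∈ L²` implies `w ∈ L⁶`. -/
lemma norm_cube_le {R : ℝ} (hR : 0 ≤ R) (μ : ℝ) (z : ℂ) :
    ‖z‖ ^ 3 ≤ ‖psi R μ z‖ + R * ‖z‖ := by
  have hm := one_le_cubicNorm μ
  have h1 : cubicNorm μ * ‖z‖ ^ 3 = ‖R * z - psi R μ z‖ := by
    have : R * z - psi R μ z = (1 + μ * Complex.I) * ((‖z‖ : ℂ) ^ 2 * z) := by
      unfold psi; ring
    rw [this, norm_mul, norm_mul, norm_pow, Complex.norm_real, norm_norm, cubicNorm]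
    ring
  have h2 := norm_sub_le (R * z) (psi R μ z)
  rw [← h1, norm_mul, Complex.norm_real, Real.norm_eq_abs, abs_of_nonneg hR] at h2
  have : 0 ≤ ‖z‖ ^ 3 := by positivity
  nlinarith

/-- The constant in the sextic growth bound for `|psi|²`. -/
def psiGrowth (R μ : ℝ) : ℝ := 64 * (R ^ 2 + cubicNorm μ ^ 2)

lemma psiGrowth_nonneg (R μ : ℝ) : 0 ≤ psiGrowth R μ := by unfold psiGrowth; positivity

lemma norm_psi_add_sq_le (R μ : ℝ) (v z : ℂ) :
    ‖psi R μ (v + z)‖ ^ 2 ≤ psiGrowth R μ * (1 + ‖v‖ ^ 6 + ‖z‖ ^ 6) := by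
  set w := v + z with hw
  have h1 : ‖psi R μ w‖ ≤ |R| * ‖w‖ + cubicNorm μ * ‖w‖ ^ 3 := by
    unfold psi
    refine (norm_sub_le _ _).trans (le_of_eq ?_)
    rw [norm_mul, norm_mul, norm_mul, norm_pow, Complex.norm_real, Complex.norm_real, norm_norm,
      Real.norm_eq_abs, cubicNorm]
    ring
  have h2 : ‖psi R μ w‖ ^ 2 ≤ 2 * (R ^ 2 + cubicNorm μ ^ 2) * (1 + ‖w‖ ^ 6) := by
    have h3 : ‖psi R μ w‖ ^ 2 ≤ (|R| * ‖w‖ + cubicNorm μ * ‖w‖ ^ 3) ^ 2 := by gcongr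
    have h4 : (|R| * ‖w‖ + cubicNorm μ * ‖w‖ ^ 3) ^ 2 ≤
        2 * (R ^ 2 * ‖w‖ ^ 2) + 2 * (cubicNorm μ ^ 2 * ‖w‖ ^ 6) := by
      have := sq_nonneg (|R| * ‖w‖ - cubicNorm μ * ‖w‖ ^ 3)
      have h5 := sq_abs R
      have h6 : (|R| * ‖w‖) ^ 2 = R ^ 2 * ‖w‖ ^ 2 := by rw [mul_pow, h5]
      nlinarith
    have h7 : ‖w‖ ^ 2 ≤ 1 + ‖w‖ ^ 6 := by
      rcases le_total (‖w‖ ^ 2) 1 with h | h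
      · have : 0 ≤ ‖w‖ ^ 6 := by positivity
        linarith
      · nlinarith [sq_nonneg (‖w‖ ^ 2 - 1)]
    have h8 := mul_le_mul_of_nonneg_left h7 (sq_nonneg R)
    nlinarith [sq_nonneg (cubicNorm μ)]
  have h9 : ‖w‖ ^ 6 ≤ 32 * (‖v‖ ^ 6 + ‖z‖ ^ 6) := by
    calc ‖w‖ ^ 6 ≤ (‖v‖ + ‖z‖) ^ 6 := by gcongr; exact norm_add_le _ _
      _ ≤ 2 ^ (6 - 1) * (‖v‖ ^ 6 + ‖z‖ ^ 6) := add_pow_le (norm_nonneg _) (norm_nonneg _) 6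
      _ = _ := by norm_num
  have h10 : 0 ≤ R ^ 2 + cubicNorm μ ^ 2 := by positivity
  unfold psiGrowth
  have := mul_le_mul_of_nonneg_left h9 h10
  nlinarith

/-- The constant in the dissipativity bound for `psi`. -/
def psiDiss (R μ : ℝ) : ℝ := 3 * R ^ 2 + |R| + cubicNorm μ ^ 4

lemma psiDiss_nonneg (R μ : ℝ) : 0 ≤ psiDiss R μ := by unfold psiDiss; positivity

/-- Dissipativity: the cubic term absorbs all terms containing `v`. -/
lemma re_psi_mul_conj_le (R μ : ℝ) (v z : ℂ) :
    (psi R μ (v + z) * (starRingEnd ℂ) v).re ≤ psiDiss R μ * (1 + ‖z‖ ^ 4) := by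
  set w := v + z with hw
  have hv : v = w - z := by rw [hw]; ring
  have hm := one_le_cubicNorm μ
  set a := ‖w‖ with ha
  set b := ‖z‖ with hb
  have ha0 : 0 ≤ a := norm_nonneg _
  have hb0 : 0 ≤ b := norm_nonneg _
  have e : psi R μ w * (starRingEnd ℂ) v = ((R * a ^ 2 - a ^ 4 : ℝ) : ℂ) -
      (μ * a ^ 4 : ℝ) * Complex.I - psi R μ w * (starRingEnd ℂ) z := by
    have h := Complex.mul_conj w
    rw [Complex.normSq_eq_norm_sq, ← ha] at h
    rw [hv, map_sub, mul_sub]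
    have : psi R μ w * (starRingEnd ℂ) w =
        (R - (1 + μ * Complex.I) * (a : ℂ) ^ 2) * (w * (starRingEnd ℂ) w) := by
      unfold psi; rw [← ha]; ring
    rw [this, h]
    push_cast
    ring
  have h1 : ‖psi R μ w * (starRingEnd ℂ) z‖ ≤ (|R| * a + cubicNorm μ * a ^ 3) * b := by
    rw [norm_mul, RCLike.norm_conj]
    gcongr
    unfold psi
    refine (norm_sub_le _ _).trans (le_of_eq ?_)
    rw [norm_mul, norm_mul, norm_mul, norm_pow, Complex.norm_real, Complex.norm_real, norm_norm,
      Real.norm_eq_abs, cubicNorm, ← ha]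
    ring
  have h2 : (psi R μ w * (starRingEnd ℂ) v).re ≤
      R * a ^ 2 - a ^ 4 + (|R| * a + cubicNorm μ * a ^ 3) * b := by
    have h3 := (abs_le.1 ((Complex.abs_re_le_norm _).trans h1)).1
    rw [e, Complex.sub_re, Complex.sub_re, Complex.ofReal_re, Complex.re_ofReal_mul,
      Complex.I_re, mul_zero]
    linarith
  refine h2.trans ?_
  have hR : R ≤ |R| := le_abs_self R
  have hRsq : |R| ^ 2 = R ^ 2 := sq_abs R
  set r := |R| with hr
  have hr0 : 0 ≤ r := abs_nonneg R
  set m := cubicNorm μ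
  -- Young's inequality `a³ (m b) ≤ 3/4 a⁴ + 1/4 (m b)⁴`
  have y1 : a ^ 3 * (m * b) ≤ 3 / 4 * a ^ 4 + 1 / 4 * (m * b) ^ 4 := by
    have hs : 0 ≤ m * b := by positivity
    set s := m * b
    have : 3 * a ^ 4 + s ^ 4 - 4 * a ^ 3 * s = (a - s) ^ 2 * (3 * a ^ 2 + 2 * a * s + s ^ 2) := by
      ring
    have : 0 ≤ (a - s) ^ 2 * (3 * a ^ 2 + 2 * a * s + s ^ 2) := by positivity
    linarith
  have y2 : r * a * b ≤ r / 2 * a ^ 2 + r / 2 * b ^ 2 := by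
    nlinarith [mul_nonneg hr0 (sq_nonneg (a - b))]
  have y3 : 3 / 2 * r * a ^ 2 ≤ 1 / 4 * a ^ 4 + 9 / 4 * r ^ 2 := by
    nlinarith [sq_nonneg (a ^ 2 / 2 - 3 / 2 * r)]
  have y4 : b ^ 2 ≤ 1 + b ^ 4 := by nlinarith [sq_nonneg (b ^ 2 - 1)]
  have y5 : R * a ^ 2 ≤ r * a ^ 2 := by gcongr
  have y6 : (m * b) ^ 4 = m ^ 4 * b ^ 4 := by ring
  have y7 : 0 ≤ m ^ 4 * b ^ 4 := by positivity
  have y8 : 0 ≤ m ^ 4 := by positivity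
  have y9 : 0 ≤ r ^ 2 * b ^ 4 := by positivity
  have y10 := mul_le_mul_of_nonneg_left y4 hr0
  have y11 : 0 ≤ r * b ^ 4 := by positivity
  unfold psiDiss
  rw [← hRsq]
  nlinarith

/-! ### The nonlinearity on `L²` -/

/-- `psi ∘ w` is square integrable. -/
def PsiMem (R μ : ℝ) (w : L2T) : Prop :=
  MemLp (fun x => psi R μ (w x)) 2 AddCircle.haarAddCircle

lemma PsiMem.coeFn_psiL2 {R μ : ℝ} {w : L2T} (h : PsiMem R μ w) :
    psiL2 R μ w =ᵐ[AddCircle.haarAddCircle] fun x => psi R μ (w x) := by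
  have h' : MemLp (fun x => psi R μ (w x)) 2 AddCircle.haarAddCircle := h
  unfold psiL2
  rw [dif_pos h']
  exact h'.coeFn_toLp

lemma aestronglyMeasurable_psi (R μ : ℝ) (w : L2T) :
    AEStronglyMeasurable (fun x => psi R μ (w x)) AddCircle.haarAddCircle :=
  (continuous_psi R μ).comp_aestronglyMeasurable (Lp.aestronglyMeasurable w)

lemma psiMem_of_bounded {R μ B : ℝ} {w : L2T}
    (h : ∀ᵐ x ∂AddCircle.haarAddCircle, ‖w x‖ ≤ B) : PsiMem R μ w := by
  obtain ⟨C, hC⟩ := (isCompact_closedBall (0 : ℂ) B).exists_bound_of_continuousOn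
    (continuous_psi R μ).continuousOn
  refine MemLp.of_bound (aestronglyMeasurable_psi R μ w) C ?_
  filter_upwards [h] with x hx
  exact hC _ (by simpa using hx)

lemma ae_norm_le {u : L2T} (hu : sobolevSq 1 u < ∞) :
    ∀ᵐ x ∂AddCircle.haarAddCircle, ‖u x‖ ≤ √(10 * (‖u‖ * √(h1Sq u))) := by
  filter_upwards [ae_norm_sq_le hu] with x hx
  exact Real.le_sqrt_of_sq_le hx

lemma psiMem_of_sobolev {R μ : ℝ} {w : L2T} (h : sobolevSq 1 w < ∞) : PsiMem R μ w :=
  psiMem_of_bounded (ae_norm_le h)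

lemma enorm_coeff_le_lintegral (u : L2T) (k : ℤ) :
    ‖coeff u k‖ₑ ≤ ∫⁻ x, ‖u x‖ₑ ∂AddCircle.haarAddCircle := by
  unfold coeff fourierCoeff
  refine (enorm_integral_le_lintegral_enorm _).trans (le_of_eq ?_)
  refine lintegral_congr fun x => ?_
  rw [enorm_smul]
  have : ‖(fourier (-k) x : ℂ)‖ₑ = 1 := by
    rw [← ofReal_norm, fourier_apply, Circle.norm_coe, ENNReal.ofReal_one]
  rw [this, one_mul]

lemma lintegral_mul_le_sqrt {X : Type*} [MeasurableSpace X] {m : Measure X} {f g : X → ℝ≥0∞}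
    (hf : AEMeasurable f m) (hg : AEMeasurable g m) :
    ∫⁻ x, f x * g x ∂m ≤ (∫⁻ x, f x ^ 2 ∂m) ^ (1 / 2 : ℝ) * (∫⁻ x, g x ^ 2 ∂m) ^ (1 / 2 : ℝ) := by
  have := ENNReal.lintegral_mul_le_Lp_mul_Lq m Real.HolderConjugate.two_two hf hg
  simpa using this

lemma lintegral_enorm_sq_sqrt (u : L2T) :
    (∫⁻ x, ‖u x‖ₑ ^ 2 ∂AddCircle.haarAddCircle) ^ (1 / 2 : ℝ) = ‖u‖ₑ := by
  rw [← enorm_sq_eq_lintegral, ← ENNReal.rpow_natCast, ← ENNReal.rpow_mul]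
  norm_num

/-- A bound for `‖w‖_{L⁴}⁴` in terms of `‖w‖` and `‖psi ∘ w‖`. -/
def quarticBound (R μ : ℝ) (w : L2T) : ℝ≥0∞ :=
  ‖w‖ₑ * (‖psiL2 R μ w‖ₑ + ENNReal.ofReal R * ‖w‖ₑ)

lemma lintegral_quartic_le {R μ : ℝ} (hR : 0 ≤ R) {w : L2T} (hw : PsiMem R μ w) :
    ∫⁻ x, ‖w x‖ₑ ^ 4 ∂AddCircle.haarAddCircle ≤ quarticBound R μ w := by
  have hm := (Lp.aestronglyMeasurable w).enorm
  have hm' := (Lp.aestronglyMeasurable (psiL2 R μ w)).enorm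
  have h1 : ∀ᵐ x ∂AddCircle.haarAddCircle, ‖w x‖ₑ ^ 4 ≤
      ‖w x‖ₑ * ‖psiL2 R μ w x‖ₑ + ENNReal.ofReal R * (‖w x‖ₑ * ‖w x‖ₑ) := by
    filter_upwards [hw.coeFn_psiL2] with x hx
    rw [hx]
    have h2 := norm_cube_le hR μ (w x)
    simp only [← ofReal_norm]
    rw [← ENNReal.ofReal_pow (norm_nonneg _), ← ENNReal.ofReal_mul (norm_nonneg _),
      ← ENNReal.ofReal_mul (norm_nonneg _), ← ENNReal.ofReal_mul hR,
      ← ENNReal.ofReal_add (by positivity) (by positivity)]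
    refine ENNReal.ofReal_le_ofReal ?_
    nlinarith [norm_nonneg (w x)]
  calc _ ≤ ∫⁻ x, (‖w x‖ₑ * ‖psiL2 R μ w x‖ₑ + ENNReal.ofReal R * (‖w x‖ₑ * ‖w x‖ₑ))
          ∂AddCircle.haarAddCircle := lintegral_mono_ae h1
    _ = ∫⁻ x, ‖w x‖ₑ * ‖psiL2 R μ w x‖ₑ ∂AddCircle.haarAddCircle +
        ENNReal.ofReal R * ∫⁻ x, ‖w x‖ₑ * ‖w x‖ₑ ∂AddCircle.haarAddCircle := by
        have hmm : AEMeasurable (fun x => ‖w x‖ₑ * ‖psiL2 R μ w x‖ₑ) AddCircle.haarAddCircle :=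
          hm.mul hm'
        rw [lintegral_add_left' hmm, lintegral_const_mul' _ _ ENNReal.ofReal_ne_top]
    _ ≤ ‖w‖ₑ * ‖psiL2 R μ w‖ₑ + ENNReal.ofReal R * (‖w‖ₑ * ‖w‖ₑ) := by
        gcongr
        · refine (lintegral_mul_le_sqrt hm hm').trans (le_of_eq ?_)
          rw [lintegral_enorm_sq_sqrt, lintegral_enorm_sq_sqrt]
        · refine (lintegral_mul_le_sqrt hm hm).trans (le_of_eq ?_)
          rw [lintegral_enorm_sq_sqrt]
    _ = _ := by rw [quarticBound]; ring

/-- The local Lipschitz factor of `psi` as a map from `L²` to `L¹`. -/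
def lipFactor (R μ : ℝ) (w w' : L2T) : ℝ≥0∞ :=
  ENNReal.ofReal (psiLip R μ) *
    (3 * (1 + quarticBound R μ w + quarticBound R μ w')) ^ (1 / 2 : ℝ)

/-- The nonlinearity is locally Lipschitz from `L²` to `L¹`, hence in each Fourier coefficient. -/
lemma enorm_coeff_psiL2_sub_le {R μ : ℝ} (hR : 0 ≤ R) {w w' : L2T} (hw : PsiMem R μ w)
    (hw' : PsiMem R μ w') (k : ℤ) :
    ‖coeff (psiL2 R μ w) k - coeff (psiL2 R μ w') k‖ₑ ≤ lipFactor R μ w w' * ‖w - w'‖ₑ := by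
  have hm := (Lp.aestronglyMeasurable w).enorm
  have hm' := (Lp.aestronglyMeasurable w').enorm
  rw [← coeff_sub]
  refine (enorm_coeff_le_lintegral _ k).trans ?_
  have h1 : ∀ᵐ x ∂AddCircle.haarAddCircle, ‖(psiL2 R μ w - psiL2 R μ w') x‖ₑ ≤
      ENNReal.ofReal (psiLip R μ) * ((1 + ‖w x‖ₑ ^ 2 + ‖w' x‖ₑ ^ 2) * ‖(w - w') x‖ₑ) := by
    filter_upwards [hw.coeFn_psiL2, hw'.coeFn_psiL2, Lp.coeFn_sub w w',
      Lp.coeFn_sub (psiL2 R μ w) (psiL2 R μ w')] with x h1 h2 h3 h4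
    rw [h4, h3, Pi.sub_apply, Pi.sub_apply, h1, h2]
    simp only [← ofReal_norm]
    rw [← ENNReal.ofReal_pow (norm_nonneg _), ← ENNReal.ofReal_pow (norm_nonneg _),
      ← ENNReal.ofReal_one, ← ENNReal.ofReal_add (by positivity) (by positivity),
      ← ENNReal.ofReal_add (by positivity) (by positivity),
      ← ENNReal.ofReal_mul (by positivity), ← ENNReal.ofReal_mul (psiLip_nonneg _ _)]
    refine ENNReal.ofReal_le_ofReal ?_
    rw [← mul_assoc]
    exact norm_psi_sub_le R μ _ _
  have hq : ∫⁻ x, (1 + ‖w x‖ₑ ^ 2 + ‖w' x‖ₑ ^ 2) ^ 2 ∂AddCircle.haarAddCircle ≤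
      3 * (1 + quarticBound R μ w + quarticBound R μ w') := by
    calc _ ≤ ∫⁻ x, 3 * (1 + ‖w x‖ₑ ^ 4 + ‖w' x‖ₑ ^ 4) ∂AddCircle.haarAddCircle := by
          refine lintegral_mono fun x => ?_
          have h3 : (3 : ℝ≥0∞) = ENNReal.ofReal 3 := by simp
          simp only [← ofReal_norm]
          rw [← ENNReal.ofReal_pow (norm_nonneg _), ← ENNReal.ofReal_pow (norm_nonneg _),
            ← ENNReal.ofReal_pow (norm_nonneg _), ← ENNReal.ofReal_pow (norm_nonneg _),
            ← ENNReal.ofReal_one, h3,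
            ← ENNReal.ofReal_add (by positivity) (by positivity),
            ← ENNReal.ofReal_add (by positivity) (by positivity),
            ← ENNReal.ofReal_add (by positivity) (by positivity),
            ← ENNReal.ofReal_add (by positivity) (by positivity),
            ← ENNReal.ofReal_mul (by positivity), ← ENNReal.ofReal_pow (by positivity)]
          refine ENNReal.ofReal_le_ofReal ?_
          nlinarith [sq_nonneg (‖w x‖ ^ 2 - ‖w' x‖ ^ 2), sq_nonneg (‖w x‖ ^ 2 - 1),
            sq_nonneg (‖w' x‖ ^ 2 - 1)]
      _ = 3 * (1 + ∫⁻ x, ‖w x‖ₑ ^ 4 ∂AddCircle.haarAddCircle +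
            ∫⁻ x, ‖w' x‖ₑ ^ 4 ∂AddCircle.haarAddCircle) := by
          rw [lintegral_const_mul' _ _ (by norm_num),
            lintegral_add_right' _ (hm'.pow_const 4), lintegral_add_left' (by fun_prop)]
          simp
      _ ≤ _ := by
          gcongr
          · exact lintegral_quartic_le hR hw
          · exact lintegral_quartic_le hR hw'
  calc _ ≤ ∫⁻ x, ENNReal.ofReal (psiLip R μ) * ((1 + ‖w x‖ₑ ^ 2 + ‖w' x‖ₑ ^ 2) *
          ‖(w - w') x‖ₑ) ∂AddCircle.haarAddCircle := lintegral_mono_ae h1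
    _ = ENNReal.ofReal (psiLip R μ) * ∫⁻ x, (1 + ‖w x‖ₑ ^ 2 + ‖w' x‖ₑ ^ 2) *
          ‖(w - w') x‖ₑ ∂AddCircle.haarAddCircle :=
        lintegral_const_mul' _ _ ENNReal.ofReal_ne_top
    _ ≤ ENNReal.ofReal (psiLip R μ) *
          ((∫⁻ x, (1 + ‖w x‖ₑ ^ 2 + ‖w' x‖ₑ ^ 2) ^ 2 ∂AddCircle.haarAddCircle) ^ (1 / 2 : ℝ) *
            (∫⁻ x, ‖(w - w') x‖ₑ ^ 2 ∂AddCircle.haarAddCircle) ^ (1 / 2 : ℝ)) := by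
        gcongr
        exact lintegral_mul_le_sqrt (by fun_prop) (Lp.aestronglyMeasurable _).enorm
    _ ≤ _ := by
        rw [lintegral_enorm_sq_sqrt, lipFactor, mul_assoc]
        gcongr

lemma norm_psiL2_sub_le_of_bounded {R μ B : ℝ} {w w' : L2T}
    (h : ∀ᵐ x ∂AddCircle.haarAddCircle, ‖w x‖ ≤ B)
    (h' : ∀ᵐ x ∂AddCircle.haarAddCircle, ‖w' x‖ ≤ B) :
    ‖psiL2 R μ w - psiL2 R μ w'‖ ≤ psiLip R μ * (1 + 2 * B ^ 2) * ‖w - w'‖ := by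
  refine Lp.norm_le_mul_norm_of_ae_le_mul ?_
  filter_upwards [(psiMem_of_bounded h).coeFn_psiL2, (psiMem_of_bounded h').coeFn_psiL2,
    Lp.coeFn_sub w w', Lp.coeFn_sub (psiL2 R μ w) (psiL2 R μ w'), h, h'] with x h1 h2 h3 h4 h5 h6
  rw [h4, h3, Pi.sub_apply, Pi.sub_apply, h1, h2]
  refine (norm_psi_sub_le R μ _ _).trans ?_
  have := psiLip_nonneg R μ
  have h7 : ‖w x‖ ^ 2 ≤ B ^ 2 := by gcongr
  have h8 : ‖w' x‖ ^ 2 ≤ B ^ 2 := by gcongr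
  have h9 : 1 + ‖w x‖ ^ 2 + ‖w' x‖ ^ 2 ≤ 1 + 2 * B ^ 2 := by linarith
  gcongr

lemma integrable_norm_sq (u : L2T) :
    Integrable (fun x => ‖u x‖ ^ 2) AddCircle.haarAddCircle :=
  (Lp.memLp u).integrable_norm_pow (by norm_num)

/-- Growth of the nonlinearity: Agmon's inequality bounds `‖v‖_{L⁶}⁶` by `‖v‖⁴ ‖v‖²_{H¹}`. -/
lemma norm_psiL2_add_sq_le (R μ : ℝ) {v z : L2T} (hv : sobolevSq 1 v < ∞)
    (hz : sobolevSq 1 z < ∞) (hw : PsiMem R μ (v + z)) :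
    ‖psiL2 R μ (v + z)‖ ^ 2 ≤
      psiGrowth R μ * (1 + 100 * (‖v‖ ^ 4 * h1Sq v) + 100 * (‖z‖ ^ 4 * h1Sq z)) := by
  have hsix : ∀ {u : L2T} {x : UnitAddCircle}, ‖u x‖ ^ 2 ≤ 10 * (‖u‖ * √(h1Sq u)) →
      ‖u x‖ ^ 6 ≤ 100 * (‖u‖ ^ 2 * h1Sq u) * ‖u x‖ ^ 2 := by
    intro u x h
    have h1 : (‖u x‖ ^ 2) ^ 2 ≤ (10 * (‖u‖ * √(h1Sq u))) ^ 2 := by gcongr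
    have h2 : (10 * (‖u‖ * √(h1Sq u))) ^ 2 = 100 * (‖u‖ ^ 2 * h1Sq u) := by
      rw [mul_pow, mul_pow, Real.sq_sqrt (h1Sq_nonneg u)]; norm_num
    rw [h2] at h1
    calc ‖u x‖ ^ 6 = (‖u x‖ ^ 2) ^ 2 * ‖u x‖ ^ 2 := by ring
      _ ≤ _ := by gcongr
  set a := 100 * (‖v‖ ^ 2 * h1Sq v)
  set b := 100 * (‖z‖ ^ 2 * h1Sq z)
  have hi1 := (integrable_norm_sq v).const_mul a
  have hi2 := (integrable_norm_sq z).const_mul b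
  have hi3 : Integrable (fun x => 1 + a * ‖v x‖ ^ 2) AddCircle.haarAddCircle :=
    (integrable_const 1).add hi1
  have h1 : ∀ᵐ x ∂AddCircle.haarAddCircle, ‖psiL2 R μ (v + z) x‖ ^ 2 ≤
      psiGrowth R μ * (1 + a * ‖v x‖ ^ 2 + b * ‖z x‖ ^ 2) := by
    filter_upwards [hw.coeFn_psiL2, Lp.coeFn_add v z, ae_norm_sq_le hv, ae_norm_sq_le hz]
      with x h1 h2 h3 h4
    rw [h1, h2, Pi.add_apply]
    refine (norm_psi_add_sq_le R μ _ _).trans ?_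
    have := psiGrowth_nonneg R μ
    gcongr
    · exact hsix h3
    · exact hsix h4
  rw [norm_sq_eq_integral]
  refine (integral_mono_ae (integrable_norm_sq _) ((hi3.add hi2).const_mul _) h1).trans ?_
  refine le_of_eq ?_
  have e1 : ∫ x, psiGrowth R μ * (1 + a * ‖v x‖ ^ 2 + b * ‖z x‖ ^ 2) ∂AddCircle.haarAddCircle =
      psiGrowth R μ * (1 + a * ‖v‖ ^ 2 + b * ‖z‖ ^ 2) := by
    rw [integral_const_mul, integral_add hi3 hi2, integral_add (integrable_const 1) hi1,
      integral_const_mul, integral_const_mul, ← norm_sq_eq_integral, ← norm_sq_eq_integral]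
    simp
  refine e1.trans ?_
  simp only [a, b]
  ring

/-- The energy estimate for the nonlinearity, `Re ⟨v, psi(v + z)⟩ ≤ C (1 + ‖z‖_{L⁴}⁴)`. -/
lemma re_inner_psiL2_le (R μ : ℝ) {v z : L2T} (hz : sobolevSq 1 z < ∞)
    (hw : PsiMem R μ (v + z)) :
    (inner ℂ v (psiL2 R μ (v + z))).re ≤
      psiDiss R μ * (1 + 10 * (‖z‖ ^ 3 * √(h1Sq z))) := by
  have hi := L2.integrable_inner (𝕜 := ℂ) v (psiL2 R μ (v + z))
  have hi2 := (integrable_norm_sq z).const_mul (10 * (‖z‖ * √(h1Sq z)))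
  have h0 : (inner ℂ v (psiL2 R μ (v + z))).re =
      ∫ x, (inner ℂ (v x) (psiL2 R μ (v + z) x)).re ∂AddCircle.haarAddCircle := by
    rw [L2.inner_def]
    exact (integral_re hi).symm
  rw [h0]
  have h1 : ∀ᵐ x ∂AddCircle.haarAddCircle, (inner ℂ (v x) (psiL2 R μ (v + z) x)).re ≤
      psiDiss R μ * (1 + 10 * (‖z‖ * √(h1Sq z)) * ‖z x‖ ^ 2) := by
    filter_upwards [hw.coeFn_psiL2, Lp.coeFn_add v z, ae_norm_sq_le hz] with x h1 h2 h3
    rw [h1, h2, Pi.add_apply, RCLike.inner_apply]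
    refine (re_psi_mul_conj_le R μ _ _).trans ?_
    have := psiDiss_nonneg R μ
    gcongr
    calc ‖z x‖ ^ 4 = ‖z x‖ ^ 2 * ‖z x‖ ^ 2 := by ring
      _ ≤ _ := by gcongr
  refine (integral_mono_ae hi.re (((integrable_const 1).add hi2).const_mul _) h1).trans ?_
  refine le_of_eq ?_
  have e1 : ∫ x, psiDiss R μ * (1 + 10 * (‖z‖ * √(h1Sq z)) * ‖z x‖ ^ 2)
      ∂AddCircle.haarAddCircle = psiDiss R μ * (1 + 10 * (‖z‖ * √(h1Sq z)) * ‖z‖ ^ 2) := by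
    rw [integral_const_mul, integral_add (integrable_const 1) hi2, integral_const_mul,
      ← norm_sq_eq_integral]
    simp
  refine e1.trans ?_
  ring

/-! ### A Gronwall inequality for sequences of convolutions -/

lemma summable_one_add_lam_rpow {p : ℝ} (hp : 1 / 2 < p) :
    Summable fun k : ℤ => (1 + lam k) ^ (-p) := by
  have h1 : Summable fun k : ℤ => |(k : ℝ)| ^ (-(2 * p)) + if k = 0 then (1 : ℝ) else 0 :=
    (Real.summable_abs_int_rpow (by linarith)).add (hasSum_ite_eq 0 1).summable
  refine h1.of_nonneg_of_le (fun k => ?_) fun k => ?_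
  · have := lam_nonneg k; positivity
  · have hl := lam_nonneg k
    rcases eq_or_ne k 0 with rfl | hk
    · simp only [lam_zero, if_true, add_zero, Real.one_rpow]
      have : 0 ≤ |((0 : ℤ) : ℝ)| ^ (-(2 * p)) := by positivity
      linarith
    · have hk' : 0 < |(k : ℝ)| := by positivity
      rw [if_neg hk, add_zero, show -(2 * p) = 2 * (-p) by ring, Real.rpow_mul (abs_nonneg _)]
      refine Real.rpow_le_rpow_of_nonpos (by positivity) ?_ (by linarith)
      rw [Real.rpow_ofNat, sq_abs]
      linarith [sq_le_lam k]

lemma tendsto_tsum_lam_add_rpow {p : ℝ} (hp : 1 / 2 < p) :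
    Tendsto (fun n : ℕ => ∑' k : ℤ, (1 + n + lam k) ^ (-p)) atTop (𝓝 0) := by
  have h := tendsto_tsum_of_dominated_convergence (𝓕 := atTop)
    (f := fun (n : ℕ) (k : ℤ) => (1 + n + lam k) ^ (-p)) (g := fun _ => (0 : ℝ))
    (summable_one_add_lam_rpow hp) (fun k => ?_) (Eventually.of_forall fun n k => ?_)
  · simpa using h
  · refine (tendsto_rpow_neg_atTop (by linarith : 0 < p)).comp ?_
    exact tendsto_atTop_add_const_right _ _
      (tendsto_atTop_add_const_left _ _ tendsto_natCast_atTop_atTop)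
  · have hl := lam_nonneg k
    rw [Real.norm_of_nonneg (by positivity)]
    refine Real.rpow_le_rpow_of_nonpos (by positivity) ?_ (by linarith)
    have : (0 : ℝ) ≤ n := n.cast_nonneg
    linarith

lemma lintegral_exp_le {a t : ℝ} (ha : 0 < a) :
    ∫⁻ s in Ioc 0 t, ENNReal.ofReal (Real.exp (-(a * (t - s)))) ≤ ENNReal.ofReal (1 / a) := by
  rcases le_total t 0 with h | h
  · simp [Ioc_eq_empty_of_le h]
  have hd : ∀ s ∈ uIcc 0 t, HasDerivAt (fun s : ℝ => Real.exp (-(a * (t - s))) / a)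
      (Real.exp (-(a * (t - s)))) s := by
    intro s _
    have h1 : HasDerivAt (fun s : ℝ => -(a * (t - s))) a s := by
      have h := (((hasDerivAt_id s).const_sub t).const_mul a).neg
      simp only [mul_neg, mul_one, neg_neg, id] at h
      exact h
    have h2 := (h1.exp).div_const a
    rwa [mul_div_assoc, div_self ha.ne', mul_one] at h2
  have hc : Continuous fun s : ℝ => Real.exp (-(a * (t - s))) := by fun_prop
  have hi := intervalIntegral.integral_eq_sub_of_hasDerivAt hd (hc.intervalIntegrable _ _)
  rw [← ofReal_integral_eq_lintegral_ofReal
    ((hc.integrableOn_Icc (a := 0) (b := t)).mono_set Ioc_subset_Icc_self)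
    (ae_of_all _ fun _ => (Real.exp_pos _).le), ← intervalIntegral.integral_of_le h, hi]
  refine ENNReal.ofReal_le_ofReal ?_
  have : 0 ≤ Real.exp (-(a * (t - 0))) / a := by positivity
  simp only [sub_self, mul_zero, neg_zero, Real.exp_zero] at *
  linarith

/-- Hölder's inequality in time for the convolution with `exp (-a t)`. -/
lemma lintegral_exp_mul_sq_le {a t : ℝ} (ha : 0 < a) {g : ℝ → ℝ≥0∞}
    (hg : AEMeasurable g (volume.restrict (Ioc 0 t))) :
    (∫⁻ s in Ioc 0 t, ENNReal.ofReal (Real.exp (-(a * (t - s)))) * g s) ^ 2 ≤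
      ENNReal.ofReal (a ^ (-(2 / 3) : ℝ)) * (∫⁻ s in Ioc 0 t, g s ^ (3 / 2 : ℝ)) ^ (4 / 3 : ℝ) := by
  have hpq : (3 : ℝ).HolderConjugate (3 / 2) := by
    rw [Real.holderConjugate_iff]; norm_num
  have h1 := ENNReal.lintegral_mul_le_Lp_mul_Lq (volume.restrict (Ioc 0 t)) hpq
    (f := fun s => ENNReal.ofReal (Real.exp (-(a * (t - s))))) (by fun_prop) hg
  have h2 : ∫⁻ s in Ioc 0 t, ENNReal.ofReal (Real.exp (-(a * (t - s)))) ^ (3 : ℝ) ≤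
      ENNReal.ofReal a⁻¹ := by
    refine le_trans (le_of_eq ?_) ((lintegral_exp_le (a := 3 * a) (t := t) (by positivity)).trans
      (ENNReal.ofReal_le_ofReal ?_))
    · refine lintegral_congr fun s => ?_
      rw [ENNReal.ofReal_rpow_of_pos (Real.exp_pos _), ← Real.exp_mul]
      congr 2
      ring
    · rw [← one_div]
      gcongr
      linarith
  calc _ ≤ (ENNReal.ofReal a⁻¹ ^ (1 / 3 : ℝ) *
        (∫⁻ s in Ioc 0 t, g s ^ (3 / 2 : ℝ)) ^ (1 / (3 / 2) : ℝ)) ^ 2 := by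
        gcongr
        refine h1.trans ?_
        gcongr
    _ = _ := by
        rw [mul_pow, ← ENNReal.rpow_natCast, ← ENNReal.rpow_natCast, ← ENNReal.rpow_mul,
          ← ENNReal.rpow_mul, ENNReal.ofReal_rpow_of_pos (by positivity),
          ← Real.rpow_neg_one, ← Real.rpow_mul ha.le]
        norm_num

lemma le_two_mul_of_le_add_half {x ε : ℝ≥0∞} (hx : x ≠ ∞) (h : x ≤ ε + x * (1 / 2)) :
    x ≤ 2 * ε := by
  have h2 : x * (1 / 2) + x * (1 / 2) = x := by
    rw [← mul_add, ENNReal.add_halves, mul_one]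
  have h3 : x * (1 / 2) ≠ ∞ := by finiteness
  have h4 : x * (1 / 2) ≤ ε := by
    rw [← ENNReal.add_le_add_iff_right h3, h2]
    exact h
  calc x = x * (1 / 2) + x * (1 / 2) := h2.symm
    _ ≤ ε + ε := by gcongr
    _ = 2 * ε := (two_mul ε).symm

/-- A Gronwall inequality for the mild formulation: if
`D(t)² ≤ ε + A ∑_k (∫₀ᵗ exp(-λ_k (t-s)) g(s) D(s) ds)²` with `g ∈ L^{3/2}(0, T)`, then
`D² ≤ C ε`. With the weight `exp(-κt)`, Hölder's inequality in time bounds the `k`-th integral by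
`(λ_k + κ)^{-1/3}`, whose squares are summable in `k` with a sum that tends to `0` as `κ → ∞`. -/
lemma exists_gronwall_const {T : ℝ} {A G : ℝ≥0∞} (hA : A ≠ ∞) (hG : G ≠ ∞) :
    ∃ C : ℝ≥0∞, C ≠ ∞ ∧ ∀ (g D : ℝ → ℝ≥0∞) (ε B : ℝ≥0∞),
      AEMeasurable g (volume.restrict (Ioc 0 T)) →
      ∫⁻ s in Ioc 0 T, g s ^ (3 / 2 : ℝ) ≤ G →
      B ≠ ∞ → (∀ t ∈ Icc 0 T, D t ≤ B) →
      (∀ t ∈ Icc 0 T, D t ^ 2 ≤ ε + A * ∑' k : ℤ, (∫⁻ s in Ioc 0 t,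
        ENNReal.ofReal (Real.exp (-(lam k * (t - s)))) * (g s * D s)) ^ 2) →
      ∀ t ∈ Icc 0 T, D t ^ 2 ≤ C * ε := by
  set G' := A * G ^ (4 / 3 : ℝ) with hG'
  have hG'top : G' ≠ ∞ := ENNReal.mul_ne_top hA (ENNReal.rpow_ne_top_of_nonneg (by norm_num) hG)
  obtain ⟨n, hn⟩ : ∃ n : ℕ, G' * ENNReal.ofReal (∑' k : ℤ, (1 + n + lam k) ^ (-(2 / 3) : ℝ)) ≤
      1 / 2 := by
    have h1 := (ENNReal.tendsto_ofReal (tendsto_tsum_lam_add_rpow (p := 2 / 3) (by norm_num)))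
    rw [ENNReal.ofReal_zero] at h1
    have h2 := ENNReal.Tendsto.const_mul h1 (Or.inr hG'top)
    rw [mul_zero] at h2
    exact (h2.eventually_le_const (by norm_num : (0 : ℝ≥0∞) < 1 / 2)).exists
  set κ : ℝ := 1 + n with hκ
  have hκ0 : 0 < κ := by positivity
  refine ⟨ENNReal.ofReal (Real.exp (2 * (κ * T))) * 2, by finiteness, ?_⟩
  intro g D ε B hgm hg hB hDB hD
  set S := ⨆ t ∈ Icc 0 T, ENNReal.ofReal (Real.exp (-(κ * t))) * D t with hS
  have hSle : ∀ t ∈ Icc 0 T, ENNReal.ofReal (Real.exp (-(κ * t))) * D t ≤ S := fun t ht =>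
    le_iSup₂ (f := fun t (_ : t ∈ Icc 0 T) => ENNReal.ofReal (Real.exp (-(κ * t))) * D t) t ht
  have hSB : S ≤ B := by
    refine iSup₂_le fun t ht => ?_
    refine le_trans (mul_le_of_le_one_left zero_le ?_) (hDB t ht)
    rw [ENNReal.ofReal_le_one, Real.exp_le_one_iff]
    have := mul_nonneg hκ0.le ht.1
    linarith
  have hSfin : S ≠ ∞ := ne_top_of_le_ne_top hB hSB
  have hDS : ∀ t ∈ Icc 0 T, D t ≤ ENNReal.ofReal (Real.exp (κ * t)) * S := by
    intro t ht
    have h1 := mul_le_mul_right (hSle t ht) (ENNReal.ofReal (Real.exp (κ * t)))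
    rwa [← mul_assoc, ← ENNReal.ofReal_mul (Real.exp_pos _).le, ← Real.exp_add, add_neg_cancel,
      Real.exp_zero, ENNReal.ofReal_one, one_mul] at h1
  have hint : ∀ t ∈ Icc 0 T, ∀ k : ℤ, (∫⁻ s in Ioc 0 t,
      ENNReal.ofReal (Real.exp (-(lam k * (t - s)))) * (g s * D s)) ^ 2 ≤
      ENNReal.ofReal (Real.exp (κ * t)) ^ 2 * S ^ 2 *
        (ENNReal.ofReal ((1 + n + lam k) ^ (-(2 / 3) : ℝ)) * G ^ (4 / 3 : ℝ)) := by
    intro t ht k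
    have hlk : 0 < 1 + n + lam k := by have := lam_nonneg k; positivity
    have hsub : Ioc 0 t ⊆ Ioc 0 T := Ioc_subset_Ioc_right ht.2
    have h1 : ∫⁻ s in Ioc 0 t, ENNReal.ofReal (Real.exp (-(lam k * (t - s)))) * (g s * D s) ≤
        ENNReal.ofReal (Real.exp (κ * t)) * S *
        ∫⁻ s in Ioc 0 t, ENNReal.ofReal (Real.exp (-((1 + n + lam k) * (t - s)))) * g s := by
      rw [← lintegral_const_mul' _ _ (by finiteness)]
      refine setLIntegral_mono' measurableSet_Ioc fun s hs => ?_
      have h2 := hDS s ⟨hs.1.le, hs.2.trans ht.2⟩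
      calc _ ≤ ENNReal.ofReal (Real.exp (-(lam k * (t - s)))) *
            (g s * (ENNReal.ofReal (Real.exp (κ * s)) * S)) := by gcongr
        _ = (ENNReal.ofReal (Real.exp (-(lam k * (t - s)))) * ENNReal.ofReal (Real.exp (κ * s))) *
            S * g s := by ring
        _ = (ENNReal.ofReal (Real.exp (κ * t)) *
            ENNReal.ofReal (Real.exp (-((1 + n + lam k) * (t - s))))) * S * g s := by
            rw [← ENNReal.ofReal_mul (Real.exp_pos _).le, ← ENNReal.ofReal_mul (Real.exp_pos _).le,
              ← Real.exp_add, ← Real.exp_add, hκ]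
            congr 4
            ring
        _ = _ := by ring
    refine (pow_le_pow_left' h1 2).trans ?_
    rw [mul_pow, mul_pow]
    gcongr
    refine (lintegral_exp_mul_sq_le hlk (hgm.mono_measure (Measure.restrict_mono hsub le_rfl))).trans
      ?_
    gcongr
    exact (lintegral_mono_set hsub).trans hg
  have hsum : Summable fun k : ℤ => (1 + n + lam k) ^ (-(2 / 3) : ℝ) := by
    refine (summable_one_add_lam_rpow (p := 2 / 3) (by norm_num)).of_nonneg_of_le
      (fun k => ?_) fun k => ?_
    · have := lam_nonneg k; positivity
    · have := lam_nonneg k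
      refine Real.rpow_le_rpow_of_nonpos (by positivity) ?_ (by norm_num)
      have : (0 : ℝ) ≤ n := n.cast_nonneg
      linarith
  have hmain : ∀ t ∈ Icc 0 T, (ENNReal.ofReal (Real.exp (-(κ * t))) * D t) ^ 2 ≤
      ε + S ^ 2 * (1 / 2) := by
    intro t ht
    have he1 : ENNReal.ofReal (Real.exp (-(κ * t))) ≤ 1 := by
      rw [ENNReal.ofReal_le_one, Real.exp_le_one_iff]
      have := mul_nonneg hκ0.le ht.1
      linarith
    have he2 : ENNReal.ofReal (Real.exp (-(κ * t))) * ENNReal.ofReal (Real.exp (κ * t)) = 1 := by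
      rw [← ENNReal.ofReal_mul (Real.exp_pos _).le, ← Real.exp_add, neg_add_cancel, Real.exp_zero,
        ENNReal.ofReal_one]
    calc _ = ENNReal.ofReal (Real.exp (-(κ * t))) ^ 2 * D t ^ 2 := by rw [mul_pow]
      _ ≤ ENNReal.ofReal (Real.exp (-(κ * t))) ^ 2 * (ε + A * ∑' k : ℤ,
          ENNReal.ofReal (Real.exp (κ * t)) ^ 2 * S ^ 2 *
          (ENNReal.ofReal ((1 + n + lam k) ^ (-(2 / 3) : ℝ)) * G ^ (4 / 3 : ℝ))) := by
          gcongr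
          refine (hD t ht).trans ?_
          gcongr with k
          exact hint t ht k
      _ = ENNReal.ofReal (Real.exp (-(κ * t))) ^ 2 * ε +
          (ENNReal.ofReal (Real.exp (-(κ * t))) * ENNReal.ofReal (Real.exp (κ * t))) ^ 2 *
          (S ^ 2 * (G' * ENNReal.ofReal (∑' k : ℤ, (1 + n + lam k) ^ (-(2 / 3) : ℝ)))) := by
          rw [ENNReal.tsum_mul_left, ENNReal.tsum_mul_right, ← ENNReal.ofReal_tsum_of_nonneg
            (fun k => by have := lam_nonneg k; positivity) hsum, hG']
          ring
      _ ≤ _ := by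
          rw [he2, one_pow, one_mul]
          gcongr
          exact mul_le_of_le_one_left zero_le (pow_le_one₀ zero_le he1)
  have hS2 : S ^ 2 ≤ ε + S ^ 2 * (1 / 2) := by
    have hsq : ((ε + S ^ 2 * (1 / 2)) ^ (1 / 2 : ℝ)) ^ 2 = ε + S ^ 2 * (1 / 2) := by
      rw [← ENNReal.rpow_natCast, ← ENNReal.rpow_mul]; norm_num
    rw [← hsq, ENNReal.pow_le_pow_left_iff two_ne_zero]
    refine iSup₂_le fun t ht => ?_
    rw [← ENNReal.pow_le_pow_left_iff two_ne_zero, hsq]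
    exact hmain t ht
  have hS3 : S ^ 2 ≤ 2 * ε := le_two_mul_of_le_add_half (by finiteness) hS2
  intro t ht
  calc D t ^ 2 ≤ (ENNReal.ofReal (Real.exp (κ * t)) * S) ^ 2 := by gcongr; exact hDS t ht
    _ = ENNReal.ofReal (Real.exp (2 * (κ * t))) * S ^ 2 := by
        rw [mul_pow, ← ENNReal.ofReal_pow (Real.exp_pos _).le, ← Real.exp_nat_mul]
        norm_num
    _ ≤ ENNReal.ofReal (Real.exp (2 * (κ * T))) * (2 * ε) := by
        gcongr
        exact ht.2
    _ = _ := by ring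

/-! ### Uniqueness of mild solutions -/

/-- A bound for `lipFactor R μ w w'` in terms of a bound `B` for `‖w‖`, `‖w'‖` and of
`p = ‖psiL2 R μ w‖`, `p' = ‖psiL2 R μ w'‖`. -/
def lipMajorant (R μ : ℝ) (B p p' : ℝ≥0∞) : ℝ≥0∞ :=
  ENNReal.ofReal (psiLip R μ) * (3 * (1 + B * (p + ENNReal.ofReal R * B) +
    B * (p' + ENNReal.ofReal R * B))) ^ (1 / 2 : ℝ)

lemma lipFactor_le_lipMajorant {R μ : ℝ} {w w' : L2T} {B : ℝ≥0∞} (hw : ‖w‖ₑ ≤ B)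
    (hw' : ‖w'‖ₑ ≤ B) :
    lipFactor R μ w w' ≤ lipMajorant R μ B ‖psiL2 R μ w‖ₑ ‖psiL2 R μ w'‖ₑ := by
  unfold lipFactor lipMajorant quarticBound
  gcongr

lemma aemeasurable_lipMajorant {X : Type*} [MeasurableSpace X] {m : Measure X} (R μ : ℝ)
    (B : ℝ≥0∞) {p p' : X → ℝ≥0∞} (hp : AEMeasurable p m) (hp' : AEMeasurable p' m) :
    AEMeasurable (fun s => lipMajorant R μ B (p s) (p' s)) m := by
  unfold lipMajorant
  fun_prop

lemma lintegral_lipMajorant_le {X : Type*} [MeasurableSpace X] {m : Measure X} (R μ : ℝ)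
    {B : ℝ≥0∞} {p p' : X → ℝ≥0∞} (hB : B ≠ ∞) (hp : AEMeasurable p m) :
    ∫⁻ s, lipMajorant R μ B (p s) (p' s) ^ (3 / 2 : ℝ) ∂m ≤
      ENNReal.ofReal (psiLip R μ) ^ (3 / 2 : ℝ) * (3 * ((1 + 2 * (ENNReal.ofReal R * B ^ 2)) *
        m univ + B * (∫⁻ s, p s ∂m + ∫⁻ s, p' s ∂m))) := by
  have hc : ENNReal.ofReal (psiLip R μ) ^ (3 / 2 : ℝ) ≠ ∞ :=
    ENNReal.rpow_ne_top_of_nonneg (by norm_num) ENNReal.ofReal_ne_top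
  calc _ ≤ ∫⁻ s, ENNReal.ofReal (psiLip R μ) ^ (3 / 2 : ℝ) *
        (3 * ((1 + 2 * (ENNReal.ofReal R * B ^ 2)) + B * (p s + p' s))) ∂m := by
        refine lintegral_mono fun s => ?_
        have h1 : 1 + B * (p s + ENNReal.ofReal R * B) + B * (p' s + ENNReal.ofReal R * B) =
            (1 + 2 * (ENNReal.ofReal R * B ^ 2)) + B * (p s + p' s) := by ring
        simp only [lipMajorant]
        rw [ENNReal.mul_rpow_of_nonneg _ _ (by norm_num), ← ENNReal.rpow_mul, h1]
        gcongr
        have h3 : (1 : ℝ≥0∞) ≤ 3 * ((1 + 2 * (ENNReal.ofReal R * B ^ 2)) + B * (p s + p' s)) := by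
          calc (1 : ℝ≥0∞) ≤ 3 * ((1 + 0) + 0) := by norm_num
            _ ≤ _ := by gcongr <;> exact zero_le
        calc _ ≤ (3 * ((1 + 2 * (ENNReal.ofReal R * B ^ 2)) + B * (p s + p' s))) ^ (1 : ℝ) :=
              ENNReal.rpow_le_rpow_of_exponent_le h3 (by norm_num)
          _ = _ := ENNReal.rpow_one _
    _ = _ := by
        rw [lintegral_const_mul' _ _ hc, lintegral_const_mul' _ _ (by norm_num),
          lintegral_add_left' aemeasurable_const, lintegral_const, lintegral_const_mul' _ _ hB,
          lintegral_add_left' hp]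

lemma intervalIntegrable_exp_mul_coeff {ν T t : ℝ} (ht : t ∈ Icc 0 T) {f : ℝ → L2T}
    (hf : IntegrableOn f (Ioc 0 T)) (k : ℤ) :
    IntervalIntegrable (fun s => Complex.exp (-((1 + ν * Complex.I) * lam k * ((t - s : ℝ) : ℂ))) *
      coeff (f s) k) volume 0 t := by
  rw [intervalIntegrable_iff_integrableOn_Ioc_of_le ht.1]
  have h := (coeffL k).integrable_comp (integrableOn_semigroup (ν := ν) ht hf)
  refine h.congr ?_
  filter_upwards [ae_restrict_mem measurableSet_Ioc] with s hs
  simp only [coeffL_apply]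
  rw [coeff_semigroup (by linarith [hs.2])]

lemma enorm_integral_exp_mul_le {ν t : ℝ} (ht : 0 ≤ t) (f : ℝ → ℂ) (k : ℤ) :
    ‖∫ s in (0 : ℝ)..t, Complex.exp (-((1 + ν * Complex.I) * lam k * ((t - s : ℝ) : ℂ))) * f s‖ₑ ≤
      ∫⁻ s in Ioc 0 t, ENNReal.ofReal (Real.exp (-(lam k * (t - s)))) * ‖f s‖ₑ := by
  rw [intervalIntegral.integral_of_le ht]
  refine (enorm_integral_le_lintegral_enorm _).trans (le_of_eq ?_)
  refine lintegral_congr fun s => ?_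
  rw [enorm_mul, ← ofReal_norm, norm_exp_semigroup]

lemma IsMildSolution.coeff_eq {R ν μ T : ℝ} {u₀ : L2T} {η v : ℝ → L2T}
    (hv : IsMildSolution R ν μ T u₀ η v) {t : ℝ} (ht : t ∈ Icc 0 T) (k : ℤ) :
    coeff (v t) k = Complex.exp (-((1 + ν * Complex.I) * lam k * t)) * coeff u₀ k +
      ∫ s in (0 : ℝ)..t, Complex.exp (-((1 + ν * Complex.I) * lam k * ((t - s : ℝ) : ℂ))) *
        coeff (psiL2 R μ (v s + η s)) k := by
  rw [hv.mild t ht, coeff_add, coeff_semigroup ht.1, coeff_duhamel ht hv.integrableOn]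

/-- Mild solutions with bounded forcing are unique: `‖psi ∘ w‖ ∈ L¹(0, T)` makes the Lipschitz
factor of `psi : L² → L¹` an element of `L^{3/2}(0, T)`. -/
lemma IsMildSolution.eqOn {R ν μ T : ℝ} {u₀ : L2T} {η v v' : ℝ → L2T} (hR : 0 ≤ R)
    (hη : ∃ B : ℝ, ∀ t ∈ Icc 0 T, ‖η t‖ ≤ B)
    (hv : IsMildSolution R ν μ T u₀ η v) (hv' : IsMildSolution R ν μ T u₀ η v') :
    EqOn v' v (Icc 0 T) := by
  obtain ⟨Bη, hBη⟩ := hη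
  obtain ⟨Bv, hBv⟩ := isCompact_Icc.exists_bound_of_continuousOn hv.continuousOn
  obtain ⟨Bv', hBv'⟩ := isCompact_Icc.exists_bound_of_continuousOn hv'.continuousOn
  set B : ℝ := max Bv Bv' + Bη with hB
  have hwB : ∀ t ∈ Icc 0 T, ‖v t + η t‖ₑ ≤ ENNReal.ofReal B := fun t ht => by
    rw [← ofReal_norm]
    refine ENNReal.ofReal_le_ofReal ((norm_add_le _ _).trans ?_)
    exact add_le_add ((hBv t ht).trans (le_max_left _ _)) (hBη t ht)
  have hwB' : ∀ t ∈ Icc 0 T, ‖v' t + η t‖ₑ ≤ ENNReal.ofReal B := fun t ht => by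
    rw [← ofReal_norm]
    refine ENNReal.ofReal_le_ofReal ((norm_add_le _ _).trans ?_)
    exact add_le_add ((hBv' t ht).trans (le_max_right _ _)) (hBη t ht)
  have hp := hv.integrableOn.aestronglyMeasurable.enorm
  have hp' := hv'.integrableOn.aestronglyMeasurable.enorm
  have hpfin := hv.integrableOn.hasFiniteIntegral
  have hpfin' := hv'.integrableOn.hasFiniteIntegral
  set g : ℝ → ℝ≥0∞ := fun s => lipMajorant R μ (ENNReal.ofReal B) ‖psiL2 R μ (v' s + η s)‖ₑ
    ‖psiL2 R μ (v s + η s)‖ₑ with hg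
  have hGle := lintegral_lipMajorant_le (m := volume.restrict (Ioc 0 T)) R μ
    (p' := fun s => ‖psiL2 R μ (v s + η s)‖ₑ) (ENNReal.ofReal_ne_top (r := B)) hp'
  have hGtop : ∫⁻ s in Ioc 0 T, g s ^ (3 / 2 : ℝ) ≠ ∞ := by
    refine ne_top_of_le_ne_top ?_ hGle
    have h1 : ENNReal.ofReal (psiLip R μ) ^ (3 / 2 : ℝ) ≠ ∞ :=
      ENNReal.rpow_ne_top_of_nonneg (by norm_num) ENNReal.ofReal_ne_top
    have h2 : (volume.restrict (Ioc 0 T)) univ ≠ ∞ := by simp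
    have h3 := hpfin.ne
    have h4 := hpfin'.ne
    finiteness
  obtain ⟨C, -, hC⟩ := exists_gronwall_const (T := T) ENNReal.one_ne_top hGtop
  have key := hC g (fun t => ‖v' t - v t‖ₑ) 0 (ENNReal.ofReal (Bv' + Bv))
    (aemeasurable_lipMajorant R μ _ hp' hp) le_rfl ENNReal.ofReal_ne_top
    (fun t ht => by
      rw [← ofReal_norm]
      refine ENNReal.ofReal_le_ofReal ((norm_sub_le _ _).trans ?_)
      exact add_le_add (hBv' t ht) (hBv t ht))
    (fun t ht => by
      rw [zero_add, one_mul, enorm_sq_eq_tsum]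
      refine ENNReal.tsum_le_tsum fun k => ?_
      gcongr
      rw [coeff_sub, hv.coeff_eq ht, hv'.coeff_eq ht, add_sub_add_left_eq_sub,
        ← intervalIntegral.integral_sub (intervalIntegrable_exp_mul_coeff ht hv'.integrableOn k)
          (intervalIntegrable_exp_mul_coeff ht hv.integrableOn k)]
      simp_rw [← mul_sub]
      refine (enorm_integral_exp_mul_le ht.1 _ k).trans ?_
      have hsub : Ioc 0 t ⊆ Ioc 0 T := Ioc_subset_Ioc_right ht.2
      refine lintegral_mono_ae ?_
      filter_upwards [ae_mono (Measure.restrict_mono hsub le_rfl) hv.memLp,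
        ae_mono (Measure.restrict_mono hsub le_rfl) hv'.memLp,
        ae_restrict_mem measurableSet_Ioc] with s h1 h2 hs
      gcongr
      have hs' : s ∈ Icc 0 T := ⟨hs.1.le, hs.2.trans ht.2⟩
      have h3 := enorm_coeff_psiL2_sub_le hR (w := v' s + η s) (w' := v s + η s) h2 h1 k
      rw [add_sub_add_right_eq_sub] at h3
      refine h3.trans ?_
      gcongr
      exact lipFactor_le_lipMajorant (hwB' s hs') (hwB s hs'))
  intro t ht
  have h0 := key t ht
  rw [mul_zero, nonpos_iff_eq_zero, pow_eq_zero_iff two_ne_zero, enorm_eq_zero, sub_eq_zero] at h0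
  exact h0

/-! ### Global solutions of dissipative differential equations -/

lemma sub_le_integral_of_deriv_le {T t : ℝ} {y y' φ : ℝ → ℝ}
    (hy : ∀ s ∈ Icc 0 T, HasDerivWithinAt y (y' s) (Icc 0 T) s) (hφ : ContinuousOn φ (Icc 0 T))
    (hle : ∀ s ∈ Icc 0 T, y' s ≤ φ s) (ht : t ∈ Icc 0 T) :
    y t - y 0 ≤ ∫ s in (0 : ℝ)..t, φ s := by
  have hsub : Icc 0 t ⊆ Icc 0 T := Icc_subset_Icc_right ht.2
  refine intervalIntegral.sub_le_integral_of_hasDeriv_right_of_le (g' := y') ht.1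
    (fun s hs => ((hy s (hsub hs)).continuousWithinAt).mono hsub) (fun s hs => ?_)
    ((hφ.mono hsub).integrableOn_Icc) fun s hs => hle s (hsub (Ioo_subset_Icc_self hs))
  exact ((hy s (hsub (Ioo_subset_Icc_self hs))).hasDerivAt
    (Icc_mem_nhds hs.1 (hs.2.trans_le ht.2))).hasDerivWithinAt

/-- The cut-off function equal to `1` on `(-∞, m]` and to `0` on `[m + 1, ∞)`. -/
def cutoff (m s : ℝ) : ℝ := max 0 (min 1 (m + 1 - s))

lemma cutoff_nonneg (m s : ℝ) : 0 ≤ cutoff m s := le_max_left _ _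

lemma cutoff_le_one (m s : ℝ) : cutoff m s ≤ 1 := max_le zero_le_one (min_le_left _ _)

lemma cutoff_eq_zero {m s : ℝ} (h : m + 1 ≤ s) : cutoff m s = 0 :=
  max_eq_left ((min_le_right _ _).trans (by linarith))

lemma cutoff_eq_one {m s : ℝ} (h : s ≤ m) : cutoff m s = 1 := by
  unfold cutoff
  rw [min_eq_left (by linarith), max_eq_right zero_le_one]

lemma abs_cutoff_sub_le (m s s' : ℝ) : |cutoff m s - cutoff m s'| ≤ |s - s'| := by
  unfold cutoff
  refine (abs_max_sub_max_le_max _ _ _ _).trans (max_le (by simp) ?_)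
  refine (abs_min_sub_min_le_max _ _ _ _).trans (max_le (by simp) ?_)
  rw [show m + 1 - s - (m + 1 - s') = -(s - s') by ring, abs_neg]

/-- A locally Lipschitz vector field on a Hilbert space with `⟪a, F t a⟫ ≤ C` has global solutions:
the solution of the equation with the cut-off field stays where the cut-off equals `1`. -/
theorem exists_solution_of_dissipative {E : Type*} [NormedAddCommGroup E] [InnerProductSpace ℝ E]
    [CompleteSpace E] {F : ℝ → E → E} {T C : ℝ} (hT : 0 ≤ T) (hC : 0 ≤ C)
    (hcont : ∀ a, ContinuousOn (fun t => F t a) (Icc 0 T))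
    (hlip : ∀ r : ℝ, ∃ K : ℝ, ∀ t ∈ Icc 0 T, ∀ a b, ‖a‖ ≤ r → ‖b‖ ≤ r →
      ‖F t a - F t b‖ ≤ K * ‖a - b‖)
    (hdiss : ∀ t ∈ Icc 0 T, ∀ a, inner ℝ a (F t a) ≤ C) (a₀ : E) :
    ∃ a : ℝ → E, a 0 = a₀ ∧ ∀ t ∈ Icc 0 T, HasDerivWithinAt a (F t (a t)) (Icc 0 T) t := by
  set m : ℝ := √(‖a₀‖ ^ 2 + 2 * C * T) with hm
  obtain ⟨K, hK⟩ := hlip (m + 1)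
  obtain ⟨M, hM⟩ := isCompact_Icc.exists_bound_of_continuousOn (hcont 0)
  have hm0 : 0 ≤ m := Real.sqrt_nonneg _
  set L : ℝ := |M| + |K| * (m + 1) with hL
  have hL0 : 0 ≤ L := by positivity
  have hK' : ∀ t ∈ Icc 0 T, ∀ a b, ‖a‖ ≤ m + 1 → ‖b‖ ≤ m + 1 →
      ‖F t a - F t b‖ ≤ |K| * ‖a - b‖ := fun t ht a b ha hb =>
    (hK t ht a b ha hb).trans (mul_le_mul_of_nonneg_right (le_abs_self K) (norm_nonneg _))
  have hFL : ∀ t ∈ Icc 0 T, ∀ a, ‖a‖ ≤ m + 1 → ‖F t a‖ ≤ L := by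
    intro t ht a ha
    have h1 := hK' t ht a 0 ha (by simp; linarith)
    rw [sub_zero] at h1
    calc ‖F t a‖ = ‖F t 0 + (F t a - F t 0)‖ := by rw [add_sub_cancel]
      _ ≤ ‖F t 0‖ + ‖F t a - F t 0‖ := norm_add_le _ _
      _ ≤ |M| + |K| * (m + 1) := by
        refine add_le_add ((hM t ht).trans (le_abs_self _)) (h1.trans ?_)
        gcongr
  set F' : ℝ → E → E := fun t a => cutoff m ‖a‖ • F t a with hF'
  have hF'zero : ∀ t a, m + 1 ≤ ‖a‖ → F' t a = 0 := fun t a h => by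
    simp [hF', cutoff_eq_zero h]
  have hF'lip1 : ∀ t ∈ Icc 0 T, ∀ a b, ‖a‖ ≤ m + 1 → ‖F' t a - F' t b‖ ≤ (|K| + L) * ‖a - b‖ := by
    intro t ht a b ha
    have hχ : |cutoff m ‖a‖ - cutoff m ‖b‖| ≤ ‖a - b‖ :=
      (abs_cutoff_sub_le _ _ _).trans (abs_norm_sub_norm_le a b)
    rcases le_total ‖b‖ (m + 1) with hb | hb
    · have e : F' t a - F' t b = cutoff m ‖a‖ • (F t a - F t b) +
          (cutoff m ‖a‖ - cutoff m ‖b‖) • F t b := by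
        simp only [hF', smul_sub, sub_smul]; abel
      rw [e]
      refine (norm_add_le _ _).trans ?_
      rw [norm_smul, norm_smul, Real.norm_eq_abs, Real.norm_eq_abs,
        abs_of_nonneg (cutoff_nonneg _ _)]
      calc _ ≤ 1 * (|K| * ‖a - b‖) + ‖a - b‖ * L := by
            gcongr
            · exact cutoff_le_one _ _
            · exact hK' t ht a b ha hb
            · exact hFL t ht b hb
        _ = _ := by ring
    · have e : F' t a - F' t b = (cutoff m ‖a‖ - cutoff m ‖b‖) • F t a := by
        rw [hF'zero t b hb, cutoff_eq_zero hb, sub_zero, sub_zero]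
      rw [e, norm_smul, Real.norm_eq_abs]
      calc _ ≤ ‖a - b‖ * L := by
            gcongr
            exact hFL t ht a ha
        _ = 0 * ‖a - b‖ + L * ‖a - b‖ := by ring
        _ ≤ |K| * ‖a - b‖ + L * ‖a - b‖ := by gcongr; exact abs_nonneg K
        _ = (|K| + L) * ‖a - b‖ := by ring
  have hF'lip : ∀ t ∈ Icc 0 T, ∀ a b, ‖F' t a - F' t b‖ ≤ (|K| + L) * ‖a - b‖ := by
    intro t ht a b
    rcases le_total ‖a‖ (m + 1) with ha | ha
    · exact hF'lip1 t ht a b ha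
    rcases le_total ‖b‖ (m + 1) with hb | hb
    · rw [norm_sub_rev, norm_sub_rev a]
      exact hF'lip1 t ht b a hb
    · rw [hF'zero t a ha, hF'zero t b hb, sub_self, norm_zero]
      positivity
  have hF'L : ∀ t ∈ Icc 0 T, ∀ a, ‖F' t a‖ ≤ L := by
    intro t ht a
    rcases le_total ‖a‖ (m + 1) with ha | ha
    · simp only [hF', norm_smul, Real.norm_eq_abs, abs_of_nonneg (cutoff_nonneg _ _)]
      calc _ ≤ 1 * L := by
            gcongr
            · exact cutoff_le_one _ _
            · exact hFL t ht a ha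
        _ = L := one_mul L
    · rw [hF'zero t a ha, norm_zero]; exact hL0
  have hPL : IsPicardLindelof F' (tmin := 0) (tmax := T) ⟨0, le_rfl, hT⟩ a₀
      (Real.toNNReal (L * T)) 0 (Real.toNNReal L) (Real.toNNReal (|K| + L)) := by
    refine ⟨fun t ht => ?_, fun a _ => ?_, fun t ht a _ => ?_, ?_⟩
    · refine LipschitzWith.lipschitzOnWith (LipschitzWith.of_dist_le_mul fun a b => ?_)
      rw [dist_eq_norm, dist_eq_norm, Real.coe_toNNReal _ (by positivity)]
      exact hF'lip t ht a b
    · exact (hcont a).const_smul _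
    · rw [Real.coe_toNNReal _ hL0]
      exact hF'L t ht a
    · rw [Real.coe_toNNReal _ hL0, Real.coe_toNNReal _ (by positivity)]
      simp [hT]
  obtain ⟨α, hα0, hα⟩ := hPL.exists_eq_forall_mem_Icc_hasDerivWithinAt₀
  refine ⟨α, hα0, fun t ht => ?_⟩
  have henergy : ‖α t‖ ≤ m := by
    have h1 := sub_le_integral_of_deriv_le (φ := fun _ => 2 * C) (fun s hs => (hα s hs).norm_sq)
      continuousOn_const (fun s hs => ?_) ht
    · simp only [intervalIntegral.integral_const, smul_eq_mul, sub_zero] at h1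
      refine Real.le_sqrt_of_sq_le ?_
      rw [show α 0 = a₀ from hα0] at h1
      have : t * (2 * C) ≤ T * (2 * C) := by
        have := ht.2
        gcongr
      linarith
    · have h2 : inner ℝ (α s) (F' s (α s)) = cutoff m ‖α s‖ * inner ℝ (α s) (F s (α s)) :=
        real_inner_smul_right _ _ _
      rw [h2]
      have h3 := mul_le_mul_of_nonneg_left (hdiss s hs (α s)) (cutoff_nonneg m ‖α s‖)
      have h4 := mul_le_mul_of_nonneg_right (cutoff_le_one m ‖α s‖) hC
      linarith
  have h5 := hα t ht
  simp only [hF', cutoff_eq_one henergy, one_smul] at h5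
  exact h5

/-! ### Galerkin approximations -/

/-- The orthogonal projection onto the span of the `φ_k`, `k ∈ s`. -/
def proj (s : Finset ℤ) (u : L2T) : L2T := ∑ k ∈ s, coeff u k • phi k

lemma coeff_sum_smul_phi (s : Finset ℤ) (c : ℤ → ℂ) (k : ℤ) :
    coeff (∑ j ∈ s, c j • phi j) k = if k ∈ s then c k else 0 := by
  rw [coeff_sum]
  simp only [coeff_smul, coeff_phi, mul_ite, mul_one, mul_zero]
  rw [Finset.sum_ite_eq']

lemma coeff_proj (s : Finset ℤ) (u : L2T) (k : ℤ) :
    coeff (proj s u) k = if k ∈ s then coeff u k else 0 := coeff_sum_smul_phi s _ k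

lemma proj_add (s : Finset ℤ) (u v : L2T) : proj s (u + v) = proj s u + proj s v := by
  simp only [proj, coeff_add, add_smul, Finset.sum_add_distrib]

lemma proj_sub (s : Finset ℤ) (u v : L2T) : proj s (u - v) = proj s u - proj s v := by
  simp only [proj, coeff_sub, sub_smul, Finset.sum_sub_distrib]

lemma norm_sq_eq_sum {s : Finset ℤ} {u : L2T} (hu : ∀ k ∉ s, coeff u k = 0) :
    ‖u‖ ^ 2 = ∑ k ∈ s, ‖coeff u k‖ ^ 2 :=
  (hasSum_norm_coeff_sq u).unique (hasSum_sum_of_ne_finset_zero fun k hk => by simp [hu k hk])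

lemma sobolevSq_one_eq_sum {s : Finset ℤ} {u : L2T} (hu : ∀ k ∉ s, coeff u k = 0) :
    sobolevSq 1 u = ENNReal.ofReal (∑ k ∈ s, (1 + lam k) * ‖coeff u k‖ ^ 2) := by
  rw [sobolevSq_one, tsum_eq_sum (s := s) (fun k hk => by simp [hu k hk]),
    ENNReal.ofReal_sum_of_nonneg fun k _ => by have := lam_nonneg k; positivity]

lemma sobolevSq_two_eq_sum {s : Finset ℤ} {u : L2T} (hu : ∀ k ∉ s, coeff u k = 0) :
    sobolevSq 2 u = ENNReal.ofReal (∑ k ∈ s, (1 + lam k) ^ 2 * ‖coeff u k‖ ^ 2) := by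
  rw [sobolevSq_two, tsum_eq_sum (s := s) (fun k hk => by simp [hu k hk]),
    ENNReal.ofReal_sum_of_nonneg fun k _ => by have := lam_nonneg k; positivity]

lemma sobolevSq_one_lt_top {s : Finset ℤ} {u : L2T} (hu : ∀ k ∉ s, coeff u k = 0) :
    sobolevSq 1 u < ∞ := by
  rw [sobolevSq_one_eq_sum hu]; exact ENNReal.ofReal_lt_top

lemma h1Sq_eq_sum {s : Finset ℤ} {u : L2T} (hu : ∀ k ∉ s, coeff u k = 0) :
    h1Sq u = ∑ k ∈ s, (1 + lam k) * ‖coeff u k‖ ^ 2 := by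
  rw [h1Sq, sobolevSq_one_eq_sum hu, ENNReal.toReal_ofReal]
  exact Finset.sum_nonneg fun k _ => by have := lam_nonneg k; positivity

lemma coeff_proj_of_notMem {s : Finset ℤ} (u : L2T) : ∀ k ∉ s, coeff (proj s u) k = 0 :=
  fun k hk => by rw [coeff_proj, if_neg hk]

lemma proj_eq_self {s : Finset ℤ} {u : L2T} (hu : ∀ k ∉ s, coeff u k = 0) : proj s u = u :=
  coeff_ext fun k => by
    rw [coeff_proj]
    split_ifs with h
    · rfl
    · exact (hu k h).symm

lemma sobolevSq_one_proj_lt_top (s : Finset ℤ) (u : L2T) : sobolevSq 1 (proj s u) < ∞ :=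
  sobolevSq_one_lt_top (coeff_proj_of_notMem u)

lemma h1Sq_proj (s : Finset ℤ) (u : L2T) :
    h1Sq (proj s u) = ∑ k ∈ s, (1 + lam k) * ‖coeff u k‖ ^ 2 := by
  rw [h1Sq_eq_sum (coeff_proj_of_notMem u)]
  exact Finset.sum_congr rfl fun k hk => by rw [coeff_proj, if_pos hk]

lemma sobolevSq_one_proj_le (s : Finset ℤ) (u : L2T) : sobolevSq 1 (proj s u) ≤ sobolevSq 1 u := by
  rw [sobolevSq_one, sobolevSq_one]
  refine ENNReal.tsum_le_tsum fun k => ?_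
  rw [coeff_proj]
  split_ifs with h
  · rfl
  · simp

lemma sum_norm_coeff_sq_le_norm_sq (s : Finset ℤ) (u : L2T) :
    ∑ k ∈ s, ‖coeff u k‖ ^ 2 ≤ ‖u‖ ^ 2 :=
  sum_le_hasSum s (fun _ _ => by positivity) (hasSum_norm_coeff_sq u)

lemma norm_proj_le (s : Finset ℤ) (u : L2T) : ‖proj s u‖ ≤ ‖u‖ := by
  rw [← pow_le_pow_iff_left₀ (norm_nonneg _) (norm_nonneg _) two_ne_zero,
    norm_sq_eq_sum (coeff_proj_of_notMem u)]
  refine le_trans (le_of_eq ?_) (sum_norm_coeff_sq_le_norm_sq s u)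
  exact Finset.sum_congr rfl fun k hk => by rw [coeff_proj, if_pos hk]

/-- Trigonometric polynomials of a given degree are bounded, which makes the Galerkin field locally
Lipschitz. -/
lemma ae_norm_proj_le (s : Finset ℤ) (u : L2T) :
    ∀ᵐ x ∂AddCircle.haarAddCircle, ‖proj s u x‖ ≤ s.card * ‖u‖ := by
  filter_upwards [ae_norm_le_tsum_coeff (summable_norm_coeff (sobolevSq_one_proj_lt_top s u))]
    with x hx
  refine hx.trans ?_
  rw [tsum_eq_sum (s := s) (fun k hk => by rw [coeff_proj_of_notMem u k hk, norm_zero])]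
  refine (Finset.sum_le_card_nsmul s _ ‖u‖ fun k _ => ?_).trans (le_of_eq (nsmul_eq_mul _ _))
  exact (norm_coeff_le _ _).trans (norm_proj_le s u)

lemma psiMem_proj (R μ : ℝ) (s : Finset ℤ) (u : L2T) : PsiMem R μ (proj s u) :=
  psiMem_of_bounded (ae_norm_proj_le s u)

/-- `psi` is Lipschitz on bounded sets of trigonometric polynomials of a given degree. -/
lemma norm_psiL2_proj_sub_le (R μ : ℝ) (s : Finset ℤ) {r : ℝ} {u v : L2T} (hu : ‖u‖ ≤ r)
    (hv : ‖v‖ ≤ r) :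
    ‖psiL2 R μ (proj s u) - psiL2 R μ (proj s v)‖ ≤
      psiLip R μ * (1 + 2 * (s.card * r) ^ 2) * ‖u - v‖ := by
  have hr : (s.card : ℝ) * ‖u‖ ≤ s.card * r := by gcongr
  have hr' : (s.card : ℝ) * ‖v‖ ≤ s.card * r := by gcongr
  refine (norm_psiL2_sub_le_of_bounded (B := s.card * r)
    ((ae_norm_proj_le s u).mono fun x hx => hx.trans hr)
    ((ae_norm_proj_le s v).mono fun x hx => hx.trans hr')).trans ?_
  have := psiLip_nonneg R μ
  gcongr
  rw [← proj_sub]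
  exact norm_proj_le s _

lemma continuous_psiL2_proj (R μ : ℝ) (s : Finset ℤ) :
    Continuous fun u => psiL2 R μ (proj s u) := by
  refine continuous_iff_continuousAt.2 fun u => ?_
  have hL : LipschitzOnWith (psiLip R μ * (1 + 2 * (s.card * (‖u‖ + 1)) ^ 2)).toNNReal
      (fun u => psiL2 R μ (proj s u)) (Metric.closedBall 0 (‖u‖ + 1)) := by
    refine LipschitzOnWith.of_dist_le_mul fun x hx y hy => ?_
    have := psiLip_nonneg R μ
    rw [dist_eq_norm, dist_eq_norm, Real.coe_toNNReal _ (by positivity)]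
    exact norm_psiL2_proj_sub_le R μ s (by simpa using hx) (by simpa using hy)
  refine hL.continuousOn.continuousAt (Metric.closedBall_mem_nhds_of_mem ?_)
  simp

/-- The vector field of the Galerkin equation with forcing `y`,
`a ↦ P (A a + psi (P (a + y)))`, where `P` is the projection `proj s`. -/
def galerkinField (R ν μ : ℝ) (s : Finset ℤ) (y a : L2T) : L2T :=
  ∑ k ∈ s, (-((1 + ν * Complex.I) * lam k) * coeff a k +
    coeff (psiL2 R μ (proj s (a + y))) k) • phi k

lemma coeff_galerkinField (R ν μ : ℝ) (s : Finset ℤ) (y a : L2T) (k : ℤ) :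
    coeff (galerkinField R ν μ s y a) k = if k ∈ s then
      (-((1 + ν * Complex.I) * lam k) * coeff a k + coeff (psiL2 R μ (proj s (a + y))) k) else 0 :=
  coeff_sum_smul_phi s _ k

lemma real_inner_eq_re (u v : L2T) : inner ℝ u v = (inner ℂ u v).re := by
  rw [L2.inner_def, L2.inner_def]
  exact integral_re (L2.integrable_inner (𝕜 := ℂ) u v)

lemma inner_eq_sum {s : Finset ℤ} {u : L2T} (hu : ∀ k ∉ s, coeff u k = 0) (v : L2T) :
    inner ℂ u v = ∑ k ∈ s, (starRingEnd ℂ) (coeff u k) * coeff v k := by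
  conv_lhs => rw [← proj_eq_self hu, proj]
  rw [sum_inner]
  refine Finset.sum_congr rfl fun k _ => ?_
  rw [inner_smul_left, ← coeff_eq_inner]

/-- The energy identity for one Fourier mode of the Galerkin field. -/
lemma re_conj_mul_galerkin (ν : ℝ) (k : ℤ) (a g : ℂ) :
    ((starRingEnd ℂ) a * (-((1 + ν * Complex.I) * lam k) * a + g)).re =
      -(lam k * ‖a‖ ^ 2) + ((starRingEnd ℂ) a * g).re := by
  have h : (starRingEnd ℂ) a * (-((1 + ν * Complex.I) * lam k) * a + g) =
      -((1 + ν * Complex.I) * ((lam k * ‖a‖ ^ 2 : ℝ) : ℂ)) + (starRingEnd ℂ) a * g := by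
    have h1 := Complex.conj_mul' a
    push_cast
    linear_combination (-((1 + ν * Complex.I) * lam k)) * h1
  rw [h, Complex.add_re, Complex.neg_re, Complex.re_mul_ofReal]
  simp

lemma sum_re_conj_mul_eq_inner (s : Finset ℤ) (a f : L2T) :
    ∑ k ∈ s, ((starRingEnd ℂ) (coeff a k) * coeff f k).re = (inner ℂ (proj s a) f).re := by
  rw [inner_eq_sum (coeff_proj_of_notMem a), Complex.re_sum]
  exact Finset.sum_congr rfl fun k hk => by rw [coeff_proj, if_pos hk]

lemma real_inner_galerkinField (R ν μ : ℝ) (s : Finset ℤ) (y a : L2T) :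
    inner ℝ a (galerkinField R ν μ s y a) = -∑ k ∈ s, lam k * ‖coeff a k‖ ^ 2 +
      (inner ℂ (proj s a) (psiL2 R μ (proj s (a + y)))).re := by
  have h : inner ℂ a (galerkinField R ν μ s y a) = ∑ k ∈ s, (starRingEnd ℂ) (coeff a k) *
      (-((1 + ν * Complex.I) * lam k) * coeff a k + coeff (psiL2 R μ (proj s (a + y))) k) := by
    rw [galerkinField, inner_sum]
    refine Finset.sum_congr rfl fun k _ => ?_
    rw [inner_smul_right, mul_comm, coeff_eq_inner a, inner_conj_symm]
  rw [real_inner_eq_re, h, Complex.re_sum, ← sum_re_conj_mul_eq_inner, ← Finset.sum_neg_distrib,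
    ← Finset.sum_add_distrib]
  exact Finset.sum_congr rfl fun k _ => re_conj_mul_galerkin ν k _ _

/-- `a` solves the Galerkin equation on the modes in `s`, with initial value `u₀` and forcing
path `η`. -/
def IsGalerkin (R ν μ T : ℝ) (u₀ : L2T) (η : ℝ → L2T) (s : Finset ℤ) (a : ℝ → L2T) : Prop :=
  a 0 = proj s u₀ ∧
    ∀ t ∈ Icc 0 T, HasDerivWithinAt a (galerkinField R ν μ s (η t) (a t)) (Icc 0 T) t

theorem exists_isGalerkin (R ν μ : ℝ) {T : ℝ} (hT : 0 ≤ T) (u₀ : L2T) {η : ℝ → L2T}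
    (hη : ContinuousOn η (Icc 0 T)) (s : Finset ℤ) : ∃ a, IsGalerkin R ν μ T u₀ η s a := by
  obtain ⟨S, hS⟩ := isCompact_Icc.exists_bound_of_continuousOn hη
  have hS0 : 0 ≤ S := (norm_nonneg _).trans (hS 0 ⟨le_rfl, hT⟩)
  set Λ : ℝ := ∑ k ∈ s, (1 + lam k) * S ^ 2 with hΛ
  have hD := psiDiss_nonneg R μ
  refine exists_solution_of_dissipative (F := fun t a => galerkinField R ν μ s (η t) a)
    (C := psiDiss R μ * (1 + 10 * (S ^ 3 * √Λ))) hT (by positivity) (fun a => ?_) (fun r => ?_)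
    (fun t ht a => ?_) (proj s u₀)
  · unfold galerkinField
    refine continuousOn_finsetSum _ fun k _ => ?_
    have h : Continuous fun y => (-((1 + ν * Complex.I) * lam k) * coeff a k +
        coeff (psiL2 R μ (proj s (a + y))) k) • phi k :=
      (continuous_const.add ((continuous_coeff k).comp ((continuous_psiL2_proj R μ s).comp
        (continuous_const.add continuous_id)))).smul continuous_const
    exact h.comp_continuousOn hη
  · set P : ℝ := psiLip R μ * (1 + 2 * (s.card * (r + S)) ^ 2) with hP
    refine ⟨∑ k ∈ s, (‖-((1 + ν * Complex.I) * lam k)‖ + P), fun t ht a b ha hb => ?_⟩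
    have e : galerkinField R ν μ s (η t) a - galerkinField R ν μ s (η t) b = ∑ k ∈ s,
        (-((1 + ν * Complex.I) * lam k) * coeff (a - b) k + coeff (psiL2 R μ (proj s (a + η t)) -
          psiL2 R μ (proj s (b + η t))) k) • phi k := by
      rw [galerkinField, galerkinField, ← Finset.sum_sub_distrib]
      refine Finset.sum_congr rfl fun k _ => ?_
      rw [← sub_smul, coeff_sub, coeff_sub]
      congr 1
      ring
    have hp := norm_psiL2_proj_sub_le R μ s (r := r + S) (u := a + η t) (v := b + η t)
      ((norm_add_le _ _).trans (add_le_add ha (hS t ht)))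
      ((norm_add_le _ _).trans (add_le_add hb (hS t ht)))
    rw [add_sub_add_right_eq_sub] at hp
    rw [e, Finset.sum_mul]
    refine norm_sum_le_of_le _ fun k _ => ?_
    rw [norm_smul, norm_phi, mul_one]
    refine (norm_add_le _ _).trans ?_
    rw [norm_mul, add_mul ‖-((1 + ν * Complex.I) * lam k)‖ P]
    exact add_le_add (mul_le_mul_of_nonneg_left (norm_coeff_le _ _)
      (norm_nonneg (-((1 + ν * Complex.I) * lam k) : ℂ)))
      ((norm_coeff_le _ _).trans hp)
  · rw [real_inner_galerkinField, proj_add]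
    have h1 : 0 ≤ ∑ k ∈ s, lam k * ‖coeff a k‖ ^ 2 :=
      Finset.sum_nonneg fun k _ => mul_nonneg (lam_nonneg k) (sq_nonneg _)
    have h2 := re_inner_psiL2_le R μ (v := proj s a) (z := proj s (η t))
      (sobolevSq_one_proj_lt_top _ _) (by rw [← proj_add]; exact psiMem_proj _ _ _ _)
    have h3 : ‖proj s (η t)‖ ≤ S := (norm_proj_le _ _).trans (hS t ht)
    have h4 : h1Sq (proj s (η t)) ≤ Λ := by
      rw [h1Sq_proj]
      refine Finset.sum_le_sum fun k _ => ?_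
      have := lam_nonneg k
      gcongr
      exact (norm_coeff_le _ _).trans (hS t ht)
    have h5 : psiDiss R μ * (1 + 10 * (‖proj s (η t)‖ ^ 3 * √(h1Sq (proj s (η t))))) ≤
        psiDiss R μ * (1 + 10 * (S ^ 3 * √Λ)) := by gcongr
    linarith

namespace IsGalerkin

variable {R ν μ T : ℝ} {u₀ : L2T} {η : ℝ → L2T} {s : Finset ℤ} {a : ℝ → L2T}

lemma continuousOn (ha : IsGalerkin R ν μ T u₀ η s a) : ContinuousOn a (Icc 0 T) :=
  fun t ht => (ha.2 t ht).continuousWithinAt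

lemma hasDerivWithinAt_coeff (ha : IsGalerkin R ν μ T u₀ η s a) {t : ℝ} (ht : t ∈ Icc 0 T)
    (k : ℤ) :
    HasDerivWithinAt (fun t => coeff (a t) k) (coeff (galerkinField R ν μ s (η t) (a t)) k)
      (Icc 0 T) t := by
  have h := ((coeffL k).restrictScalars ℝ).hasFDerivAt.comp_hasDerivWithinAt t (ha.2 t ht)
  simp only [ContinuousLinearMap.coe_restrictScalars', coeffL_apply] at h
  refine h.congr_of_mem (fun x _ => ?_) ht
  simp [coeffL_apply]

lemma coeff_eq_zero (ha : IsGalerkin R ν μ T u₀ η s a) {t : ℝ} (ht : t ∈ Icc 0 T) :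
    ∀ k ∉ s, coeff (a t) k = 0 := by
  intro k hk
  have h := constant_of_has_deriv_right_zero (f := fun t => coeff (a t) k) (a := 0) (b := T)
    ((continuous_coeff k).comp_continuousOn ha.continuousOn) (fun x hx => ?_) t ht
  · rw [h, ha.1, coeff_proj, if_neg hk]
  · have h1 := ha.hasDerivWithinAt_coeff (Ico_subset_Icc_self hx) k
    rw [coeff_galerkinField, if_neg hk] at h1
    exact h1.mono_of_mem_nhdsWithin (Icc_mem_nhdsGE_of_mem hx)

lemma proj_eq (ha : IsGalerkin R ν μ T u₀ η s a) {t : ℝ} (ht : t ∈ Icc 0 T) :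
    proj s (a t) = a t := proj_eq_self (ha.coeff_eq_zero ht)

lemma proj_add_eq (ha : IsGalerkin R ν μ T u₀ η s a) {t : ℝ} (ht : t ∈ Icc 0 T) :
    proj s (a t + η t) = a t + proj s (η t) := by rw [proj_add, ha.proj_eq ht]

/-- The energy identity for weighted sums of squares of Fourier coefficients. -/
lemma hasDerivWithinAt_sum (ha : IsGalerkin R ν μ T u₀ η s a) (c : ℤ → ℝ) {t : ℝ}
    (ht : t ∈ Icc 0 T) :
    HasDerivWithinAt (fun t => ∑ k ∈ s, c k * ‖coeff (a t) k‖ ^ 2)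
      (∑ k ∈ s, c k * (2 * (-(lam k * ‖coeff (a t) k‖ ^ 2) + ((starRingEnd ℂ) (coeff (a t) k) *
        coeff (psiL2 R μ (a t + proj s (η t))) k).re))) (Icc 0 T) t := by
  refine HasDerivWithinAt.fun_sum fun k hk => HasDerivWithinAt.const_mul _ ?_
  have h := (ha.hasDerivWithinAt_coeff ht k).norm_sq
  rw [coeff_galerkinField, if_pos hk, Complex.inner, mul_comm _ ((starRingEnd ℂ) _),
    re_conj_mul_galerkin, ha.proj_add_eq ht] at h
  exact h

lemma continuousOn_psiL2 (ha : IsGalerkin R ν μ T u₀ η s a) (hη : ContinuousOn η (Icc 0 T)) :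
    ContinuousOn (fun t => psiL2 R μ (a t + proj s (η t))) (Icc 0 T) := by
  refine ((continuous_psiL2_proj R μ s).comp_continuousOn (ha.continuousOn.add hη)).congr ?_
  intro t ht
  simp only [Function.comp, Pi.add_apply]
  rw [ha.proj_add_eq ht]

/-- Variation of constants. -/
lemma coeff_eq (ha : IsGalerkin R ν μ T u₀ η s a) (hη : ContinuousOn η (Icc 0 T)) {t : ℝ}
    (ht : t ∈ Icc 0 T) {k : ℤ} (hk : k ∈ s) :
    coeff (a t) k = Complex.exp (-((1 + ν * Complex.I) * lam k * t)) * coeff u₀ k +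
      ∫ r in (0 : ℝ)..t, Complex.exp (-((1 + ν * Complex.I) * lam k * ((t - r : ℝ) : ℂ))) *
        coeff (psiL2 R μ (a r + proj s (η r))) k := by
  set c : ℂ := (1 + ν * Complex.I) * lam k with hc
  set g : ℝ → ℂ := fun r => coeff (psiL2 R μ (a r + proj s (η r))) k with hg
  have hgc : ContinuousOn g (Icc 0 T) :=
    (continuous_coeff k).comp_continuousOn (ha.continuousOn_psiL2 hη)
  have hsub : Icc 0 t ⊆ Icc 0 T := Icc_subset_Icc_right ht.2
  have hexp : ∀ r : ℝ, HasDerivAt (fun r : ℝ => Complex.exp (-(c * ((t - r : ℝ) : ℂ))))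
      (Complex.exp (-(c * ((t - r : ℝ) : ℂ))) * c) r := by
    intro r
    have h1 : HasDerivAt (fun r : ℝ => ((t - r : ℝ) : ℂ)) (-1) r := by
      have := ((hasDerivAt_id r).const_sub t).ofReal_comp
      simpa using this
    have h2 := (h1.const_mul c).fun_neg.cexp
    simpa using h2
  have hder : ∀ r ∈ Ioo 0 t, HasDerivAt (fun r : ℝ => Complex.exp (-(c * ((t - r : ℝ) : ℂ))) *
      coeff (a r) k) (Complex.exp (-(c * ((t - r : ℝ) : ℂ))) * g r) r := by
    intro r hr
    have hrT : r ∈ Icc 0 T := hsub (Ioo_subset_Icc_self hr)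
    have h1 := (ha.hasDerivWithinAt_coeff hrT k).hasDerivAt
      (Icc_mem_nhds hr.1 (hr.2.trans_le ht.2))
    rw [coeff_galerkinField, if_pos hk, ha.proj_add_eq hrT] at h1
    have h2 := (hexp r).mul h1
    refine h2.congr_deriv ?_
    ring
  have hcexp : Continuous fun r : ℝ => Complex.exp (-(c * ((t - r : ℝ) : ℂ))) := by fun_prop
  have hint : ∫ r in (0 : ℝ)..t, Complex.exp (-(c * ((t - r : ℝ) : ℂ))) * g r =
      Complex.exp (-(c * ((t - t : ℝ) : ℂ))) * coeff (a t) k -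
      Complex.exp (-(c * ((t - 0 : ℝ) : ℂ))) * coeff (a 0) k :=
    intervalIntegral.integral_eq_sub_of_hasDerivAt_of_le ht.1
    (hcexp.continuousOn.mul
      (((continuous_coeff k).comp_continuousOn ha.continuousOn).mono hsub)) hder
    (ContinuousOn.intervalIntegrable_of_Icc ht.1
      (hcexp.continuousOn.mul (hgc.mono hsub)))
  rw [hint, ha.1, coeff_proj, if_pos hk]
  simp

end IsGalerkin

/-! ### Energy estimates for the Galerkin approximations -/

lemma integral_lincomb {T t : ℝ} (ht : t ∈ Icc 0 T) {f g h : ℝ → ℝ} (hf : ContinuousOn f (Icc 0 T))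
    (hg : ContinuousOn g (Icc 0 T)) (hh : ContinuousOn h (Icc 0 T)) (c₀ c₁ c₂ c₃ : ℝ) :
    ∫ r in (0 : ℝ)..t, (c₀ + c₁ * f r + c₂ * g r + c₃ * h r) = c₀ * t +
      c₁ * (∫ r in (0 : ℝ)..t, f r) + c₂ * (∫ r in (0 : ℝ)..t, g r) +
      c₃ * ∫ r in (0 : ℝ)..t, h r := by
  have hsub : Icc 0 t ⊆ Icc 0 T := Icc_subset_Icc_right ht.2
  have i1 : IntervalIntegrable (fun r => c₁ * f r) volume 0 t :=
    ((hf.mono hsub).intervalIntegrable_of_Icc ht.1).const_mul c₁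
  have i2 : IntervalIntegrable (fun r => c₂ * g r) volume 0 t :=
    ((hg.mono hsub).intervalIntegrable_of_Icc ht.1).const_mul c₂
  have i3 : IntervalIntegrable (fun r => c₃ * h r) volume 0 t :=
    ((hh.mono hsub).intervalIntegrable_of_Icc ht.1).const_mul c₃
  have i0 : IntervalIntegrable (fun _ => c₀) volume 0 t := intervalIntegrable_const
  rw [intervalIntegral.integral_add ((i0.add i1).add i2) i3,
    intervalIntegral.integral_add (i0.add i1) i2, intervalIntegral.integral_add i0 i1,
    intervalIntegral.integral_const_mul, intervalIntegral.integral_const_mul,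
    intervalIntegral.integral_const_mul, intervalIntegral.integral_const, smul_eq_mul, sub_zero,
    mul_comm t]

lemma integral_nonneg_of_Icc {T t : ℝ} (ht : t ∈ Icc 0 T) {f : ℝ → ℝ}
    (h0 : ∀ r ∈ Icc 0 T, 0 ≤ f r) : 0 ≤ ∫ r in (0 : ℝ)..t, f r :=
  intervalIntegral.integral_nonneg ht.1 fun r hr => h0 r ⟨hr.1, hr.2.trans ht.2⟩

lemma integral_le_integral_of_nonneg {T t : ℝ} (ht : t ∈ Icc 0 T) {f : ℝ → ℝ}
    (hf : ContinuousOn f (Icc 0 T)) (h0 : ∀ r ∈ Icc 0 T, 0 ≤ f r) :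
    ∫ r in (0 : ℝ)..t, f r ≤ ∫ r in (0 : ℝ)..T, f r := by
  have hT : 0 ≤ T := ht.1.trans ht.2
  have h1 : IntervalIntegrable f volume 0 T := hf.intervalIntegrable_of_Icc hT
  refine intervalIntegral.integral_mono_interval le_rfl ht.1 ht.2 ?_ h1
  filter_upwards [ae_restrict_mem measurableSet_Ioc] with r hr
  exact h0 r (Ioc_subset_Icc_self hr)

/-- The squared norm `∑ λ_k |u_k|²` of the gradient, over the modes in `s`. -/
def gradSq (s : Finset ℤ) (u : L2T) : ℝ := ∑ k ∈ s, lam k * ‖coeff u k‖ ^ 2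

/-- The squared norm `∑ λ_k² |u_k|²` of the Laplacian, over the modes in `s`. -/
def laplSq (s : Finset ℤ) (u : L2T) : ℝ := ∑ k ∈ s, lam k ^ 2 * ‖coeff u k‖ ^ 2

lemma gradSq_nonneg (s : Finset ℤ) (u : L2T) : 0 ≤ gradSq s u :=
  Finset.sum_nonneg fun k _ => mul_nonneg (lam_nonneg k) (sq_nonneg _)

lemma laplSq_nonneg (s : Finset ℤ) (u : L2T) : 0 ≤ laplSq s u :=
  Finset.sum_nonneg fun k _ => by positivity

lemma continuous_gradSq (s : Finset ℤ) : Continuous (gradSq s) :=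
  continuous_finsetSum _ fun k _ => continuous_const.mul ((continuous_coeff k).norm.pow 2)

lemma continuous_laplSq (s : Finset ℤ) : Continuous (laplSq s) :=
  continuous_finsetSum _ fun k _ => continuous_const.mul ((continuous_coeff k).norm.pow 2)

lemma continuous_h1Sq_proj (s : Finset ℤ) : Continuous fun u => h1Sq (proj s u) := by
  simp only [h1Sq_proj]
  exact continuous_finsetSum _ fun k _ => continuous_const.mul ((continuous_coeff k).norm.pow 2)

/-- The constant in the `L²` energy estimate. -/
def energyConst (R μ T M : ℝ) : ℝ := M ^ 2 + 12 * psiDiss R μ * (1 + T)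

/-- The constant in the estimate of the nonlinearity in `L²(0, T; L²)`. -/
def forceConst (R μ T M : ℝ) : ℝ :=
  psiGrowth R μ * (T + 100 * energyConst R μ T M ^ 3 * (1 + T) + 100)

lemma energyConst_nonneg {R μ T M : ℝ} (hT : 0 ≤ T) : 0 ≤ energyConst R μ T M := by
  have := psiDiss_nonneg R μ
  unfold energyConst; positivity

lemma forceConst_nonneg {R μ T M : ℝ} (hT : 0 ≤ T) : 0 ≤ forceConst R μ T M := by
  have := psiGrowth_nonneg R μ
  have := energyConst_nonneg (R := R) (μ := μ) (M := M) hT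
  unfold forceConst; positivity

namespace IsGalerkin

variable {R ν μ T M S I : ℝ} {u₀ : L2T} {η : ℝ → L2T} {s : Finset ℤ} {a : ℝ → L2T}

lemma h1Sq_eq (ha : IsGalerkin R ν μ T u₀ η s a) {t : ℝ} (ht : t ∈ Icc 0 T) :
    h1Sq (a t) = ‖a t‖ ^ 2 + gradSq s (a t) := by
  rw [h1Sq_eq_sum (ha.coeff_eq_zero ht), norm_sq_eq_sum (ha.coeff_eq_zero ht), gradSq,
    ← Finset.sum_add_distrib]
  exact Finset.sum_congr rfl fun k _ => by ring

/-- The `L²` energy estimate. -/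
lemma energy_le (ha : IsGalerkin R ν μ T u₀ η s a) (hη : ContinuousOn η (Icc 0 T))
    (hM : ‖u₀‖ ≤ M) (hS : ∀ t ∈ Icc 0 T, ‖η t‖ ≤ S)
    (hI : ∫ t in (0 : ℝ)..T, h1Sq (proj s (η t)) ≤ I) {t : ℝ} (ht : t ∈ Icc 0 T) :
    ‖a t‖ ^ 2 + ∫ r in (0 : ℝ)..t, gradSq s (a r) ≤
      energyConst R μ T M * (1 + S ^ 4 + I ^ 2) := by
  have hT : 0 ≤ T := ht.1.trans ht.2
  have hS0 : 0 ≤ S := (norm_nonneg _).trans (hS t ht)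
  set θ := 1 + S ^ 4 + I ^ 2 with hθ
  have hθ1 : 1 ≤ θ := by rw [hθ]; nlinarith [sq_nonneg (S ^ 2), sq_nonneg I]
  set D := psiDiss R μ with hD
  have hD0 : 0 ≤ D := psiDiss_nonneg R μ
  have hcn : ContinuousOn (fun r => gradSq s (a r)) (Icc 0 T) :=
    (continuous_gradSq s).comp_continuousOn ha.continuousOn
  have hcH : ContinuousOn (fun r => h1Sq (proj s (η r))) (Icc 0 T) :=
    (continuous_h1Sq_proj s).comp_continuousOn hη
  -- The term `S³ ‖η‖_{H¹}` is split by Young's inequality with the weight `θ`, so that its integral is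
  -- at most a multiple of `S⁶ I / θ + θ T`, and `S⁶ I ≤ θ²`.
  have h1 := sub_le_integral_of_deriv_le
    (φ := fun r => 2 * D * (1 + 5 * θ) + (-2) * gradSq s (a r) +
      (2 * D * (5 * (S ^ 6 / θ))) * h1Sq (proj s (η r)) + 0 * gradSq s (a r))
    (fun r hr => ha.hasDerivWithinAt_sum (fun _ => 1) hr) (by fun_prop) (fun r hr => ?_) ht
  · rw [integral_lincomb ht hcn hcH hcn] at h1
    simp only [one_mul] at h1
    rw [← norm_sq_eq_sum (ha.coeff_eq_zero ht), ← norm_sq_eq_sum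
      (ha.coeff_eq_zero (t := 0) ⟨le_rfl, hT⟩), ha.1] at h1
    have h2 : ‖proj s u₀‖ ^ 2 ≤ M ^ 2 := by
      gcongr
      exact (norm_proj_le s u₀).trans hM
    have h3 := integral_nonneg_of_Icc ht fun r _ => gradSq_nonneg s (a r)
    have h4 := (integral_le_integral_of_nonneg ht hcH fun r _ => h1Sq_nonneg _).trans hI
    have hI0 : 0 ≤ I := (integral_nonneg_of_Icc ht fun r _ => h1Sq_nonneg _).trans h4
    have h5 : S ^ 6 / θ * I ≤ θ := by
      rw [div_mul_eq_mul_div, div_le_iff₀ (by linarith)]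
      have e : (S ^ 4 + I ^ 2) * (S ^ 4 + I ^ 2) - S ^ 6 * I =
          S ^ 4 * (S ^ 2 - I / 2) ^ 2 + 7 / 4 * (S ^ 4 * I ^ 2) + I ^ 4 := by ring
      have e1 : 0 ≤ S ^ 4 * (S ^ 2 - I / 2) ^ 2 + 7 / 4 * (S ^ 4 * I ^ 2) + I ^ 4 := by positivity
      have e2 : (S ^ 4 + I ^ 2) * (S ^ 4 + I ^ 2) ≤ θ * θ := by
        gcongr <;> rw [hθ] <;> linarith
      linarith
    have h6 : 2 * D * (5 * (S ^ 6 / θ)) * ∫ r in (0 : ℝ)..t, h1Sq (proj s (η r)) ≤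
        10 * D * θ := by
      calc _ ≤ 2 * D * (5 * (S ^ 6 / θ)) * I := by gcongr
        _ = 10 * D * (S ^ 6 / θ * I) := by ring
        _ ≤ _ := by gcongr
    have h7 : 2 * D * (1 + 5 * θ) * t ≤ 12 * D * θ * T := by
      calc _ ≤ 2 * D * (θ + 5 * θ) * T := by
            have ht1 := ht.1
            have ht2 := ht.2
            gcongr
        _ = _ := by ring
    have h8 : M ^ 2 ≤ M ^ 2 * θ := le_mul_of_one_le_right (sq_nonneg M) hθ1
    have h9 : 0 ≤ D * θ := by positivity
    unfold energyConst
    rw [← hD]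
    nlinarith
  · have hm := psiMem_proj R μ s (a r + η r)
    rw [ha.proj_add_eq hr] at hm
    have h2 := re_inner_psiL2_le R μ (v := a r) (z := proj s (η r))
      (sobolevSq_one_proj_lt_top _ _) hm
    have h3 := sum_re_conj_mul_eq_inner s (a r) (psiL2 R μ (a r + proj s (η r)))
    rw [ha.proj_eq hr] at h3
    have h4 : ‖proj s (η r)‖ ^ 3 * √(h1Sq (proj s (η r))) ≤
        1 / 2 * (S ^ 6 / θ * h1Sq (proj s (η r)) + θ) := by
      set H := h1Sq (proj s (η r))
      have hH : √H ^ 2 = H := Real.sq_sqrt (h1Sq_nonneg _)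
      calc _ ≤ S ^ 3 * √H := by
            gcongr
            exact (norm_proj_le _ _).trans (hS r hr)
        _ ≤ _ := by
          have h5 : 0 ≤ (S ^ 3 * √H - θ) ^ 2 / θ := by positivity
          have h6 : (S ^ 3 * √H - θ) ^ 2 / θ = S ^ 6 / θ * √H ^ 2 + θ - 2 * (S ^ 3 * √H) := by
            field_simp
            ring
          rw [hH] at h6
          linarith
    have h5 : ∑ k ∈ s, (1 : ℝ) * (2 * (-(lam k * ‖coeff (a r) k‖ ^ 2) +
        ((starRingEnd ℂ) (coeff (a r) k) * coeff (psiL2 R μ (a r + proj s (η r))) k).re)) =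
        -2 * gradSq s (a r) + 2 * (inner ℂ (a r) (psiL2 R μ (a r + proj s (η r)))).re := by
      rw [← h3, gradSq, Finset.mul_sum, Finset.mul_sum, ← Finset.sum_add_distrib]
      exact Finset.sum_congr rfl fun k _ => by ring
    rw [h5]
    have h6 : 2 * (psiDiss R μ * (1 + 10 * (‖proj s (η r)‖ ^ 3 * √(h1Sq (proj s (η r)))))) ≤
        2 * (D * (1 + 10 * (1 / 2 * (S ^ 6 / θ * h1Sq (proj s (η r)) + θ)))) := by
      rw [hD]; gcongr
    linarith

lemma norm_sq_le (ha : IsGalerkin R ν μ T u₀ η s a) (hη : ContinuousOn η (Icc 0 T))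
    (hM : ‖u₀‖ ≤ M) (hS : ∀ t ∈ Icc 0 T, ‖η t‖ ≤ S)
    (hI : ∫ t in (0 : ℝ)..T, h1Sq (proj s (η t)) ≤ I) {t : ℝ} (ht : t ∈ Icc 0 T) :
    ‖a t‖ ^ 2 ≤ energyConst R μ T M * (1 + S ^ 4 + I ^ 2) := by
  have h1 := ha.energy_le hη hM hS hI ht
  have h2 := integral_nonneg_of_Icc ht fun r _ => gradSq_nonneg s (a r)
  linarith

lemma integral_gradSq_le (ha : IsGalerkin R ν μ T u₀ η s a) (hη : ContinuousOn η (Icc 0 T))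
    (hM : ‖u₀‖ ≤ M) (hS : ∀ t ∈ Icc 0 T, ‖η t‖ ≤ S)
    (hI : ∫ t in (0 : ℝ)..T, h1Sq (proj s (η t)) ≤ I) {t : ℝ} (ht : t ∈ Icc 0 T) :
    ∫ r in (0 : ℝ)..t, gradSq s (a r) ≤ energyConst R μ T M * (1 + S ^ 4 + I ^ 2) := by
  have h1 := ha.energy_le hη hM hS hI ht
  have h2 := sq_nonneg ‖a t‖
  linarith

/-- The pointwise in time bound for the nonlinearity, by Agmon's inequality. -/
lemma norm_psiL2_sq_le (ha : IsGalerkin R ν μ T u₀ η s a) (hη : ContinuousOn η (Icc 0 T))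
    (hM : ‖u₀‖ ≤ M) (hS : ∀ t ∈ Icc 0 T, ‖η t‖ ≤ S)
    (hI : ∫ t in (0 : ℝ)..T, h1Sq (proj s (η t)) ≤ I) {t : ℝ} (ht : t ∈ Icc 0 T) :
    ‖psiL2 R μ (a t + proj s (η t))‖ ^ 2 ≤ psiGrowth R μ *
      (1 + 100 * ((energyConst R μ T M * (1 + S ^ 4 + I ^ 2)) ^ 2 *
        (energyConst R μ T M * (1 + S ^ 4 + I ^ 2) + gradSq s (a t))) +
        100 * (S ^ 4 * h1Sq (proj s (η t)))) := by
  have hm := psiMem_proj R μ s (a t + η t)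
  rw [ha.proj_add_eq ht] at hm
  refine (norm_psiL2_add_sq_le R μ (v := a t) (sobolevSq_one_lt_top (ha.coeff_eq_zero ht))
    (sobolevSq_one_proj_lt_top _ _) hm).trans ?_
  have h1 := ha.norm_sq_le hη hM hS hI ht
  have h2 : ‖proj s (η t)‖ ≤ S := (norm_proj_le _ _).trans (hS t ht)
  have h3 := psiGrowth_nonneg R μ
  have h4 := gradSq_nonneg s (a t)
  have h5 := h1Sq_nonneg (proj s (η t))
  rw [ha.h1Sq_eq ht, show ‖a t‖ ^ 4 = (‖a t‖ ^ 2) ^ 2 by ring]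
  gcongr

lemma continuousOn_majorant (ha : IsGalerkin R ν μ T u₀ η s a) (hη : ContinuousOn η (Icc 0 T)) :
    ContinuousOn (fun r => gradSq s (a r)) (Icc 0 T) ∧
      ContinuousOn (fun r => h1Sq (proj s (η r))) (Icc 0 T) ∧
      ContinuousOn (fun r => laplSq s (a r)) (Icc 0 T) :=
  ⟨(continuous_gradSq s).comp_continuousOn ha.continuousOn,
    (continuous_h1Sq_proj s).comp_continuousOn hη,
    (continuous_laplSq s).comp_continuousOn ha.continuousOn⟩

/-- The integral of the bound in `norm_psiL2_sq_le`. -/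
lemma integral_majorant_le (ha : IsGalerkin R ν μ T u₀ η s a) (hη : ContinuousOn η (Icc 0 T))
    (hM : ‖u₀‖ ≤ M) (hS : ∀ t ∈ Icc 0 T, ‖η t‖ ≤ S)
    (hI : ∫ t in (0 : ℝ)..T, h1Sq (proj s (η t)) ≤ I) {t : ℝ} (ht : t ∈ Icc 0 T) :
    psiGrowth R μ * (1 + 100 * (energyConst R μ T M * (1 + S ^ 4 + I ^ 2)) ^ 3) * t +
      psiGrowth R μ * (100 * (energyConst R μ T M * (1 + S ^ 4 + I ^ 2)) ^ 2) *
        (∫ r in (0 : ℝ)..t, gradSq s (a r)) +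
      psiGrowth R μ * (100 * S ^ 4) * (∫ r in (0 : ℝ)..t, h1Sq (proj s (η r))) ≤
    forceConst R μ T M * (1 + S ^ 4 + I ^ 2) ^ 3 := by
  have hT : 0 ≤ T := ht.1.trans ht.2
  have hS0 : 0 ≤ S := (norm_nonneg _).trans (hS t ht)
  obtain ⟨-, hcH, -⟩ := ha.continuousOn_majorant hη
  have h1 := ha.integral_gradSq_le hη hM hS hI ht
  have h2 := (integral_le_integral_of_nonneg ht hcH fun r _ => h1Sq_nonneg _).trans hI
  have hI0 : 0 ≤ I := (integral_nonneg_of_Icc ht fun r _ => h1Sq_nonneg _).trans h2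
  have hP := psiGrowth_nonneg R μ
  have hK := energyConst_nonneg (R := R) (μ := μ) (M := M) hT
  set θ := 1 + S ^ 4 + I ^ 2 with hθ
  have hθ1 : 1 ≤ θ := by rw [hθ]; nlinarith [sq_nonneg (S ^ 2), sq_nonneg I]
  have hS4 : S ^ 4 ≤ θ := by rw [hθ]; nlinarith [sq_nonneg I]
  have hI1 : I ≤ θ := by rw [hθ]; nlinarith [sq_nonneg (I - 1), sq_nonneg (S ^ 2)]
  set P := psiGrowth R μ
  set K := energyConst R μ T M with hKdef
  have hθ3 : 1 ≤ θ ^ 3 := one_le_pow₀ hθ1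
  have hθ23 : θ ^ 2 ≤ θ ^ 3 := pow_le_pow_right₀ hθ1 (by norm_num)
  calc _ ≤ P * (θ ^ 3 + 100 * (K * θ) ^ 3) * T + P * (100 * (K * θ) ^ 2) * (K * θ) +
        P * (100 * S ^ 4) * I := by
        have ht1 := ht.1
        have ht2 := ht.2
        gcongr
    _ ≤ P * (θ ^ 3 + 100 * (K * θ) ^ 3) * T + P * (100 * (K * θ) ^ 2) * (K * θ) +
        P * (100 * θ ^ 3) := by
        have : S ^ 4 * I ≤ θ ^ 3 := by
          calc S ^ 4 * I ≤ θ * θ := by gcongr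
            _ = θ ^ 2 := by ring
            _ ≤ θ ^ 3 := hθ23
        have h3 : P * (100 * S ^ 4) * I = P * (100 * (S ^ 4 * I)) := by ring
        rw [h3]
        gcongr
    _ = forceConst R μ T M * θ ^ 3 := by
        unfold forceConst
        rw [← hKdef]
        ring

lemma integral_norm_psiL2_sq_le (ha : IsGalerkin R ν μ T u₀ η s a)
    (hη : ContinuousOn η (Icc 0 T)) (hM : ‖u₀‖ ≤ M) (hS : ∀ t ∈ Icc 0 T, ‖η t‖ ≤ S)
    (hI : ∫ t in (0 : ℝ)..T, h1Sq (proj s (η t)) ≤ I) (hT : 0 ≤ T) :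
    ∫ r in (0 : ℝ)..T, ‖psiL2 R μ (a r + proj s (η r))‖ ^ 2 ≤
      forceConst R μ T M * (1 + S ^ 4 + I ^ 2) ^ 3 := by
  have hTm : T ∈ Icc 0 T := ⟨hT, le_rfl⟩
  obtain ⟨hcn, hcH, -⟩ := ha.continuousOn_majorant hη
  refine le_trans ?_ (ha.integral_majorant_le hη hM hS hI hTm)
  have h1 := integral_lincomb hTm hcn hcH hcH
    (psiGrowth R μ * (1 + 100 * (energyConst R μ T M * (1 + S ^ 4 + I ^ 2)) ^ 3))
    (psiGrowth R μ * (100 * (energyConst R μ T M * (1 + S ^ 4 + I ^ 2)) ^ 2))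
    (psiGrowth R μ * (100 * S ^ 4)) 0
  rw [zero_mul, add_zero] at h1
  rw [← h1]
  refine intervalIntegral.integral_mono_on hT
    (((ha.continuousOn_psiL2 hη).norm.pow 2).intervalIntegrable_of_Icc hT)
    (ContinuousOn.intervalIntegrable_of_Icc hT (by fun_prop)) fun r hr => ?_
  refine (ha.norm_psiL2_sq_le hη hM hS hI hr).trans (le_of_eq ?_)
  ring

/-- The `H¹` energy estimate. -/
lemma gradSq_le (ha : IsGalerkin R ν μ T u₀ η s a) (hη : ContinuousOn η (Icc 0 T))
    (hM : ‖u₀‖ ≤ M) (hS : ∀ t ∈ Icc 0 T, ‖η t‖ ≤ S)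
    (hI : ∫ t in (0 : ℝ)..T, h1Sq (proj s (η t)) ≤ I) {t : ℝ} (ht : t ∈ Icc 0 T) :
    gradSq s (a t) + ∫ r in (0 : ℝ)..t, laplSq s (a r) ≤
      gradSq s u₀ + forceConst R μ T M * (1 + S ^ 4 + I ^ 2) ^ 3 := by
  obtain ⟨hcn, hcH, hcL⟩ := ha.continuousOn_majorant hη
  have h1 := sub_le_integral_of_deriv_le
    (φ := fun r => psiGrowth R μ * (1 + 100 * (energyConst R μ T M * (1 + S ^ 4 + I ^ 2)) ^ 3) +
      psiGrowth R μ * (100 * (energyConst R μ T M * (1 + S ^ 4 + I ^ 2)) ^ 2) * gradSq s (a r) +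
      psiGrowth R μ * (100 * S ^ 4) * h1Sq (proj s (η r)) + (-1) * laplSq s (a r))
    (fun r hr => ha.hasDerivWithinAt_sum lam hr) (by fun_prop) (fun r hr => ?_) ht
  · rw [integral_lincomb ht hcn hcH hcL] at h1
    have h2 := ha.integral_majorant_le hη hM hS hI ht
    have h3 : gradSq s (a 0) = gradSq s u₀ := by
      rw [ha.1]
      exact Finset.sum_congr rfl fun k hk => by rw [coeff_proj, if_pos hk]
    rw [← h3]
    unfold gradSq at *
    linarith
  · have h2 := ha.norm_psiL2_sq_le hη hM hS hI hr
    have h3 := sum_norm_coeff_sq_le_norm_sq s (psiL2 R μ (a r + proj s (η r)))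
    have h4 : ∑ k ∈ s, lam k * (2 * (-(lam k * ‖coeff (a r) k‖ ^ 2) +
        ((starRingEnd ℂ) (coeff (a r) k) * coeff (psiL2 R μ (a r + proj s (η r))) k).re)) ≤
        -laplSq s (a r) + ∑ k ∈ s, ‖coeff (psiL2 R μ (a r + proj s (η r))) k‖ ^ 2 := by
      rw [laplSq, ← Finset.sum_neg_distrib, ← Finset.sum_add_distrib]
      refine Finset.sum_le_sum fun k _ => ?_
      set x := coeff (a r) k
      set g := coeff (psiL2 R μ (a r + proj s (η r))) k
      have h5 : ((starRingEnd ℂ) x * g).re ≤ ‖x‖ * ‖g‖ := by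
        refine (Complex.re_le_norm _).trans (le_of_eq ?_)
        rw [norm_mul, RCLike.norm_conj]
      have h6 := mul_le_mul_of_nonneg_left h5 (lam_nonneg k)
      nlinarith [sq_nonneg (lam k * ‖x‖ - ‖g‖)]
    linarith

end IsGalerkin

/-! ### Convergence of the Galerkin approximations -/

lemma ennreal_add_sq_le (x y : ℝ≥0∞) : (x + y) ^ 2 ≤ 2 * x ^ 2 + 2 * y ^ 2 := by
  have h := ENNReal.rpow_add_le_mul_rpow_add_rpow x y (p := 2) (by norm_num)
  rw [show (2 : ℝ) - 1 = 1 by norm_num, ENNReal.rpow_one, mul_add] at h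
  exact_mod_cast h

lemma lintegral_mul_sq_le {X : Type*} [MeasurableSpace X] {m : Measure X} {f g : X → ℝ≥0∞}
    (hf : AEMeasurable f m) (hg : AEMeasurable g m) :
    (∫⁻ x, f x * g x ∂m) ^ 2 ≤ (∫⁻ x, f x ^ 2 ∂m) * ∫⁻ x, g x ^ 2 ∂m := by
  refine (pow_le_pow_left' (lintegral_mul_le_sqrt hf hg) 2).trans (le_of_eq ?_)
  rw [mul_pow, ← ENNReal.rpow_natCast, ← ENNReal.rpow_natCast, ← ENNReal.rpow_mul,
    ← ENNReal.rpow_mul]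
  norm_num

/-- The convolution with `exp (-λ_k t)` on `[0, T]` gains a factor `(1 + λ_k)^{-1/2}`. -/
lemma lintegral_exp_lam_mul_sq_le {T t : ℝ} (ht : t ∈ Icc 0 T) (k : ℤ) {f : ℝ → ℝ≥0∞}
    (hf : AEMeasurable f (volume.restrict (Ioc 0 t))) :
    (∫⁻ s in Ioc 0 t, ENNReal.ofReal (Real.exp (-(lam k * (t - s)))) * f s) ^ 2 ≤
      ENNReal.ofReal (Real.exp (2 * T) * (1 + lam k)⁻¹) * ∫⁻ s in Ioc 0 t, f s ^ 2 := by
  have hk := lam_nonneg k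
  refine (lintegral_mul_sq_le (by fun_prop) hf).trans ?_
  gcongr
  have h1 : ∀ s ∈ Ioc 0 t, ENNReal.ofReal (Real.exp (-(lam k * (t - s)))) ^ 2 ≤
      ENNReal.ofReal (Real.exp (2 * T)) *
        ENNReal.ofReal (Real.exp (-((1 + lam k) * (t - s)))) := by
    intro s hs
    rw [← ENNReal.ofReal_pow (Real.exp_pos _).le, ← ENNReal.ofReal_mul (Real.exp_pos _).le,
      ← Real.exp_nat_mul, ← Real.exp_add]
    refine ENNReal.ofReal_le_ofReal (Real.exp_le_exp.2 ?_)
    have h2 := ht.1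
    have h3 := ht.2
    have h4 := hs.1
    have h5 := hs.2
    have h6 : 0 ≤ lam k * (t - s) := mul_nonneg hk (by linarith)
    push_cast
    linarith
  calc _ ≤ ∫⁻ s in Ioc 0 t, ENNReal.ofReal (Real.exp (2 * T)) *
        ENNReal.ofReal (Real.exp (-((1 + lam k) * (t - s)))) :=
        setLIntegral_mono' measurableSet_Ioc h1
    _ = ENNReal.ofReal (Real.exp (2 * T)) *
        ∫⁻ s in Ioc 0 t, ENNReal.ofReal (Real.exp (-((1 + lam k) * (t - s)))) :=
        lintegral_const_mul' _ _ ENNReal.ofReal_ne_top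
    _ ≤ ENNReal.ofReal (Real.exp (2 * T)) * ENNReal.ofReal (1 / (1 + lam k)) := by
        gcongr
        exact lintegral_exp_le (by positivity)
    _ = _ := by rw [← ENNReal.ofReal_mul (Real.exp_pos _).le, one_div]

/-- A forcing path on `[0, T]` whose Fourier coefficients are continuous and dominated by a
square-summable sequence, with the norms of `L^∞(0, T; L²)` and `L²(0, T; H¹)` bounded by `S`
and `√I`. -/
structure IsForcing (T S I : ℝ) (b : ℤ → ℝ) (η : ℝ → L2T) : Prop where
  continuousOn_coeff : ∀ k, ContinuousOn (fun t => coeff (η t) k) (Icc 0 T)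
  summable : Summable fun k => b k ^ 2
  norm_coeff_le : ∀ t ∈ Icc 0 T, ∀ k, ‖coeff (η t) k‖ ≤ b k
  norm_le : ∀ t ∈ Icc 0 T, ‖η t‖ ≤ S
  nonneg : 0 ≤ I
  lintegral_le : ∫⁻ t in Icc 0 T, sobolevSq 1 (η t) ≤ ENNReal.ofReal I

/-- The tail of a series over `ℤ`, outside a finite set. -/
def tailSum (β : ℤ → ℝ≥0∞) (s : Finset ℤ) : ℝ≥0∞ := ∑' k, if k ∈ s then 0 else β k

lemma tendsto_tailSum {β : ℤ → ℝ≥0∞} (hβ : ∑' k, β k ≠ ∞) :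
    Tendsto (tailSum β) atTop (𝓝 0) := by
  convert ENNReal.tendsto_tsum_compl_atTop_zero hβ using 2 with s
  rw [tailSum]
  have h := tsum_subtype {k : ℤ | k ∉ s} β
  rw [show (∑' (b : { x // x ∉ s }), β b) = ∑' (b : {k : ℤ | k ∉ s}), β b from rfl, h]
  refine tsum_congr fun k => ?_
  by_cases hk : k ∈ s <;> simp [hk, Set.indicator]

namespace IsForcing

variable {T S I : ℝ} {b : ℤ → ℝ} {η : ℝ → L2T}

lemma tsum_ne_top (h : IsForcing T S I b η) : ∑' k, ENNReal.ofReal (b k ^ 2) ≠ ∞ := by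
  rw [← ENNReal.ofReal_tsum_of_nonneg (fun _ => sq_nonneg _) h.summable]
  exact ENNReal.ofReal_ne_top

/-- Two projections of the forcing path that agree on `s₀` differ by at most a tail. -/
lemma enorm_proj_sub_sq_le (h : IsForcing T S I b η) {s₀ s s' : Finset ℤ} (hs : s₀ ⊆ s)
    (hs' : s₀ ⊆ s') {t : ℝ} (ht : t ∈ Icc 0 T) :
    ‖proj s (η t) - proj s' (η t)‖ₑ ^ 2 ≤ tailSum (fun k => ENNReal.ofReal (b k ^ 2)) s₀ := by
  rw [enorm_sq_eq_tsum, tailSum]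
  refine ENNReal.tsum_le_tsum fun k => ?_
  rw [coeff_sub, coeff_proj, coeff_proj]
  have hb : ‖coeff (η t) k‖ₑ ^ 2 ≤ ENNReal.ofReal (b k ^ 2) := by
    rw [← ofReal_norm, ← ENNReal.ofReal_pow (norm_nonneg _)]
    refine ENNReal.ofReal_le_ofReal ?_
    have := h.norm_coeff_le t ht k
    gcongr
  by_cases hk0 : k ∈ s₀
  · simp [hk0, hs hk0, hs' hk0]
  · rw [if_neg hk0]
    by_cases hk : k ∈ s <;> by_cases hk' : k ∈ s' <;> simp [hk, hk', hb]

lemma enorm_sub_proj_sq_le (h : IsForcing T S I b η) (s : Finset ℤ) {t : ℝ} (ht : t ∈ Icc 0 T) :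
    ‖η t - proj s (η t)‖ₑ ^ 2 ≤ tailSum (fun k => ENNReal.ofReal (b k ^ 2)) s := by
  rw [enorm_sq_eq_tsum, tailSum]
  refine ENNReal.tsum_le_tsum fun k => ?_
  rw [coeff_sub, coeff_proj]
  by_cases hk : k ∈ s
  · simp [hk]
  · rw [if_neg hk, if_neg hk, sub_zero, ← ofReal_norm, ← ENNReal.ofReal_pow (norm_nonneg _)]
    refine ENNReal.ofReal_le_ofReal ?_
    have := h.norm_coeff_le t ht k
    gcongr

lemma tendstoUniformlyOn_proj (h : IsForcing T S I b η) :
    TendstoUniformlyOn (fun s t => proj s (η t)) η atTop (Icc 0 T) := by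
  rw [Metric.tendstoUniformlyOn_iff]
  intro ε hε
  have h1 := (tendsto_tailSum h.tsum_ne_top).eventually_lt_const
    (show (0 : ℝ≥0∞) < ENNReal.ofReal (ε ^ 2) by simpa using by positivity)
  filter_upwards [h1] with s hs t ht
  have h2 := (h.enorm_sub_proj_sq_le s ht).trans_lt hs
  rw [← ofReal_norm, ← ENNReal.ofReal_pow (norm_nonneg _),
    ENNReal.ofReal_lt_ofReal_iff (by positivity)] at h2
  rw [dist_eq_norm]
  exact lt_of_pow_lt_pow_left₀ 2 hε.le h2

lemma continuousOn (h : IsForcing T S I b η) : ContinuousOn η (Icc 0 T) := by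
  refine h.tendstoUniformlyOn_proj.continuousOn (Eventually.of_forall fun s => ?_).frequently
  unfold proj
  exact continuousOn_finsetSum _ fun k _ => (h.continuousOn_coeff k).smul continuousOn_const

lemma integral_h1Sq_proj_le (h : IsForcing T S I b η) (hT : 0 ≤ T) (s : Finset ℤ) :
    ∫ t in (0 : ℝ)..T, h1Sq (proj s (η t)) ≤ I := by
  have hc : ContinuousOn (fun t => h1Sq (proj s (η t))) (Icc 0 T) :=
    (continuous_h1Sq_proj s).comp_continuousOn h.continuousOn
  rw [intervalIntegral.integral_of_le hT, integral_eq_lintegral_of_nonneg_ae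
    (ae_of_all _ fun _ => h1Sq_nonneg _)
    ((hc.mono Ioc_subset_Icc_self).aestronglyMeasurable measurableSet_Ioc)]
  refine ENNReal.toReal_le_of_le_ofReal h.nonneg (le_trans ?_ h.lintegral_le)
  refine (lintegral_mono fun t => ?_).trans (lintegral_mono_set Ioc_subset_Icc_self)
  rw [ofReal_h1Sq (sobolevSq_one_proj_lt_top _ _)]
  exact sobolevSq_one_proj_le _ _

end IsForcing

/-- The bound for `∫ ‖psi ∘ w‖²` along the Galerkin approximations. -/
def forceBound (R μ T M S I : ℝ) : ℝ≥0∞ :=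
  ENNReal.ofReal (forceConst R μ T M * (1 + S ^ 4 + I ^ 2) ^ 3)

/-- The bound for `‖w‖` along the Galerkin approximations. -/
def stateBound (R μ T M S I : ℝ) : ℝ :=
  √(energyConst R μ T M * (1 + S ^ 4 + I ^ 2)) + S

/-- The bound for the squares of the Fourier coefficients of the Galerkin approximations. -/
def coeffBound (R μ T M S I : ℝ) (u₀ : L2T) (k : ℤ) : ℝ≥0∞ :=
  2 * ‖coeff u₀ k‖ₑ ^ 2 +
    2 * (ENNReal.ofReal (Real.exp (2 * T) * (1 + lam k)⁻¹) * forceBound R μ T M S I)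

lemma tsum_coeffBound_ne_top (R μ T M S I : ℝ) (u₀ : L2T) :
    ∑' k, coeffBound R μ T M S I u₀ k ≠ ∞ := by
  have h1 : ∑' k, ENNReal.ofReal (Real.exp (2 * T) * (1 + lam k)⁻¹) ≠ ∞ := by
    have hs : Summable fun k : ℤ => Real.exp (2 * T) * (1 + lam k)⁻¹ := by
      have := summable_one_add_lam_rpow (p := 1) (by norm_num)
      simp only [Real.rpow_neg_one] at this
      exact this.mul_left _
    rw [← ENNReal.ofReal_tsum_of_nonneg (fun k => ?_) hs]
    · exact ENNReal.ofReal_ne_top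
    · have := lam_nonneg k; positivity
  have h2 : ∑' k, ‖coeff u₀ k‖ₑ ^ 2 ≠ ∞ := by
    rw [← enorm_sq_eq_tsum]; finiteness
  have h3 : forceBound R μ T M S I ≠ ∞ := ENNReal.ofReal_ne_top
  simp only [coeffBound]
  rw [ENNReal.tsum_add, ENNReal.tsum_mul_left, ENNReal.tsum_mul_left, ENNReal.tsum_mul_right]
  finiteness

namespace IsGalerkin

variable {R ν μ T M S I : ℝ} {u₀ : L2T} {η : ℝ → L2T} {s s' s₀ : Finset ℤ} {a a' : ℝ → L2T}
  {b : ℤ → ℝ}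

lemma enorm_add_proj_le (ha : IsGalerkin R ν μ T u₀ η s a) (hη : IsForcing T S I b η)
    (hM : ‖u₀‖ ≤ M) {t : ℝ} (ht : t ∈ Icc 0 T) :
    ‖a t + proj s (η t)‖ₑ ≤ ENNReal.ofReal (stateBound R μ T M S I) := by
  rw [← ofReal_norm]
  refine ENNReal.ofReal_le_ofReal ((norm_add_le _ _).trans (add_le_add ?_ ?_))
  · exact Real.le_sqrt_of_sq_le (ha.norm_sq_le hη.continuousOn hM hη.norm_le
      (hη.integral_h1Sq_proj_le (ht.1.trans ht.2) s) ht)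
  · exact (norm_proj_le _ _).trans (hη.norm_le t ht)

lemma lintegral_enorm_psiL2_sq_le (ha : IsGalerkin R ν μ T u₀ η s a) (hη : IsForcing T S I b η)
    (hM : ‖u₀‖ ≤ M) (hT : 0 ≤ T) :
    ∫⁻ r in Ioc 0 T, ‖psiL2 R μ (a r + proj s (η r))‖ₑ ^ 2 ≤ forceBound R μ T M S I := by
  have h1 := ha.integral_norm_psiL2_sq_le hη.continuousOn hM hη.norm_le
    (hη.integral_h1Sq_proj_le hT s) hT
  have hc : ContinuousOn (fun r => ‖psiL2 R μ (a r + proj s (η r))‖ ^ 2) (Icc 0 T) :=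
    (ha.continuousOn_psiL2 hη.continuousOn).norm.pow 2
  rw [intervalIntegral.integral_of_le hT] at h1
  refine le_trans (le_of_eq ?_) (ENNReal.ofReal_le_ofReal h1)
  rw [ofReal_integral_eq_lintegral_ofReal (hc.integrableOn_Icc.mono_set Ioc_subset_Icc_self)
    (ae_of_all _ fun _ => sq_nonneg _)]
  refine lintegral_congr fun r => ?_
  rw [← ofReal_norm, ENNReal.ofReal_pow (norm_nonneg _)]

lemma aemeasurable_enorm_psiL2 (ha : IsGalerkin R ν μ T u₀ η s a) (hη : IsForcing T S I b η)
    {t : ℝ} (ht : t ∈ Icc 0 T) :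
    AEMeasurable (fun r => ‖psiL2 R μ (a r + proj s (η r))‖ₑ) (volume.restrict (Ioc 0 t)) :=
  (((ha.continuousOn_psiL2 hη.continuousOn).mono
    (Ioc_subset_Icc_self.trans (Icc_subset_Icc_right ht.2))).aestronglyMeasurable
    measurableSet_Ioc).enorm

lemma enorm_coeff_sq_le (ha : IsGalerkin R ν μ T u₀ η s a) (hη : IsForcing T S I b η)
    (hM : ‖u₀‖ ≤ M) {t : ℝ} (ht : t ∈ Icc 0 T) (k : ℤ) :
    ‖coeff (a t) k‖ₑ ^ 2 ≤ coeffBound R μ T M S I u₀ k := by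
  by_cases hk : k ∈ s
  · rw [ha.coeff_eq hη.continuousOn ht hk]
    refine (pow_le_pow_left' (enorm_add_le _ _) 2).trans ((ennreal_add_sq_le _ _).trans ?_)
    unfold coeffBound
    gcongr
    · rw [enorm_mul]
      refine mul_le_of_le_one_left zero_le ?_
      rw [← ofReal_norm]
      exact ENNReal.ofReal_le_one.2 (norm_exp_semigroup_le_one ht.1 k)
    · refine (pow_le_pow_left' (enorm_integral_exp_mul_le ht.1 _ k) 2).trans ?_
      have h1 : ∫⁻ r in Ioc 0 t, ENNReal.ofReal (Real.exp (-(lam k * (t - r)))) *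
          ‖coeff (psiL2 R μ (a r + proj s (η r))) k‖ₑ ≤
          ∫⁻ r in Ioc 0 t, ENNReal.ofReal (Real.exp (-(lam k * (t - r)))) *
          ‖psiL2 R μ (a r + proj s (η r))‖ₑ := by
        gcongr with r
        exact enorm_le_iff_norm_le.2 (norm_coeff_le _ _)
      refine (pow_le_pow_left' h1 2).trans
        ((lintegral_exp_lam_mul_sq_le ht k (ha.aemeasurable_enorm_psiL2 hη ht)).trans ?_)
      gcongr
      exact (lintegral_mono_set (Ioc_subset_Ioc_right ht.2)).trans
        (ha.lintegral_enorm_psiL2_sq_le hη hM (ht.1.trans ht.2))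
  · rw [ha.coeff_eq_zero ht k hk]
    simp

end IsGalerkin

/-- Two Galerkin approximations that contain the modes in `s₀` differ, uniformly on `[0, T]`, by
at most a multiple of the tail outside `s₀` of a fixed convergent series. -/
theorem exists_isGalerkin_sub_le {R ν μ T M S I : ℝ} {u₀ : L2T} {η : ℝ → L2T} {b : ℤ → ℝ}
    (hR : 0 ≤ R) (hT : 0 ≤ T) (hη : IsForcing T S I b η) (hM : ‖u₀‖ ≤ M) :
    ∃ (C : ℝ≥0∞) (β : ℤ → ℝ≥0∞), C ≠ ∞ ∧ ∑' k, β k ≠ ∞ ∧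
      ∀ (s₀ s s' : Finset ℤ) (a a' : ℝ → L2T), s₀ ⊆ s → s₀ ⊆ s' →
        IsGalerkin R ν μ T u₀ η s a → IsGalerkin R ν μ T u₀ η s' a' →
        ∀ t ∈ Icc 0 T, ‖a t - a' t‖ₑ ^ 2 ≤ C * tailSum β s₀ := by
  set B : ℝ≥0∞ := ENNReal.ofReal (stateBound R μ T M S I) with hB
  set Q : ℝ≥0∞ := forceBound R μ T M S I with hQ
  have hQtop : Q ≠ ∞ := ENNReal.ofReal_ne_top
  set G : ℝ≥0∞ := ENNReal.ofReal (psiLip R μ) ^ (3 / 2 : ℝ) *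
    (3 * ((1 + 2 * (ENNReal.ofReal R * B ^ 2)) * ENNReal.ofReal T +
      B * ((ENNReal.ofReal T + Q) + (ENNReal.ofReal T + Q)))) with hG
  have hGtop : G ≠ ∞ := by
    have h1 : ENNReal.ofReal (psiLip R μ) ^ (3 / 2 : ℝ) ≠ ∞ :=
      ENNReal.rpow_ne_top_of_nonneg (by norm_num) ENNReal.ofReal_ne_top
    have h2 : B ≠ ∞ := ENNReal.ofReal_ne_top
    rw [hG]
    finiteness
  obtain ⟨C, hCtop, hC⟩ := exists_gronwall_const (T := T) (A := 2) (by norm_num) hGtop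
  set βη : ℤ → ℝ≥0∞ := fun k => ENNReal.ofReal (b k ^ 2) with hβη
  set βu : ℤ → ℝ≥0∞ := fun k => 4 * coeffBound R μ T M S I u₀ k with hβu
  set β : ℤ → ℝ≥0∞ := fun k => 2 * βη k + 2 * βu k with hβ
  have hβsum : ∑' k, β k ≠ ∞ := by
    have h1 := hη.tsum_ne_top
    have h2 := tsum_coeffBound_ne_top R μ T M S I u₀
    simp only [hβ, hβη, hβu]
    rw [ENNReal.tsum_add, ENNReal.tsum_mul_left, ENNReal.tsum_mul_left, ENNReal.tsum_mul_left]
    finiteness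
  refine ⟨C, β, hCtop, hβsum, ?_⟩
  intro s₀ s s' a a' hs hs' ha ha'
  have htail : tailSum β s₀ = 2 * tailSum βη s₀ + 2 * tailSum βu s₀ := by
    simp only [tailSum]
    rw [← ENNReal.tsum_mul_left, ← ENNReal.tsum_mul_left, ← ENNReal.tsum_add]
    refine tsum_congr fun k => ?_
    split_ifs <;> simp [hβ]
  have hηtail : tailSum βη s₀ ≠ ∞ := by
    refine ne_top_of_le_ne_top hη.tsum_ne_top (ENNReal.tsum_le_tsum fun k => ?_)
    split_ifs
    · exact zero_le
    · exact le_rfl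
  -- `τ` bounds the difference of the projected forcing paths; it is added to `‖a - a'‖` so that the
  -- Gronwall inequality applies to a bound for the difference of the arguments of `psi`.
  set τ : ℝ≥0∞ := tailSum βη s₀ ^ (1 / 2 : ℝ) with hτ
  have hτtop : τ ≠ ∞ := ENNReal.rpow_ne_top_of_nonneg (by norm_num) hηtail
  have hτsq : τ ^ 2 = tailSum βη s₀ := by
    rw [hτ, ← ENNReal.rpow_natCast, ← ENNReal.rpow_mul]; norm_num
  have hτle : ∀ t ∈ Icc 0 T, ‖proj s (η t) - proj s' (η t)‖ₑ ≤ τ := fun t ht => by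
    rw [← ENNReal.pow_le_pow_left_iff two_ne_zero, hτsq]
    exact hη.enorm_proj_sub_sq_le hs hs' ht
  set p : ℝ → ℝ≥0∞ := fun r => ‖psiL2 R μ (a r + proj s (η r))‖ₑ with hp
  set p' : ℝ → ℝ≥0∞ := fun r => ‖psiL2 R μ (a' r + proj s' (η r))‖ₑ with hp'
  have hpm : AEMeasurable p (volume.restrict (Ioc 0 T)) :=
    ha.aemeasurable_enorm_psiL2 hη ⟨hT, le_rfl⟩
  have hpm' : AEMeasurable p' (volume.restrict (Ioc 0 T)) :=
    ha'.aemeasurable_enorm_psiL2 hη ⟨hT, le_rfl⟩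
  have hle1 : ∀ q : ℝ → ℝ≥0∞, ∫⁻ r in Ioc 0 T, q r ^ 2 ≤ Q →
      ∫⁻ r in Ioc 0 T, q r ≤ ENNReal.ofReal T + Q := by
    intro q hq
    calc _ ≤ ∫⁻ r in Ioc 0 T, (1 + q r ^ 2) := by
          refine lintegral_mono fun r => ?_
          rcases le_total (q r) 1 with h | h
          · exact h.trans le_self_add
          · calc q r = q r * 1 := (mul_one _).symm
              _ ≤ q r * q r := by gcongr
              _ = q r ^ 2 := (sq _).symm
              _ ≤ _ := le_add_self
      _ = ENNReal.ofReal T + ∫⁻ r in Ioc 0 T, q r ^ 2 := by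
          rw [lintegral_add_left measurable_const]
          simp
      _ ≤ _ := by gcongr
  set g : ℝ → ℝ≥0∞ := fun r => lipMajorant R μ B (p r) (p' r) with hg
  have hgG : ∫⁻ r in Ioc 0 T, g r ^ (3 / 2 : ℝ) ≤ G := by
    refine (lintegral_lipMajorant_le R μ ENNReal.ofReal_ne_top hpm).trans ?_
    rw [hG]
    gcongr
    · simp
    · exact hle1 p (ha.lintegral_enorm_psiL2_sq_le hη hM hT)
    · exact hle1 p' (ha'.lintegral_enorm_psiL2_sq_le hη hM hT)
  obtain ⟨Ba, hBa⟩ := isCompact_Icc.exists_bound_of_continuousOn ha.continuousOn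
  obtain ⟨Ba', hBa'⟩ := isCompact_Icc.exists_bound_of_continuousOn ha'.continuousOn
  have key := hC g (fun t => ‖a t - a' t‖ₑ + τ) (tailSum β s₀) (ENNReal.ofReal (Ba + Ba') + τ)
    (aemeasurable_lipMajorant R μ B hpm hpm') hgG (by finiteness)
    (fun t ht => by
      gcongr
      rw [← ofReal_norm]
      refine ENNReal.ofReal_le_ofReal ((norm_sub_le _ _).trans ?_)
      exact add_le_add (hBa t ht) (hBa' t ht))
    (fun t ht => by
      refine (ennreal_add_sq_le _ _).trans ?_
      rw [hτsq, htail, add_assoc, add_comm (2 * ‖a t - a' t‖ₑ ^ 2), ← mul_add 2 (tailSum βu s₀)]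
      gcongr
      rw [enorm_sq_eq_tsum, tailSum, ← ENNReal.tsum_add]
      refine ENNReal.tsum_le_tsum fun k => ?_
      by_cases hk : k ∈ s₀
      · rw [if_pos hk, zero_add]
        gcongr
        rw [coeff_sub, ha.coeff_eq hη.continuousOn ht (hs hk),
          ha'.coeff_eq hη.continuousOn ht (hs' hk), add_sub_add_left_eq_sub,
          ← intervalIntegral.integral_sub
            (intervalIntegrable_exp_mul_coeff ht
              ((ha.continuousOn_psiL2 hη.continuousOn).integrableOn_Icc.mono_set
                Ioc_subset_Icc_self) k)
            (intervalIntegrable_exp_mul_coeff ht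
              ((ha'.continuousOn_psiL2 hη.continuousOn).integrableOn_Icc.mono_set
                Ioc_subset_Icc_self) k)]
        simp_rw [← mul_sub]
        refine (enorm_integral_exp_mul_le ht.1 _ k).trans ?_
        refine setLIntegral_mono' measurableSet_Ioc fun r hr => ?_
        have hrT : r ∈ Icc 0 T := ⟨hr.1.le, hr.2.trans ht.2⟩
        gcongr
        have hm := psiMem_proj R μ s (a r + η r)
        rw [ha.proj_add_eq hrT] at hm
        have hm' := psiMem_proj R μ s' (a' r + η r)
        rw [ha'.proj_add_eq hrT] at hm'
        refine (enorm_coeff_psiL2_sub_le hR hm hm' k).trans ?_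
        gcongr
        · exact lipFactor_le_lipMajorant (ha.enorm_add_proj_le hη hM hrT)
            (ha'.enorm_add_proj_le hη hM hrT)
        · rw [add_sub_add_comm]
          exact (enorm_add_le _ _).trans (add_le_add le_rfl (hτle r hrT))
      · rw [if_neg hk]
        refine le_trans ?_ le_self_add
        rw [coeff_sub]
        calc ‖coeff (a t) k - coeff (a' t) k‖ₑ ^ 2
            ≤ (‖coeff (a t) k‖ₑ + ‖coeff (a' t) k‖ₑ) ^ 2 := by gcongr; exact enorm_sub_le
          _ ≤ 2 * ‖coeff (a t) k‖ₑ ^ 2 + 2 * ‖coeff (a' t) k‖ₑ ^ 2 := ennreal_add_sq_le _ _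
          _ ≤ 2 * coeffBound R μ T M S I u₀ k + 2 * coeffBound R μ T M S I u₀ k := by
              gcongr
              · exact ha.enorm_coeff_sq_le hη hM ht k
              · exact ha'.enorm_coeff_sq_le hη hM ht k
          _ = βu k := by simp only [hβu]; ring)
  intro t ht
  exact (pow_le_pow_left' le_self_add 2).trans (key t ht)

/-- The Galerkin approximations converge uniformly on `[0, T]`. -/
theorem exists_tendstoUniformlyOn_isGalerkin {R ν μ T M S I : ℝ} {u₀ : L2T} {η : ℝ → L2T}
    {b : ℤ → ℝ} (hR : 0 ≤ R) (hT : 0 ≤ T) (hη : IsForcing T S I b η) (hM : ‖u₀‖ ≤ M) :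
    ∃ (a : Finset ℤ → ℝ → L2T) (v : ℝ → L2T), (∀ s, IsGalerkin R ν μ T u₀ η s (a s)) ∧
      TendstoUniformlyOn a v atTop (Icc 0 T) := by
  choose a ha using exists_isGalerkin R ν μ hT u₀ hη.continuousOn
  obtain ⟨C, β, hC, hβ, hle⟩ := exists_isGalerkin_sub_le (ν := ν) (μ := μ) hR hT hη hM
  have hcauchy : UniformCauchySeqOn a atTop (Icc 0 T) := by
    rw [Metric.uniformCauchySeqOn_iff]
    intro ε hε
    have h1 := ENNReal.Tendsto.const_mul (tendsto_tailSum hβ) (Or.inr hC)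
    rw [mul_zero] at h1
    obtain ⟨s₀, hs₀⟩ := (h1.eventually_lt_const
      (show (0 : ℝ≥0∞) < ENNReal.ofReal (ε ^ 2) by simpa using by positivity)).exists
    refine ⟨s₀, fun s hs s' hs' t ht => ?_⟩
    have h2 := (hle s₀ s s' (a s) (a s') hs hs' (ha s) (ha s') t ht).trans_lt hs₀
    rw [← ofReal_norm, ← ENNReal.ofReal_pow (norm_nonneg _),
      ENNReal.ofReal_lt_ofReal_iff (by positivity)] at h2
    rw [dist_eq_norm]
    exact lt_of_pow_lt_pow_left₀ 2 hε.le h2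
  have hlim : ∀ t : ℝ, ∃ v : L2T, t ∈ Icc 0 T → Tendsto (fun s => a s t) atTop (𝓝 v) := by
    intro t
    by_cases ht : t ∈ Icc 0 T
    · obtain ⟨v, hv⟩ := cauchySeq_tendsto_of_complete (hcauchy.cauchySeq ht)
      exact ⟨v, fun _ => hv⟩
    · exact ⟨0, fun h => absurd h ht⟩
  choose v hv using hlim
  exact ⟨a, v, ha, hcauchy.tendstoUniformlyOn_of_tendsto fun t ht => hv t ht⟩

/-! ### Passage to the limit -/

lemma lowerSemicontinuous_sobolevSq (α : ℝ) : LowerSemicontinuous (sobolevSq α) := by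
  refine lowerSemicontinuous_tsum fun k => Continuous.lowerSemicontinuous ?_
  exact ENNReal.continuous_ofReal.comp
    (continuous_const.mul ((continuous_coeff k).norm.pow 2))

/-- Fatou's lemma for Sobolev norms along a filter. -/
lemma sobolevSq_le_liminf {ι : Type*} {l : Filter ι} {u : ι → L2T} {v : L2T} (α : ℝ)
    (h : Tendsto u l (𝓝 v)) : sobolevSq α v ≤ liminf (fun i => sobolevSq α (u i)) l :=
  (LowerSemicontinuousAt.le_liminf (lowerSemicontinuous_sobolevSq α v)).trans
    (liminf_le_liminf_of_le h)

lemma aemeasurable_sobolevSq {ι : Type*} [MeasurableSpace ι] {m : Measure ι} {u : ι → L2T}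
    (hu : AEStronglyMeasurable u m) (α : ℝ) : AEMeasurable (fun t => sobolevSq α (u t)) m := by
  refine AEMeasurable.tsum fun k => ?_
  have h := ((continuous_coeff k).comp_aestronglyMeasurable hu).norm.aemeasurable
  exact ((h.pow_const 2).const_mul _).ennreal_ofReal

lemma le_one_add_sq (x : ℝ) : x ≤ 1 + x ^ 2 := by nlinarith [sq_nonneg (x - 1)]

/-- The `H¹` bound for the solution. -/
def h1Bound (R μ T M S I : ℝ) (u₀ : L2T) : ℝ :=
  energyConst R μ T M * (1 + S ^ 4 + I ^ 2) + (h1Sq u₀ + forceConst R μ T M *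
    (1 + S ^ 4 + I ^ 2) ^ 3)

/-- The bound for the norm of the solution in `L²(0, T; H²)`. -/
def h2Bound (R μ T M S I : ℝ) (u₀ : L2T) : ℝ :=
  energyConst R μ T M * (1 + S ^ 4 + I ^ 2) * T + 2 * (energyConst R μ T M * (1 + S ^ 4 + I ^ 2)) +
    (h1Sq u₀ + forceConst R μ T M * (1 + S ^ 4 + I ^ 2) ^ 3)

lemma gradSq_le_h1Sq {u : L2T} (hu : sobolevSq 1 u < ∞) (s : Finset ℤ) : gradSq s u ≤ h1Sq u := by
  refine le_trans (Finset.sum_le_sum fun k _ => ?_)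
    (sum_le_hasSum s (fun k _ => ?_) (hasSum_h1Sq hu))
  · nlinarith [sq_nonneg ‖coeff u k‖]
  · have := lam_nonneg k; positivity

namespace IsGalerkin

variable {R ν μ T M S I : ℝ} {u₀ : L2T} {η : ℝ → L2T} {s : Finset ℤ} {a : ℝ → L2T} {b : ℤ → ℝ}

lemma h1Sq_le (ha : IsGalerkin R ν μ T u₀ η s a) (hη : IsForcing T S I b η) (hM : ‖u₀‖ ≤ M)
    (hu : sobolevSq 1 u₀ < ∞) {t : ℝ} (ht : t ∈ Icc 0 T) :
    h1Sq (a t) ≤ h1Bound R μ T M S I u₀ := by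
  have hT := ht.1.trans ht.2
  have h1 := ha.norm_sq_le hη.continuousOn hM hη.norm_le (hη.integral_h1Sq_proj_le hT s) ht
  have h2 := ha.gradSq_le hη.continuousOn hM hη.norm_le (hη.integral_h1Sq_proj_le hT s) ht
  have h3 := integral_nonneg_of_Icc ht fun r _ => laplSq_nonneg s (a r)
  have h4 := gradSq_le_h1Sq hu s
  rw [ha.h1Sq_eq ht, h1Bound]
  linarith

lemma lintegral_sobolevSq_two_le (ha : IsGalerkin R ν μ T u₀ η s a) (hη : IsForcing T S I b η)
    (hM : ‖u₀‖ ≤ M) (hu : sobolevSq 1 u₀ < ∞) (hT : 0 ≤ T) :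
    ∫⁻ t in Icc 0 T, sobolevSq 2 (a t) ≤ ENNReal.ofReal (h2Bound R μ T M S I u₀) := by
  have hTm : T ∈ Icc 0 T := ⟨hT, le_rfl⟩
  have hI := hη.integral_h1Sq_proj_le hT s
  obtain ⟨hcn, -, hcL⟩ := ha.continuousOn_majorant hη.continuousOn
  set K := energyConst R μ T M * (1 + S ^ 4 + I ^ 2) with hK
  have h1 : ∀ t ∈ Ioc 0 T, sobolevSq 2 (a t) ≤
      ENNReal.ofReal (K + 2 * gradSq s (a t) + 1 * laplSq s (a t) + 0 * laplSq s (a t)) := by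
    intro t ht
    have ht' := Ioc_subset_Icc_self ht
    rw [sobolevSq_two_eq_sum (ha.coeff_eq_zero ht')]
    refine ENNReal.ofReal_le_ofReal ?_
    have h2 := ha.norm_sq_le hη.continuousOn hM hη.norm_le hI ht'
    have h3 : ∑ k ∈ s, (1 + lam k) ^ 2 * ‖coeff (a t) k‖ ^ 2 =
        ‖a t‖ ^ 2 + 2 * gradSq s (a t) + laplSq s (a t) := by
      rw [norm_sq_eq_sum (ha.coeff_eq_zero ht'), gradSq, laplSq, Finset.mul_sum,
        ← Finset.sum_add_distrib, ← Finset.sum_add_distrib]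
      exact Finset.sum_congr rfl fun k _ => by ring
    rw [h3]
    linarith
  have hK0 : 0 ≤ K := (sq_nonneg ‖a T‖).trans
    (ha.norm_sq_le hη.continuousOn hM hη.norm_le hI hTm)
  have hc : ContinuousOn (fun t => K + 2 * gradSq s (a t) + 1 * laplSq s (a t) +
      0 * laplSq s (a t)) (Icc 0 T) := by fun_prop
  rw [setLIntegral_congr Ioc_ae_eq_Icc.symm]
  refine (setLIntegral_mono' measurableSet_Ioc h1).trans ?_
  rw [← ofReal_integral_eq_lintegral_ofReal (hc.integrableOn_Icc.mono_set Ioc_subset_Icc_self)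
    (ae_of_all _ fun t => by
      have := gradSq_nonneg s (a t)
      have := laplSq_nonneg s (a t)
      simp only [Pi.zero_apply]
      positivity), ← intervalIntegral.integral_of_le hT, integral_lincomb hTm hcn hcL hcL]
  refine ENNReal.ofReal_le_ofReal ?_
  have h4 := ha.integral_gradSq_le hη.continuousOn hM hη.norm_le hI hTm
  have h5 := ha.gradSq_le hη.continuousOn hM hη.norm_le hI hTm
  have h6 := gradSq_le_h1Sq hu s
  have h7 := gradSq_nonneg s (a T)
  rw [h2Bound, ← hK]
  linarith

end IsGalerkin

section Limit

variable {R ν μ T M S I : ℝ} {u₀ : L2T} {η : ℝ → L2T} {b : ℤ → ℝ} {a : Finset ℤ → ℝ → L2T}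
  {v : ℝ → L2T}

lemma sobolevSq_one_limit_le (ha : ∀ s, IsGalerkin R ν μ T u₀ η s (a s))
    (hv : TendstoUniformlyOn a v atTop (Icc 0 T)) (hη : IsForcing T S I b η) (hM : ‖u₀‖ ≤ M)
    (hu : sobolevSq 1 u₀ < ∞) {t : ℝ} (ht : t ∈ Icc 0 T) :
    sobolevSq 1 (v t) ≤ ENNReal.ofReal (h1Bound R μ T M S I u₀) := by
  refine (sobolevSq_le_liminf 1 (hv.tendsto_at ht)).trans ?_
  refine liminf_le_of_le (by isBoundedDefault) fun c hc => ?_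
  obtain ⟨s, hs⟩ := hc.exists
  refine hs.trans ?_
  rw [← ofReal_h1Sq (sobolevSq_one_lt_top ((ha s).coeff_eq_zero ht))]
  exact ENNReal.ofReal_le_ofReal ((ha s).h1Sq_le hη hM hu ht)

lemma lintegral_sobolevSq_two_limit_le (ha : ∀ s, IsGalerkin R ν μ T u₀ η s (a s))
    (hv : TendstoUniformlyOn a v atTop (Icc 0 T)) (hη : IsForcing T S I b η) (hM : ‖u₀‖ ≤ M)
    (hu : sobolevSq 1 u₀ < ∞) (hT : 0 ≤ T) :
    ∫⁻ t in Icc 0 T, sobolevSq 2 (v t) ≤ ENNReal.ofReal (h2Bound R μ T M S I u₀) := by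
  calc _ ≤ ∫⁻ t in Icc 0 T, liminf (fun s => sobolevSq 2 (a s t)) atTop :=
        setLIntegral_mono' measurableSet_Icc fun t ht => sobolevSq_le_liminf 2 (hv.tendsto_at ht)
    _ ≤ liminf (fun s => ∫⁻ t in Icc 0 T, sobolevSq 2 (a s t)) atTop := by
        refine lintegral_liminf_le' fun s => ?_
        exact aemeasurable_sobolevSq
          ((ha s).continuousOn.aestronglyMeasurable measurableSet_Icc) 2
    _ ≤ _ := by
        refine liminf_le_of_le (by isBoundedDefault) fun c hc => ?_
        obtain ⟨s, hs⟩ := hc.exists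
        exact hs.trans ((ha s).lintegral_sobolevSq_two_le hη hM hu hT)

/-- A bound for `‖psi ∘ w‖` at a time at which the forcing is in `H¹`. -/
def forceMajorant (R μ H S : ℝ) (z : L2T) : ℝ :=
  1 + psiGrowth R μ * (1 + 100 * (H ^ 2 * H) + 100 * (S ^ 4 * h1Sq z))

lemma norm_psiL2_le_forceMajorant {H : ℝ} {x y z : L2T} (hx : sobolevSq 1 x < ∞)
    (hxH : h1Sq x ≤ H) (hz : sobolevSq 1 z < ∞) (hy : sobolevSq 1 y ≤ sobolevSq 1 z)
    (hS : ‖y‖ ≤ S) : ‖psiL2 R μ (x + y)‖ ≤ forceMajorant R μ H S z := by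
  have hy' : sobolevSq 1 y < ∞ := hy.trans_lt hz
  have h1 : h1Sq y ≤ h1Sq z := ENNReal.toReal_mono hz.ne hy
  have hm : PsiMem R μ (x + y) := by
    refine psiMem_of_bounded
      (B := √(10 * (‖x‖ * √(h1Sq x))) + √(10 * (‖y‖ * √(h1Sq y)))) ?_
    filter_upwards [ae_norm_le hx, ae_norm_le hy', Lp.coeFn_add x y] with θ h1 h2 h3
    rw [h3]
    exact (norm_add_le _ _).trans (add_le_add h1 h2)
  have h2 := norm_psiL2_add_sq_le R μ hx hy' hm
  have h3 := norm_sq_le_h1Sq hx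
  have hP := psiGrowth_nonneg R μ
  have h4 : ‖x‖ ^ 4 ≤ H ^ 2 := by
    calc ‖x‖ ^ 4 = (‖x‖ ^ 2) ^ 2 := by ring
      _ ≤ H ^ 2 := by gcongr; exact h3.trans hxH
  have h5 := h1Sq_nonneg x
  have h6 := h1Sq_nonneg y
  refine (le_one_add_sq _).trans ?_
  unfold forceMajorant
  gcongr
  refine h2.trans ?_
  gcongr

lemma sobolevSq_one_add_lt_top {x y : L2T} (hx : sobolevSq 1 x < ∞) (hy : sobolevSq 1 y < ∞) :
    sobolevSq 1 (x + y) < ∞ := by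
  have hle : sobolevSq 1 (x + y) ≤ 2 * sobolevSq 1 x + 2 * sobolevSq 1 y := by
    rw [sobolevSq_one, sobolevSq_one, sobolevSq_one, ← ENNReal.tsum_mul_left,
      ← ENNReal.tsum_mul_left, ← ENNReal.tsum_add]
    refine ENNReal.tsum_le_tsum fun k => ?_
    have hk := lam_nonneg k
    have h1 : ‖coeff (x + y) k‖ ^ 2 ≤ 2 * ‖coeff x k‖ ^ 2 + 2 * ‖coeff y k‖ ^ 2 := by
      rw [coeff_add]
      calc _ ≤ (‖coeff x k‖ + ‖coeff y k‖) ^ 2 := by gcongr; exact norm_add_le _ _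
        _ ≤ _ := by nlinarith [sq_nonneg (‖coeff x k‖ - ‖coeff y k‖)]
    calc ENNReal.ofReal ((1 + lam k) * ‖coeff (x + y) k‖ ^ 2)
        ≤ ENNReal.ofReal (2 * ((1 + lam k) * ‖coeff x k‖ ^ 2) +
            2 * ((1 + lam k) * ‖coeff y k‖ ^ 2)) := by
          refine ENNReal.ofReal_le_ofReal ?_
          calc _ ≤ (1 + lam k) * (2 * ‖coeff x k‖ ^ 2 + 2 * ‖coeff y k‖ ^ 2) := by gcongr
            _ = _ := by ring
      _ = _ := by
          rw [ENNReal.ofReal_add (by positivity) (by positivity), ENNReal.ofReal_mul zero_le_two,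
            ENNReal.ofReal_mul (q := (1 + lam k) * ‖coeff y k‖ ^ 2) zero_le_two,
            ENNReal.ofReal_ofNat]
  exact hle.trans_lt (by finiteness)

/-- Along sequences that are bounded in `H¹`, convergence in `L²` implies the convergence of the
Fourier coefficients of the nonlinearity. -/
lemma tendsto_coeff_psiL2 {ι : Type*} {l : Filter ι} {w : ι → L2T} {w' : L2T} {B : ℝ}
    (hR : 0 ≤ R) (hw : ∀ i, PsiMem R μ (w i)) (hw' : PsiMem R μ w')
    (hB : ∀ i, ‖w i‖ ≤ B ∧ ‖psiL2 R μ (w i)‖ ≤ B) (hB' : ‖w'‖ ≤ B ∧ ‖psiL2 R μ w'‖ ≤ B)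
    (hlim : Tendsto w l (𝓝 w')) (k : ℤ) :
    Tendsto (fun i => coeff (psiL2 R μ (w i)) k) l (𝓝 (coeff (psiL2 R μ w') k)) := by
  set L := lipMajorant R μ (ENNReal.ofReal B) (ENNReal.ofReal B) (ENNReal.ofReal B) with hL
  have hLtop : L ≠ ∞ := by
    rw [hL, lipMajorant]
    refine ENNReal.mul_ne_top ENNReal.ofReal_ne_top
      (ENNReal.rpow_ne_top_of_nonneg (by norm_num) ?_)
    finiteness
  have hof : ∀ u : L2T, ‖u‖ ≤ B → ‖u‖ₑ ≤ ENNReal.ofReal B := fun u hu => by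
    rw [← ofReal_norm]; exact ENNReal.ofReal_le_ofReal hu
  rw [tendsto_iff_edist_tendsto_0] at hlim ⊢
  have h0 := ENNReal.Tendsto.const_mul hlim (Or.inr hLtop)
  rw [mul_zero] at h0
  refine tendsto_of_tendsto_of_tendsto_of_le_of_le tendsto_const_nhds h0 (fun _ => zero_le)
    fun i => ?_
  simp only [edist_eq_enorm_sub]
  refine (enorm_coeff_psiL2_sub_le hR (hw i) hw' k).trans ?_
  gcongr
  refine (lipFactor_le_lipMajorant (hof _ (hB i).1) (hof _ hB'.1)).trans ?_
  rw [hL]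
  unfold lipMajorant
  gcongr
  · exact hof _ (hB i).2
  · exact hof _ hB'.2

/-- The uniform limit of the Galerkin approximations is a mild solution. -/
theorem isMildSolution_limit (hR : 0 ≤ R) (hT : 0 ≤ T)
    (ha : ∀ s, IsGalerkin R ν μ T u₀ η s (a s))
    (hv : TendstoUniformlyOn a v atTop (Icc 0 T)) (hη : IsForcing T S I b η) (hM : ‖u₀‖ ≤ M)
    (hu : sobolevSq 1 u₀ < ∞) : IsMildSolution R ν μ T u₀ η v := by
  set H := h1Bound R μ T M S I u₀ with hH
  have hvc : ContinuousOn v (Icc 0 T) :=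
    hv.continuousOn (Eventually.of_forall fun s => (ha s).continuousOn).frequently
  have hvH : ∀ t ∈ Icc 0 T, sobolevSq 1 (v t) ≤ ENNReal.ofReal H := fun t ht =>
    sobolevSq_one_limit_le ha hv hη hM hu ht
  have hvfin : ∀ t ∈ Icc 0 T, sobolevSq 1 (v t) < ∞ := fun t ht =>
    (hvH t ht).trans_lt ENNReal.ofReal_lt_top
  have hH0 : 0 ≤ H := by
    have ht : (0 : ℝ) ∈ Icc 0 T := ⟨le_rfl, hT⟩
    exact (h1Sq_nonneg _).trans ((ha ∅).h1Sq_le hη hM hu ht)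
  have hvH' : ∀ t ∈ Icc 0 T, h1Sq (v t) ≤ H := fun t ht =>
    ENNReal.toReal_le_of_le_ofReal hH0 (hvH t ht)
  have hηm : AEMeasurable (fun t => sobolevSq 1 (η t)) (volume.restrict (Icc 0 T)) :=
    aemeasurable_sobolevSq (hη.continuousOn.aestronglyMeasurable measurableSet_Icc) 1
  have hηint : ∫⁻ t in Icc 0 T, sobolevSq 1 (η t) ≠ ∞ :=
    ne_top_of_le_ne_top ENNReal.ofReal_ne_top hη.lintegral_le
  have hηfin : ∀ᵐ t ∂(volume.restrict (Icc 0 T)), sobolevSq 1 (η t) < ∞ :=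
    ae_lt_top' hηm hηint
  have hηint' : IntegrableOn (fun t => forceMajorant R μ H S (η t)) (Icc 0 T) := by
    have h1 : IntegrableOn (fun t => h1Sq (η t)) (Icc 0 T) :=
      integrable_toReal_of_lintegral_ne_top hηm hηint
    have h2 : ∀ c : ℝ, IntegrableOn (fun _ : ℝ => c) (Icc 0 T) := fun c => by
      simp
    unfold forceMajorant
    exact (h2 1).add (((h2 _).add ((h1.const_mul _).const_mul _)).const_mul _)
  have hle : volume.restrict (Ioc (0 : ℝ) T) ≤ volume.restrict (Icc 0 T) :=
    Measure.restrict_mono Ioc_subset_Icc_self le_rfl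
  -- bounds at a time `t` at which `η t` is in `H¹`
  have hwn : ∀ s, ∀ t ∈ Icc 0 T, sobolevSq 1 (η t) < ∞ →
      ‖psiL2 R μ (a s t + proj s (η t))‖ ≤ forceMajorant R μ H S (η t) := fun s t ht hfin =>
    norm_psiL2_le_forceMajorant (sobolevSq_one_lt_top ((ha s).coeff_eq_zero ht))
      ((ha s).h1Sq_le hη hM hu ht) hfin (sobolevSq_one_proj_le _ _)
      ((norm_proj_le _ _).trans (hη.norm_le t ht))
  have hw : ∀ t ∈ Icc 0 T, sobolevSq 1 (η t) < ∞ →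
      ‖psiL2 R μ (v t + η t)‖ ≤ forceMajorant R μ H S (η t) := fun t ht hfin =>
    norm_psiL2_le_forceMajorant (hvfin t ht) (hvH' t ht) hfin le_rfl (hη.norm_le t ht)
  have hmem : ∀ t ∈ Icc 0 T, sobolevSq 1 (η t) < ∞ → PsiMem R μ (v t + η t) := fun t ht hfin =>
    psiMem_of_sobolev (sobolevSq_one_add_lt_top (hvfin t ht) hfin)
  have hmemn : ∀ s, ∀ t ∈ Icc 0 T, PsiMem R μ (a s t + proj s (η t)) := fun s t ht => by
    rw [← (ha s).proj_add_eq ht]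
    exact psiMem_proj _ _ _ _
  -- convergence of the coefficients of the nonlinearity
  have hlim : ∀ t ∈ Icc 0 T, sobolevSq 1 (η t) < ∞ → ∀ k,
      Tendsto (fun s => coeff (psiL2 R μ (a s t + proj s (η t))) k) atTop
        (𝓝 (coeff (psiL2 R μ (v t + η t)) k)) := by
    intro t ht hfin k
    have hsq : ∀ u : L2T, sobolevSq 1 u < ∞ → h1Sq u ≤ H → ‖u‖ ≤ 1 + H := fun u hu1 hu2 => by
      have h1 := norm_sq_le_h1Sq hu1
      have h2 := le_one_add_sq ‖u‖
      linarith
    set B : ℝ := max (1 + H + S) (forceMajorant R μ H S (η t)) with hB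
    refine tendsto_coeff_psiL2 (B := B) hR (fun s => hmemn s t ht) (hmem t ht hfin)
      (fun s => ⟨?_, ?_⟩) ⟨?_, ?_⟩ ?_ k
    · refine le_trans ?_ (le_max_left _ _)
      refine (norm_add_le _ _).trans (add_le_add ?_ ((norm_proj_le _ _).trans (hη.norm_le t ht)))
      exact hsq _ (sobolevSq_one_lt_top ((ha s).coeff_eq_zero ht)) ((ha s).h1Sq_le hη hM hu ht)
    · exact (hwn s t ht hfin).trans (le_max_right _ _)
    · refine le_trans ?_ (le_max_left _ _)
      refine (norm_add_le _ _).trans (add_le_add ?_ (hη.norm_le t ht))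
      exact hsq _ (hvfin t ht) (hvH' t ht)
    · exact (hw t ht hfin).trans (le_max_right _ _)
    · exact (hv.tendsto_at ht).add (hη.tendstoUniformlyOn_proj.tendsto_at ht)
  have hgood : ∀ᵐ t ∂(volume.restrict (Ioc 0 T)), t ∈ Icc 0 T ∧ sobolevSq 1 (η t) < ∞ := by
    filter_upwards [ae_mono hle hηfin, ae_restrict_mem measurableSet_Ioc] with t h1 h2
    exact ⟨Ioc_subset_Icc_self h2, h1⟩
  have hFm : AEStronglyMeasurable (fun t => psiL2 R μ (v t + η t)) (volume.restrict (Ioc 0 T)) := by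
    refine aestronglyMeasurable_of_coeff fun k => ?_
    refine aestronglyMeasurable_of_tendsto_ae (u := (atTop : Filter (Finset ℤ)))
      (f := fun s t => coeff (psiL2 R μ (a s t + proj s (η t))) k) (fun s => ?_) ?_
    · exact ((continuous_coeff k).comp_continuousOn
        (((ha s).continuousOn_psiL2 hη.continuousOn).mono
          Ioc_subset_Icc_self)).aestronglyMeasurable measurableSet_Ioc
    · filter_upwards [hgood] with t ht
      exact hlim t ht.1 ht.2 k
  have hFint : IntegrableOn (fun t => psiL2 R μ (v t + η t)) (Ioc 0 T) := by
    refine Integrable.mono' (hηint'.mono_set Ioc_subset_Icc_self) hFm ?_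
    filter_upwards [hgood] with t ht
    exact hw t ht.1 ht.2
  refine ⟨hvc, ?_, hFint, fun t ht => coeff_ext fun k => ?_⟩
  · filter_upwards [hgood] with t ht
    exact hmem t ht.1 ht.2
  rw [coeff_add, coeff_semigroup ht.1, coeff_duhamel ht hFint]
  have h1 : Tendsto (fun s => coeff (a s t) k) atTop (𝓝 (coeff (v t) k)) :=
    ((continuous_coeff k).tendsto _).comp (hv.tendsto_at ht)
  have hsub : Ioc 0 t ⊆ Ioc 0 T := Ioc_subset_Ioc_right ht.2
  have hgood' : ∀ᵐ r ∂volume, r ∈ Ioc 0 t → r ∈ Icc 0 T ∧ sobolevSq 1 (η r) < ∞ := by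
    have h := ae_mono (Measure.restrict_mono hsub le_rfl) hgood
    exact (ae_restrict_iff' measurableSet_Ioc).1 h
  have h2 : Tendsto (fun s => ∫ r in (0 : ℝ)..t, Complex.exp (-((1 + ν * Complex.I) * lam k *
      ((t - r : ℝ) : ℂ))) * coeff (psiL2 R μ (a s r + proj s (η r))) k) atTop
      (𝓝 (∫ r in (0 : ℝ)..t, Complex.exp (-((1 + ν * Complex.I) * lam k * ((t - r : ℝ) : ℂ))) *
        coeff (psiL2 R μ (v r + η r)) k)) := by
    refine intervalIntegral.tendsto_integral_filter_of_dominated_convergence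
      (fun r => forceMajorant R μ H S (η r)) (Eventually.of_forall fun s => ?_)
      (Eventually.of_forall fun s => ?_) ?_ ?_
    · rw [uIoc_of_le ht.1]
      refine ContinuousOn.aestronglyMeasurable ?_ measurableSet_Ioc
      refine ContinuousOn.mul (by fun_prop) ?_
      exact (continuous_coeff k).comp_continuousOn
        (((ha s).continuousOn_psiL2 hη.continuousOn).mono
          (hsub.trans Ioc_subset_Icc_self))
    · rw [uIoc_of_le ht.1]
      filter_upwards [hgood'] with r hr hrt
      rw [norm_mul]
      refine (mul_le_of_le_one_left (norm_nonneg _)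
        (norm_exp_semigroup_le_one (by linarith [hrt.2]) k)).trans ?_
      exact (norm_coeff_le _ _).trans (hwn s r (hr hrt).1 (hr hrt).2)
    · rw [intervalIntegrable_iff_integrableOn_Ioc_of_le ht.1]
      exact hηint'.mono_set (hsub.trans Ioc_subset_Icc_self)
    · rw [uIoc_of_le ht.1]
      filter_upwards [hgood'] with r hr hrt
      exact (hlim r (hr hrt).1 (hr hrt).2 k).const_mul _
  refine tendsto_nhds_unique h1 ((h2.const_add _).congr' ?_)
  filter_upwards [eventually_ge_atTop {k}] with s hs
  exact ((ha s).coeff_eq hη.continuousOn ht (hs (Finset.mem_singleton_self k))).symm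

end Limit

/-! ### Well-posedness for a given forcing path -/

lemma one_add_add_pow_three_le {x y : ℝ} (hx : 0 ≤ x) (hy : 0 ≤ y) :
    (1 + x + y) ^ 3 ≤ 9 * (1 + x ^ 3 + y ^ 3) := by
  nlinarith [mul_nonneg hx hy, mul_nonneg (add_nonneg hx hy) (sq_nonneg (x - y)),
    mul_nonneg (add_nonneg hx zero_le_one) (sq_nonneg (x - 1)),
    mul_nonneg (add_nonneg hy zero_le_one) (sq_nonneg (y - 1)),
    mul_nonneg hx (sq_nonneg (y - 1)), mul_nonneg hy (sq_nonneg (x - 1)), sq_nonneg (x - y)]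

/-- The constant in the a priori bound. -/
def aprioriConst (R μ T M : ℝ) : ℝ :=
  2 + 9 * (energyConst R μ T M * (3 + T) + 2 * forceConst R μ T M)

lemma aprioriConst_pos {R μ T M : ℝ} (hT : 0 ≤ T) : 0 < aprioriConst R μ T M := by
  have h1 := energyConst_nonneg (R := R) (μ := μ) (M := M) hT
  have h2 := forceConst_nonneg (R := R) (μ := μ) (M := M) hT
  unfold aprioriConst
  positivity

lemma h1Bound_nonneg {R μ T M S I : ℝ} {u₀ : L2T} (hT : 0 ≤ T) :
    0 ≤ h1Bound R μ T M S I u₀ := by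
  have h1 := energyConst_nonneg (R := R) (μ := μ) (M := M) hT
  have h2 := forceConst_nonneg (R := R) (μ := μ) (M := M) hT
  have h3 := h1Sq_nonneg u₀
  unfold h1Bound
  positivity

lemma h2Bound_nonneg {R μ T M S I : ℝ} {u₀ : L2T} (hT : 0 ≤ T) :
    0 ≤ h2Bound R μ T M S I u₀ := by
  have h1 := energyConst_nonneg (R := R) (μ := μ) (M := M) hT
  have h2 := forceConst_nonneg (R := R) (μ := μ) (M := M) hT
  have h3 := h1Sq_nonneg u₀
  unfold h2Bound
  positivity

lemma h1Bound_add_h2Bound_le {R μ T M S I : ℝ} {u₀ : L2T} (hT : 0 ≤ T) :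
    h1Bound R μ T M S I u₀ + h2Bound R μ T M S I u₀ ≤
      aprioriConst R μ T M * (1 + h1Sq u₀ + S ^ 12 + I ^ 6) := by
  have h1 := energyConst_nonneg (R := R) (μ := μ) (M := M) hT
  have h2 := forceConst_nonneg (R := R) (μ := μ) (M := M) hT
  have h3 := h1Sq_nonneg u₀
  have hS : 0 ≤ S ^ 4 := by positivity
  have hI : 0 ≤ I ^ 2 := by positivity
  set θ := 1 + S ^ 4 + I ^ 2 with hθ
  set Q := 1 + S ^ 12 + I ^ 6 with hQ
  have hQ0 : 0 ≤ Q := by positivity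
  have hθ3 : θ ^ 3 ≤ 9 * Q :=
    (one_add_add_pow_three_le hS hI).trans_eq (by rw [hQ]; ring)
  have hθ1 : θ ≤ θ ^ 3 := le_self_pow₀ (by linarith) (by norm_num)
  set K := energyConst R μ T M with hK
  set F := forceConst R μ T M with hF
  calc h1Bound R μ T M S I u₀ + h2Bound R μ T M S I u₀
      = K * (3 + T) * θ + 2 * F * θ ^ 3 + 2 * h1Sq u₀ := by
        rw [h1Bound, h2Bound, ← hθ]; ring
    _ ≤ K * (3 + T) * (9 * Q) + 2 * F * (9 * Q) + 2 * h1Sq u₀ := by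
        gcongr
        exact hθ1.trans hθ3
    _ = 9 * (K * (3 + T) + 2 * F) * Q + 2 * h1Sq u₀ := by ring
    _ ≤ (2 + 9 * (K * (3 + T) + 2 * F)) * Q +
        (2 + 9 * (K * (3 + T) + 2 * F)) * h1Sq u₀ := by
        have h4 : 0 ≤ 9 * (K * (3 + T) + 2 * F) := by positivity
        gcongr
        · linarith
        · linarith
    _ = _ := by rw [aprioriConst, hQ]; ring

/-- Existence, uniqueness and the a priori bound for a forcing path whose Fourier coefficients are
continuous in time and square summable uniformly in time, and which is in `L²(0, T; H¹)`. -/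
theorem exists_isMildSolution {R ν μ T M : ℝ} (hR : 0 ≤ R) (hT : 0 ≤ T) {u₀ : L2T}
    (hu : sobolevSq 1 u₀ < ∞) (hM : ‖u₀‖ ≤ M) {η : ℝ → L2T} {b : ℤ → ℝ}
    (hc : ∀ k, ContinuousOn (fun t => coeff (η t) k) (Icc 0 T))
    (hb : Summable fun k => b k ^ 2) (hηb : ∀ t ∈ Icc 0 T, ∀ k, ‖coeff (η t) k‖ ≤ b k)
    (hS : (⨆ t ∈ Icc 0 T, ‖η t‖ₑ) < ∞) (hI : (∫⁻ t in Icc 0 T, sobolevSq 1 (η t)) < ∞) :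
    ∃ v : ℝ → L2T, IsMildSolution R ν μ T u₀ η v ∧
      (⨆ t ∈ Icc 0 T, sobolevSq 1 (v t)) + (∫⁻ t in Icc 0 T, sobolevSq 2 (v t)) ≤
        ENNReal.ofReal (aprioriConst R μ T M) *
          (1 + sobolevSq 1 u₀ + (⨆ t ∈ Icc 0 T, ‖η t‖ₑ) ^ 12 +
            (∫⁻ t in Icc 0 T, sobolevSq 1 (η t)) ^ 6) ∧
      ∀ v' : ℝ → L2T, IsMildSolution R ν μ T u₀ η v' → EqOn v' v (Icc 0 T) := by
  set S := ⨆ t ∈ Icc 0 T, ‖η t‖ₑ with hSdef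
  set I := ∫⁻ t in Icc 0 T, sobolevSq 1 (η t) with hIdef
  have hnorm : ∀ t ∈ Icc 0 T, ‖η t‖ ≤ S.toReal := fun t ht => by
    rw [← toReal_enorm]
    exact ENNReal.toReal_mono hS.ne (le_iSup₂ (f := fun t (_ : t ∈ Icc 0 T) => ‖η t‖ₑ) t ht)
  have hη : IsForcing T S.toReal I.toReal b η :=
    ⟨hc, hb, hηb, hnorm, ENNReal.toReal_nonneg, (ENNReal.ofReal_toReal hI.ne).ge⟩
  obtain ⟨a, v, ha, hv⟩ := exists_tendstoUniformlyOn_isGalerkin (ν := ν) (μ := μ) hR hT hη hM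
  have hvm := isMildSolution_limit hR hT ha hv hη hM hu
  refine ⟨v, hvm, ?_, fun v' hv' => hvm.eqOn hR ⟨_, hnorm⟩ hv'⟩
  calc (⨆ t ∈ Icc 0 T, sobolevSq 1 (v t)) + (∫⁻ t in Icc 0 T, sobolevSq 2 (v t))
      ≤ ENNReal.ofReal (h1Bound R μ T M S.toReal I.toReal u₀) +
          ENNReal.ofReal (h2Bound R μ T M S.toReal I.toReal u₀) :=
        add_le_add (iSup₂_le fun t ht => sobolevSq_one_limit_le ha hv hη hM hu ht)
          (lintegral_sobolevSq_two_limit_le ha hv hη hM hu hT)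
    _ ≤ ENNReal.ofReal (aprioriConst R μ T M *
          (1 + h1Sq u₀ + S.toReal ^ 12 + I.toReal ^ 6)) := by
        rw [← ENNReal.ofReal_add (h1Bound_nonneg hT) (h2Bound_nonneg hT)]
        exact ENNReal.ofReal_le_ofReal (h1Bound_add_h2Bound_le hT)
    _ = _ := by
        have h0 := h1Sq_nonneg u₀
        rw [ENNReal.ofReal_mul (aprioriConst_pos hT).le, ENNReal.ofReal_add (by positivity)
          (by positivity), ENNReal.ofReal_add (by positivity) (by positivity),
          ENNReal.ofReal_add zero_le_one h0, ENNReal.ofReal_one, ofReal_h1Sq hu,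
          ENNReal.ofReal_pow ENNReal.toReal_nonneg, ENNReal.ofReal_pow ENNReal.toReal_nonneg,
          ENNReal.ofReal_toReal hS.ne, ENNReal.ofReal_toReal hI.ne]

/-! ### Moment bounds for Brownian motion -/

/-- The running maximum `max (0, x 0, …, x n)` of a sequence. -/
def runMax (x : ℕ → ℝ) : ℕ → ℝ
  | 0 => max 0 (x 0)
  | n + 1 => max (runMax x n) (x (n + 1))

lemma runMax_nonneg (x : ℕ → ℝ) (n : ℕ) : 0 ≤ runMax x n := by
  induction n with
  | zero => exact le_max_left _ _
  | succ n ih => exact ih.trans (le_max_left _ _)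

lemma le_runMax (x : ℕ → ℝ) {j n : ℕ} (h : j ≤ n) : x j ≤ runMax x n := by
  induction n with
  | zero => obtain rfl : j = 0 := by omega
            exact le_max_right _ _
  | succ n ih =>
    rcases Nat.lt_or_ge j (n + 1) with h1 | h1
    · exact (ih (by omega)).trans (le_max_left _ _)
    · obtain rfl : j = n + 1 := by omega
      exact le_max_right _ _

lemma runMax_congr {x y : ℕ → ℝ} {n : ℕ} (h : ∀ j ≤ n, x j = y j) : runMax x n = runMax y n := by
  induction n with
  | zero => simp [runMax, h 0 le_rfl]
  | succ n ih => rw [runMax, runMax, ih fun j hj => h j (by omega), h _ le_rfl]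

lemma runMax_le_sum_abs (x : ℕ → ℝ) (n : ℕ) : runMax x n ≤ ∑ j ∈ Finset.range (n + 1), |x j| := by
  induction n with
  | zero => simp [runMax, le_abs_self]
  | succ n ih =>
    rw [Finset.sum_range_succ, runMax]
    refine max_le (ih.trans (le_add_of_nonneg_right (abs_nonneg _))) ?_
    exact (le_abs_self _).trans (le_add_of_nonneg_left (Finset.sum_nonneg fun _ _ => abs_nonneg _))

lemma measurable_runMax {ι : Type*} [MeasurableSpace ι] {X : ℕ → ι → ℝ}
    (hX : ∀ j, Measurable (X j)) (n : ℕ) : Measurable fun ω => runMax (fun j => X j ω) n := by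
  induction n with
  | zero => exact measurable_const.max (hX 0)
  | succ n ih => exact ih.max (hX (n + 1))

lemma aemeasurable_runMax {ι : Type*} [MeasurableSpace ι] {m : Measure ι} {X : ℕ → ι → ℝ}
    (hX : ∀ j, AEMeasurable (X j) m) (n : ℕ) : AEMeasurable (fun ω => runMax (X · ω) n) m :=
  (measurable_runMax (X := fun j (g : ℕ → ℝ) => g j)
    (fun j => measurable_pi_apply j) n).comp_aemeasurable (aemeasurable_pi_lambda _ hX)

/-- The pathwise form of Doob's `L²` maximal inequality: the sum on the left is a martingale
transform, which has mean zero when `x` is a martingale. -/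
lemma runMax_sq_le (x : ℕ → ℝ) (n : ℕ) :
    runMax x n ^ 2 + 4 * ∑ j ∈ Finset.range n, runMax x j * (x (j + 1) - x j) ≤ 4 * x n ^ 2 := by
  have key : ∑ j ∈ Finset.range n, runMax x j * (x (j + 1) - x j) + runMax x n ^ 2 / 2 ≤
      runMax x n * x n := by
    induction n with
    | zero =>
      simp only [Finset.range_zero, Finset.sum_empty, runMax]
      rcases max_cases 0 (x 0) with ⟨h, h'⟩ | ⟨h, h'⟩ <;> rw [h] <;> nlinarith
    | succ n ih =>
      rw [Finset.sum_range_succ, runMax]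
      rcases max_cases (runMax x n) (x (n + 1)) with ⟨h, h'⟩ | ⟨h, h'⟩ <;> rw [h]
      · nlinarith
      · nlinarith [sq_nonneg (x (n + 1) - runMax x n)]
  nlinarith [sq_nonneg (runMax x n - 2 * x n)]

section Brownian

variable {Ω : Type*} [MeasurableSpace Ω] {P : Measure Ω} {β : ℝ≥0 → Ω → ℝ}

lemma memLp_two_brownian (hβ : IsPreBrownianReal β P) (t : ℝ≥0) : MemLp (β t) 2 P :=
  (hβ.isGaussianProcess.hasGaussianLaw_eval t).memLp_two

lemma integral_brownian_sq [IsProbabilityMeasure P] (hβ : IsPreBrownianReal β P) (t : ℝ≥0) :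
    ∫ ω, β t ω ^ 2 ∂P = t := by
  have h := hβ.covariance_eval t t
  rw [covariance_self (hβ.aemeasurable t), variance_eq_sub (memLp_two_brownian hβ t),
    hβ.integral_eval] at h
  simpa using h

/-- The increments of the running maximum transform have mean zero. -/
lemma integral_runMax_mul_sub [IsProbabilityMeasure P] (hβ : IsPreBrownianReal β P) {t : ℕ → ℝ≥0}
    (ht : Monotone t) (j : ℕ) :
    Integrable (fun ω => runMax (fun i => β (t i) ω) j * (β (t (j + 1)) ω - β (t j) ω)) P ∧
    ∫ ω, runMax (fun i => β (t i) ω) j * (β (t (j + 1)) ω - β (t j) ω) ∂P = 0 := by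
  set F : (Set.Iic (t j) → ℝ) → ℝ := fun g =>
    runMax (fun i => if h : t i ≤ t j then g ⟨t i, h⟩ else 0) j with hF
  set G : (ℝ≥0 → ℝ) → ℝ := fun g => g (t (j + 1) - t j) with hG
  have hFm : Measurable F := by
    refine measurable_runMax (X := fun i (g : Set.Iic (t j) → ℝ) =>
      if h : t i ≤ t j then g ⟨t i, h⟩ else 0) (fun i => ?_) j
    by_cases h : t i ≤ t j
    · simpa [h] using measurable_pi_apply _
    · simp [h]
  have hGm : Measurable G := measurable_pi_apply _
  have hind := (hβ.indepFun_shift (t j)).symm.comp hFm hGm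
  have e1 : F ∘ (fun ω (s : Set.Iic (t j)) => β s ω) = fun ω => runMax (fun i => β (t i) ω) j := by
    funext ω
    refine runMax_congr fun i hi => ?_
    simp [ht hi]
  have e2 : G ∘ (fun ω s => β (t j + s) ω - β (t j) ω) =
      fun ω => β (t (j + 1)) ω - β (t j) ω := by
    funext ω
    simp [hG, add_tsub_cancel_of_le (ht (Nat.le_succ j))]
  rw [e1, e2] at hind
  have hm : AEStronglyMeasurable (fun ω => runMax (fun i => β (t i) ω) j) P :=
    (aemeasurable_runMax (fun i => hβ.aemeasurable (t i)) j).aestronglyMeasurable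
  have hi1 : Integrable (fun ω => runMax (fun i => β (t i) ω) j) P := by
    refine Integrable.mono' (integrable_finsetSum (Finset.range (j + 1))
      fun i _ => (hβ.integrable_eval (t i)).abs) hm (ae_of_all _ fun ω => ?_)
    rw [Real.norm_of_nonneg (runMax_nonneg _ _)]
    exact runMax_le_sum_abs _ _
  have hi2 : Integrable (fun ω => β (t (j + 1)) ω - β (t j) ω) P :=
    (hβ.integrable_eval _).sub (hβ.integrable_eval _)
  refine ⟨hind.integrable_mul hi1 hi2, ?_⟩
  have h := hind.integral_mul_eq_mul_integral hi1.aestronglyMeasurable hi2.aestronglyMeasurable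
  simp only [Pi.mul_def] at h
  rw [h, integral_sub (hβ.integrable_eval _) (hβ.integrable_eval _), hβ.integral_eval,
    hβ.integral_eval, sub_zero, mul_zero]

/-- **Doob's `L²` inequality** for a Brownian motion along a finite grid, one-sided. -/
lemma lintegral_runMax_sq_le [IsProbabilityMeasure P] (hβ : IsPreBrownianReal β P) {t : ℕ → ℝ≥0}
    (ht : Monotone t) (n : ℕ) :
    ∫⁻ ω, ENNReal.ofReal (runMax (fun i => β (t i) ω) n ^ 2) ∂P ≤ ENNReal.ofReal (4 * t n) := by
  have hsq : Integrable (fun ω => β (t n) ω ^ 2) P := (memLp_two_brownian hβ (t n)).integrable_sq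
  have hsum := integrable_finsetSum (Finset.range n)
    fun j _ => (integral_runMax_mul_sub hβ ht j).1
  calc _ ≤ ∫⁻ ω, ENNReal.ofReal (4 * β (t n) ω ^ 2 - 4 * ∑ j ∈ Finset.range n,
        runMax (fun i => β (t i) ω) j * (β (t (j + 1)) ω - β (t j) ω)) ∂P := by
        refine lintegral_mono fun ω => ENNReal.ofReal_le_ofReal ?_
        linarith [runMax_sq_le (fun i => β (t i) ω) n]
    _ = ENNReal.ofReal (∫ ω, (4 * β (t n) ω ^ 2 - 4 * ∑ j ∈ Finset.range n,
        runMax (fun i => β (t i) ω) j * (β (t (j + 1)) ω - β (t j) ω)) ∂P) := by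
        rw [ofReal_integral_eq_lintegral_ofReal]
        · exact (hsq.const_mul 4).sub (hsum.const_mul 4)
        · refine ae_of_all _ fun ω => ?_
          have h1 := runMax_sq_le (fun i => β (t i) ω) n
          have h2 := sq_nonneg (runMax (fun i => β (t i) ω) n)
          simp only [Pi.zero_apply]
          linarith
    _ = _ := by
        rw [integral_sub (hsq.const_mul 4) (hsum.const_mul 4), integral_const_mul,
          integral_const_mul, integral_brownian_sq hβ,
          integral_finsetSum _ fun j _ => (integral_runMax_mul_sub hβ ht j).1,
          Finset.sum_eq_zero fun j _ => (integral_runMax_mul_sub hβ ht j).2]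
        simp

/-- **Doob's `L²` inequality** for a Brownian motion along a finite grid. -/
lemma lintegral_iSup_brownian_sq_le [IsProbabilityMeasure P] (hβ : IsPreBrownianReal β P)
    {t : ℕ → ℝ≥0} (ht : Monotone t) (n : ℕ) :
    ∫⁻ ω, ⨆ j ∈ Finset.range (n + 1), ENNReal.ofReal (β (t j) ω ^ 2) ∂P ≤
      ENNReal.ofReal (8 * t n) := by
  have hm : AEMeasurable (fun ω => ENNReal.ofReal (runMax (fun i => β (t i) ω) n ^ 2)) P :=
    ((aemeasurable_runMax (fun i => hβ.aemeasurable (t i)) n).pow_const 2).ennreal_ofReal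
  calc _ ≤ ∫⁻ ω, (ENNReal.ofReal (runMax (fun i => β (t i) ω) n ^ 2) +
        ENNReal.ofReal (runMax (fun i => (-β) (t i) ω) n ^ 2)) ∂P := by
        refine lintegral_mono fun ω => iSup₂_le fun j hj => ?_
        have hjn : j ≤ n := by simpa [Nat.lt_succ_iff] using hj
        rw [← ENNReal.ofReal_add (sq_nonneg _) (sq_nonneg _)]
        refine ENNReal.ofReal_le_ofReal ?_
        have h1 := le_runMax (fun i => β (t i) ω) hjn
        have h2 := le_runMax (fun i => (-β) (t i) ω) hjn
        have h3 := runMax_nonneg (fun i => β (t i) ω) n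
        have h4 := runMax_nonneg (fun i => (-β) (t i) ω) n
        simp only [Pi.neg_apply] at h2 h4 ⊢
        rcases le_total 0 (β (t j) ω) with h | h
        · nlinarith [sq_nonneg (runMax (fun i => -β (t i) ω) n)]
        · nlinarith [sq_nonneg (runMax (fun i => β (t i) ω) n)]
    _ ≤ ENNReal.ofReal (4 * t n) + ENNReal.ofReal (4 * t n) := by
        rw [lintegral_add_left' hm]
        exact add_le_add (lintegral_runMax_sq_le hβ ht n) (lintegral_runMax_sq_le hβ.neg ht n)
    _ = _ := by
        rw [← ENNReal.ofReal_add (by positivity) (by positivity)]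
        congr 1
        ring

/-- The isometry for step functions: the variance of a linear combination of increments. -/
lemma integral_sum_increments_sq [IsProbabilityMeasure P] (hβ : IsPreBrownianReal β P)
    {t : ℕ → ℝ≥0} (ht : Monotone t) (a : ℕ → ℝ) (n : ℕ) :
    Integrable (fun ω => (∑ j ∈ Finset.range n, a j * (β (t (j + 1)) ω - β (t j) ω)) ^ 2) P ∧
    ∫ ω, (∑ j ∈ Finset.range n, a j * (β (t (j + 1)) ω - β (t j) ω)) ^ 2 ∂P =
      ∑ j ∈ Finset.range n, a j ^ 2 * ((t (j + 1) : ℝ) - t j) := by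
  set X : Fin n → Ω → ℝ := fun j ω => a j * (β (t (j + 1)) ω - β (t j) ω) with hX
  have hmem : ∀ j, MemLp (X j) 2 P := fun j =>
    ((memLp_two_brownian hβ _).sub (memLp_two_brownian hβ _)).const_mul _
  have hind : iIndepFun X P := by
    have h := hβ.hasIndepIncrements n (fun i => t i) fun i k hik => ht hik
    exact h.comp (fun j x => a j * x) fun j => by fun_prop
  have hmean : ∀ j, ∫ ω, X j ω ∂P = 0 := fun j => by
    simp only [hX]
    rw [integral_const_mul, integral_sub (hβ.integrable_eval _) (hβ.integrable_eval _),
      hβ.integral_eval, hβ.integral_eval, sub_zero, mul_zero]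
  have hsum : ∀ ω, ∑ j ∈ Finset.range n, a j * (β (t (j + 1)) ω - β (t j) ω) =
      (∑ j, X j) ω := fun ω => by
    rw [Finset.sum_apply, Finset.sum_range]
  have hmemS : MemLp (∑ j, X j) 2 P := memLp_finsetSum' _ fun j _ => hmem j
  simp_rw [hsum]
  refine ⟨hmemS.integrable_sq, ?_⟩
  have hv := IndepFun.variance_sum (s := Finset.univ) (fun j _ => hmem j)
    (fun i _ j _ hij => hind.indepFun hij)
  have hzero : ∫ ω, (∑ j, X j) ω ∂P = 0 := by
    simp_rw [Finset.sum_apply]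
    rw [integral_finsetSum _ fun j _ => (hmem j).integrable (by norm_num)]
    exact Finset.sum_eq_zero fun j _ => hmean j
  rw [variance_eq_sub hmemS, hzero] at hv
  have hv' : ∫ ω, ((∑ j, X j) ω) ^ 2 ∂P = ∑ j, Var[X j; P] := by simpa using hv
  rw [hv', Finset.sum_range]
  refine Finset.sum_congr rfl fun j _ => ?_
  rw [hX, variance_const_mul]
  congr 1
  have hl := hβ.hasLaw_sub (t (j + 1)) (t j)
  have h := hl.variance_eq
  rw [variance_id_gaussianReal] at h
  have hle : (t j : ℝ) ≤ t (j + 1) := by exact_mod_cast ht (Nat.le_succ _)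
  calc _ = Var[β (t (j + 1)) - β (t j); P] := rfl
    _ = _ := by
      rw [h, coe_nndist, Real.dist_eq]
      exact abs_of_nonneg (sub_nonneg.2 hle)

end Brownian

/-! ### One Fourier mode of the noise -/

/-- The point `j t / n` of the uniform partition of `[0, t]`. -/
def grid (t : ℝ) (n j : ℕ) : ℝ≥0 := (j * t / n).toNNReal

lemma coe_grid {t : ℝ} (ht : 0 ≤ t) (n j : ℕ) : (grid t n j : ℝ) = j * t / n :=
  Real.coe_toNNReal _ (by positivity)

lemma monotone_grid {t : ℝ} (ht : 0 ≤ t) (n : ℕ) : Monotone (grid t n) := fun i j hij => by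
  refine Real.toNNReal_le_toNNReal ?_
  gcongr

lemma grid_self_le {t : ℝ} (ht : 0 ≤ t) (n : ℕ) : (grid t n n : ℝ) ≤ t := by
  rw [coe_grid ht, mul_comm, mul_div_assoc]
  exact mul_le_of_le_one_right ht (div_self_le_one _)

lemma grid_succ_sub {t : ℝ} (ht : 0 ≤ t) (n j : ℕ) :
    (grid t n (j + 1) : ℝ) - grid t n j = t / n := by
  rw [coe_grid ht, coe_grid ht]
  push_cast
  ring

lemma itoSum_toNNReal (f : ℝ → ℂ) (x : ℝ≥0 → ℂ) (t : ℝ) (n : ℕ) :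
    itoSum f (fun s => x s.toNNReal) t n =
      ∑ j ∈ Finset.range n, f (j * t / n) * (x (grid t n (j + 1)) - x (grid t n j)) := by
  simp [itoSum, grid]

/-- A random variable that dominates `‖x t‖²` for `t ∈ [0, T]` when the path `x` is continuous. It is
written with countably many times, so that its expectation can be estimated. -/
def pathSup (T : ℝ) (x : ℝ≥0 → ℂ) : ℝ≥0∞ :=
  liminf (fun n : ℕ => ⨆ j ∈ Finset.range (n + 1), ‖x (grid T n j)‖ₑ ^ 2) atTop

lemma enorm_sq_le_pathSup {T : ℝ} (hT : 0 < T) {x : ℝ≥0 → ℂ} (hx : Continuous x) {t : ℝ}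
    (ht : t ∈ Icc 0 T) : ‖x t.toNNReal‖ₑ ^ 2 ≤ pathSup T x := by
  have ha : 0 ≤ t / T := div_nonneg ht.1 hT.le
  have h1 : Tendsto (fun n : ℕ => ((⌊t / T * n⌋₊ : ℝ) * T / n)) atTop (𝓝 t) := by
    have h := ((tendsto_nat_floor_mul_div_atTop ha).comp
      (tendsto_natCast_atTop_atTop (R := ℝ))).mul_const T
    rw [div_mul_cancel₀ _ hT.ne'] at h
    refine h.congr fun n => ?_
    simp only [Function.comp_apply]
    ring
  have h2 : Tendsto (fun n : ℕ => ‖x (grid T n ⌊t / T * n⌋₊)‖ₑ ^ 2) atTop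
      (𝓝 (‖x t.toNNReal‖ₑ ^ 2)) := by
    have h3 : Continuous fun s : ℝ => ‖x s.toNNReal‖ₑ ^ 2 :=
      (ENNReal.continuous_pow 2).comp (hx.comp continuous_real_toNNReal).enorm
    exact (h3.tendsto t).comp h1
  rw [← h2.liminf_eq]
  refine liminf_le_liminf (Eventually.of_forall fun n => ?_)
  refine le_iSup₂ (f := fun j (_ : j ∈ Finset.range (n + 1)) => ‖x (grid T n j)‖ₑ ^ 2) _ ?_
  rw [Finset.mem_range, Nat.lt_succ_iff]
  refine Nat.floor_le_of_le (mul_le_of_le_one_left (Nat.cast_nonneg n) ?_)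
  exact (div_le_one hT).2 ht.2

lemma liminf_le_of_forall_le {u : ℕ → ℝ≥0∞} {c : ℝ≥0∞} (h : ∀ n, u n ≤ c) :
    liminf u atTop ≤ c :=
  (liminf_le_liminf (Eventually.of_forall h)).trans (liminf_const c).le

section Mode

variable {Ω : Type*} [MeasurableSpace Ω] {P : Measure Ω} [IsProbabilityMeasure P]
  {β₀ β₁ : ℝ≥0 → Ω → ℝ} {q : ℝ} {X : ℝ≥0 → Ω → ℂ}

lemma measurable_pathSup (hX : ∀ t, Measurable (X t)) (T : ℝ) :
    Measurable fun ω => pathSup T (X · ω) := by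
  refine Measurable.liminf fun n => ?_
  exact Measurable.biSup _ (Finset.countable_toSet _) fun j _ => (hX _).enorm.pow_const 2

lemma lintegral_pathSup_le (hβ₀ : IsPreBrownianReal β₀ P) (hβ₁ : IsPreBrownianReal β₁ P)
    (hq : 0 ≤ q) (hX : ∀ t, Measurable (X t))
    (hXβ : ∀ t, ∀ᵐ ω ∂P, X t ω = (√q : ℂ) * ((β₀ t ω : ℂ) + Complex.I * (β₁ t ω : ℂ)))
    {T : ℝ} (hT : 0 ≤ T) :
    ∫⁻ ω, pathSup T (X · ω) ∂P ≤ ENNReal.ofReal (16 * T * q) := by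
  have hm : ∀ n : ℕ, Measurable fun ω =>
      ⨆ j ∈ Finset.range (n + 1), ‖X (grid T n j) ω‖ₑ ^ 2 := fun n =>
    Measurable.biSup _ (Finset.countable_toSet _) fun j _ => (hX _).enorm.pow_const 2
  refine (lintegral_liminf_le hm).trans (liminf_le_of_forall_le fun n => ?_)
  have hae : ∀ᵐ ω ∂P, ∀ j, X (grid T n j) ω =
      (√q : ℂ) * ((β₀ (grid T n j) ω : ℂ) + Complex.I * (β₁ (grid T n j) ω : ℂ)) :=
    ae_all_iff.2 fun j => hXβ _
  calc _ ≤ ∫⁻ ω, ENNReal.ofReal q *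
        ((⨆ j ∈ Finset.range (n + 1), ENNReal.ofReal (β₀ (grid T n j) ω ^ 2)) +
          ⨆ j ∈ Finset.range (n + 1), ENNReal.ofReal (β₁ (grid T n j) ω ^ 2)) ∂P := by
        refine lintegral_mono_ae ?_
        filter_upwards [hae] with ω hω
        refine iSup₂_le fun j hj => ?_
        have e : ‖X (grid T n j) ω‖ₑ ^ 2 = ENNReal.ofReal q *
            (ENNReal.ofReal (β₀ (grid T n j) ω ^ 2) + ENNReal.ofReal (β₁ (grid T n j) ω ^ 2)) := by
          rw [← ENNReal.ofReal_add (sq_nonneg _) (sq_nonneg _), ← ENNReal.ofReal_mul hq,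
            ← ofReal_norm, ← ENNReal.ofReal_pow (norm_nonneg _), hω j, norm_mul, mul_pow,
            Complex.norm_of_nonneg (Real.sqrt_nonneg q), Real.sq_sqrt hq, mul_comm Complex.I,
            Complex.sq_norm, Complex.normSq_add_mul_I]
        rw [e]
        gcongr
        · exact le_iSup₂ (f := fun j (_ : j ∈ Finset.range (n + 1)) =>
            ENNReal.ofReal (β₀ (grid T n j) ω ^ 2)) j hj
        · exact le_iSup₂ (f := fun j (_ : j ∈ Finset.range (n + 1)) =>
            ENNReal.ofReal (β₁ (grid T n j) ω ^ 2)) j hj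
    _ ≤ ENNReal.ofReal q * (ENNReal.ofReal (8 * T) + ENNReal.ofReal (8 * T)) := by
        rw [lintegral_const_mul' _ _ ENNReal.ofReal_ne_top, lintegral_add_left']
        · have h : ENNReal.ofReal (8 * grid T n n) ≤ ENNReal.ofReal (8 * T) :=
            ENNReal.ofReal_le_ofReal (by linarith [grid_self_le hT n])
          gcongr
          · exact (lintegral_iSup_brownian_sq_le hβ₀ (monotone_grid hT n) n).trans h
          · exact (lintegral_iSup_brownian_sq_le hβ₁ (monotone_grid hT n) n).trans h
        · exact AEMeasurable.biSup _ (Finset.countable_toSet _) fun j _ =>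
            ((hβ₀.aemeasurable _).pow_const 2).ennreal_ofReal
    _ = _ := by
        rw [← ENNReal.ofReal_add (by positivity) (by positivity), ← ENNReal.ofReal_mul hq]
        congr 1
        ring

/-- The second moment of the approximating sums of a stochastic integral. -/
lemma lintegral_itoSum_sq_le (hβ₀ : IsPreBrownianReal β₀ P) (hβ₁ : IsPreBrownianReal β₁ P)
    (hq : 0 ≤ q)
    (hXβ : ∀ t, ∀ᵐ ω ∂P, X t ω = (√q : ℂ) * ((β₀ t ω : ℂ) + Complex.I * (β₁ t ω : ℂ)))
    (f : ℝ → ℂ) {t : ℝ} (ht : 0 ≤ t) (n : ℕ) :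
    ∫⁻ ω, ‖itoSum f (fun s => X s.toNNReal ω) t n‖ₑ ^ 2 ∂P ≤
      ENNReal.ofReal (4 * q * ∑ j ∈ Finset.range n, ‖f (j * t / n)‖ ^ 2 * (t / n)) := by
  set Z : (ℝ≥0 → Ω → ℝ) → (ℕ → ℝ) → Ω → ℝ := fun β c ω =>
    ∑ j ∈ Finset.range n, c j * (β (grid t n (j + 1)) ω - β (grid t n j) ω) with hZ
  set a : ℕ → ℝ := fun j => (f (j * t / n)).re with ha
  set b : ℕ → ℝ := fun j => (f (j * t / n)).im with hb
  have hZi : ∀ β, IsPreBrownianReal β P → ∀ c, Integrable (fun ω => Z β c ω ^ 2) P ∧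
      ∫ ω, Z β c ω ^ 2 ∂P = ∑ j ∈ Finset.range n, c j ^ 2 * (t / n) := fun β hβ c => by
    have h := integral_sum_increments_sq hβ (monotone_grid ht n) c n
    refine ⟨h.1, h.2.trans (Finset.sum_congr rfl fun j _ => ?_)⟩
    rw [grid_succ_sub ht]
  have hae : ∀ᵐ ω ∂P, ∀ j, X (grid t n j) ω =
      (√q : ℂ) * ((β₀ (grid t n j) ω : ℂ) + Complex.I * (β₁ (grid t n j) ω : ℂ)) :=
    ae_all_iff.2 fun j => hXβ _
  obtain ⟨i1, e1⟩ := hZi β₀ hβ₀ a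
  obtain ⟨i2, e2⟩ := hZi β₀ hβ₀ b
  obtain ⟨i3, e3⟩ := hZi β₁ hβ₁ a
  obtain ⟨i4, e4⟩ := hZi β₁ hβ₁ b
  have i12 : Integrable (fun ω => Z β₀ a ω ^ 2 + Z β₀ b ω ^ 2) P := i1.add i2
  have i34 : Integrable (fun ω => Z β₁ a ω ^ 2 + Z β₁ b ω ^ 2) P := i3.add i4
  have hint : Integrable (fun ω => 2 * q * ((Z β₀ a ω ^ 2 + Z β₀ b ω ^ 2) +
      (Z β₁ a ω ^ 2 + Z β₁ b ω ^ 2))) P := (i12.add i34).const_mul _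
  calc _ ≤ ∫⁻ ω, ENNReal.ofReal (2 * q * ((Z β₀ a ω ^ 2 + Z β₀ b ω ^ 2) +
        (Z β₁ a ω ^ 2 + Z β₁ b ω ^ 2))) ∂P := by
        refine lintegral_mono_ae ?_
        filter_upwards [hae] with ω hω
        have e : itoSum f (fun s => X s.toNNReal ω) t n = (√q : ℂ) *
            (((Z β₀ a ω - Z β₁ b ω : ℝ) : ℂ) + ((Z β₀ b ω + Z β₁ a ω : ℝ) : ℂ) * Complex.I) := by
          rw [itoSum_toNNReal f (X · ω), hZ]
          push_cast
          rw [← Finset.sum_sub_distrib, ← Finset.sum_add_distrib, Finset.sum_mul,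
            ← Finset.sum_add_distrib, Finset.mul_sum]
          refine Finset.sum_congr rfl fun j _ => ?_
          rw [hω, hω, ← Complex.re_add_im (f (j * t / n))]
          simp only [ha, hb]
          linear_combination ((√q : ℂ) * (f (j * t / n)).im *
            (β₁ (grid t n (j + 1)) ω - β₁ (grid t n j) ω)) * Complex.I_sq
        rw [← ofReal_norm, ← ENNReal.ofReal_pow (norm_nonneg _), e, norm_mul, mul_pow,
          Complex.norm_of_nonneg (Real.sqrt_nonneg q), Real.sq_sqrt hq,
          Complex.sq_norm, Complex.normSq_add_mul_I]
        refine ENNReal.ofReal_le_ofReal ?_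
        rw [mul_comm 2 q, mul_assoc]
        refine mul_le_mul_of_nonneg_left ?_ hq
        nlinarith [sq_nonneg (Z β₀ a ω + Z β₁ b ω), sq_nonneg (Z β₀ b ω - Z β₁ a ω)]
    _ = _ := by
        rw [← ofReal_integral_eq_lintegral_ofReal hint (ae_of_all _ fun ω => by
          simp only [Pi.zero_apply]; positivity), integral_const_mul,
          integral_add i12 i34, integral_add i1 i2, integral_add i3 i4, e1, e2, e3,
          e4]
        congr 1
        have : ∀ j : ℕ, ‖f (j * t / n)‖ ^ 2 = a j ^ 2 + b j ^ 2 := fun j => by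
          rw [Complex.sq_norm, Complex.normSq_apply]; ring
        simp_rw [this, add_mul, Finset.sum_add_distrib]
        ring

end Mode

/-- A left Riemann sum of `exp(-2λ(t - ·))`, which is increasing, is at most its integral. -/
lemma one_add_lam_mul_sum_le (ν : ℝ) (k : ℤ) {t : ℝ} (ht : 0 ≤ t) (n : ℕ) :
    (1 + lam k) * ∑ j ∈ Finset.range n,
      ‖Complex.exp (-((1 + ν * Complex.I) * lam k * (t - ((j * t / n : ℝ) : ℂ))))‖ ^ 2 * (t / n) ≤
      t + 1 := by
  rcases Nat.eq_zero_or_pos n with rfl | hn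
  · simp; linarith
  have hn' : (0 : ℝ) < n := by exact_mod_cast hn
  have hl := lam_nonneg k
  set δ := t / n with hδ
  have hδ0 : 0 ≤ δ := by positivity
  set p : ℕ → ℝ := fun j => Real.exp (-(2 * lam k * (t - j * δ))) with hp
  have hpn : p n = 1 := by
    have : (n : ℝ) * δ = t := by rw [hδ]; field_simp
    simp [hp, this]
  have hnorm : ∀ j : ℕ,
      ‖Complex.exp (-((1 + ν * Complex.I) * lam k * (t - ((j * t / n : ℝ) : ℂ))))‖ ^ 2 = p j :=
    fun j => by
      rw [Complex.norm_exp, ← Real.exp_nat_mul]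
      simp only [hp, hδ]
      congr 1
      have e : (-((1 + ν * Complex.I) * lam k * (t - ((j * t / n : ℝ) : ℂ)))).re =
          -(lam k * (t - j * t / n)) := by
        have : ((t : ℂ) - ((j * t / n : ℝ) : ℂ)) = ((t - j * t / n : ℝ) : ℂ) := by push_cast; ring
        rw [this, mul_assoc, ← Complex.ofReal_mul, Complex.neg_re, Complex.re_mul_ofReal]
        simp
      rw [e]
      push_cast
      ring
  simp_rw [hnorm]
  rw [← Finset.sum_mul]
  have hp1 : ∀ j ∈ Finset.range n, p j ≤ 1 := fun j hj => by
    have hj' : (j : ℝ) ≤ n := by exact_mod_cast (Finset.mem_range.1 hj).le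
    refine Real.exp_le_one_iff.2 ?_
    have : (j : ℝ) * δ ≤ n * δ := by gcongr
    have h2 : (n : ℝ) * δ = t := by rw [hδ]; field_simp
    have : 0 ≤ lam k * (t - j * δ) := mul_nonneg hl (by linarith)
    linarith
  have h1 : (∑ j ∈ Finset.range n, p j) * δ ≤ t := by
    calc _ ≤ (∑ j ∈ Finset.range n, (1 : ℝ)) * δ := by
          gcongr with j hj; exact hp1 j hj
      _ = t := by simp [hδ]; field_simp
  have h2 : 2 * lam k * δ * ∑ j ∈ Finset.range n, p j ≤ 1 := by
    rw [Finset.mul_sum]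
    calc _ ≤ ∑ j ∈ Finset.range n, (p (j + 1) - p j) := by
          refine Finset.sum_le_sum fun j _ => ?_
          have e : p (j + 1) = Real.exp (2 * lam k * δ) * p j := by
            simp only [hp]
            rw [← Real.exp_add]
            push_cast
            congr 1
            ring
          rw [e]
          have h3 := Real.add_one_le_exp (2 * lam k * δ)
          have h4 : 0 < p j := Real.exp_pos _
          nlinarith
      _ = p n - p 0 := Finset.sum_range_sub p n
      _ ≤ 1 := by rw [hpn]; linarith [Real.exp_pos (-(2 * lam k * (t - (0 : ℕ) * δ)))]
  nlinarith [mul_nonneg (mul_nonneg hl hδ0)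
    (Finset.sum_nonneg fun j (_ : j ∈ Finset.range n) => (Real.exp_pos _ : 0 < p j).le)]

/-! ### One Fourier mode of the stochastic convolution -/

/-- The kernel `s ↦ exp(-(1 + iν) λ_k (t - s))` of the stochastic convolution. -/
def convKernel (ν : ℝ) (k : ℤ) (t s : ℝ) : ℂ :=
  Complex.exp (-((1 + ν * Complex.I) * lam k * (t - s)))

/-- The integral `∫₀ᵗ exp(-(1 + iν) λ_k (t - s)) dB(s)` after an integration by parts, which makes
sense for every continuous path `B`. -/
def convPath (ν : ℝ) (k : ℤ) (B : ℝ → ℂ) (t : ℝ) : ℂ :=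
  B t - convKernel ν k t 0 * B 0 -
    ∫ s in (0 : ℝ)..t, (1 + ν * Complex.I) * lam k * convKernel ν k t s * B s

lemma convKernel_self (ν : ℝ) (k : ℤ) (t : ℝ) : convKernel ν k t t = 1 := by simp [convKernel]

lemma norm_convKernel (ν : ℝ) (k : ℤ) (t s : ℝ) :
    ‖convKernel ν k t s‖ = Real.exp (-(lam k * (t - s))) := by
  have e : (-((1 + ν * Complex.I) * lam k * ((t : ℂ) - s))).re = -(lam k * (t - s)) := by
    rw [← Complex.ofReal_sub, mul_assoc, ← Complex.ofReal_mul, Complex.neg_re,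
      Complex.re_mul_ofReal]
    simp
  rw [convKernel, Complex.norm_exp, e]

lemma hasDerivAt_convKernel (ν : ℝ) (k : ℤ) (t s : ℝ) :
    HasDerivAt (convKernel ν k t) ((1 + ν * Complex.I) * lam k * convKernel ν k t s) s := by
  have h1 : HasDerivAt (fun s : ℝ => -((1 + ν * Complex.I) * lam k * ((t : ℂ) - s)))
      ((1 + ν * Complex.I) * lam k) s := by
    have h := (((Complex.ofRealCLM.hasDerivAt (x := s)).const_sub (t : ℂ)).const_mul
      (-((1 + ν * Complex.I) * lam k)))
    simpa only [neg_mul, mul_neg, neg_neg, Complex.ofRealCLM_apply, Complex.ofReal_one, mul_one]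
      using h
  have h2 := h1.cexp
  rw [mul_comm]
  exact h2

lemma continuous_convKernel (ν : ℝ) (k : ℤ) (t : ℝ) : Continuous (convKernel ν k t) := by
  unfold convKernel
  fun_prop

lemma tendsto_itoSum_convKernel (ν : ℝ) (k : ℤ) {B : ℝ → ℂ} (hB : Continuous B) {t : ℝ}
    (ht : 0 ≤ t) : Tendsto (itoSum (convKernel ν k t) B t) atTop (𝓝 (convPath ν k B t)) := by
  have h := tendsto_itoSum ht (hasDerivAt_convKernel ν k t)
    ((continuous_convKernel ν k t).const_mul _) hB
  rwa [convKernel_self, one_mul] at h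

lemma continuous_convPath (ν : ℝ) (k : ℤ) {B : ℝ → ℂ} (hB : Continuous B) :
    Continuous (convPath ν k B) := by
  have e : convPath ν k B = fun t => B t - convKernel ν k t 0 * B 0 -
      Complex.exp (-((1 + ν * Complex.I) * lam k * t)) * ∫ s in (0 : ℝ)..t,
        (1 + ν * Complex.I) * lam k * Complex.exp ((1 + ν * Complex.I) * lam k * s) * B s := by
    funext t
    rw [convPath, ← intervalIntegral.integral_const_mul]
    congr 1
    refine intervalIntegral.integral_congr fun s _ => ?_
    have : convKernel ν k t s = Complex.exp (-((1 + ν * Complex.I) * lam k * t)) *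
        Complex.exp ((1 + ν * Complex.I) * lam k * s) := by
      rw [convKernel, ← Complex.exp_add]
      congr 1
      ring
    simp only [this]
    ring
  rw [e]
  have h1 : Continuous fun t => ∫ s in (0 : ℝ)..t,
      (1 + ν * Complex.I) * lam k * Complex.exp ((1 + ν * Complex.I) * lam k * s) * B s :=
    intervalIntegral.continuous_primitive
      (fun a b => Continuous.intervalIntegrable (by fun_prop) _ _) 0
  unfold convKernel
  fun_prop

lemma norm_convPath_le (ν : ℝ) (k : ℤ) {B : ℝ → ℂ} {b t : ℝ} (ht : 0 ≤ t)
    (hb : ∀ s ∈ Icc 0 t, ‖B s‖ ≤ b) :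
    ‖convPath ν k B t‖ ≤ (2 + ‖1 + ν * Complex.I‖) * b := by
  have hl := lam_nonneg k
  have hb0 : 0 ≤ b := (norm_nonneg _).trans (hb 0 ⟨le_rfl, ht⟩)
  have h1 : ‖convKernel ν k t 0 * B 0‖ ≤ b := by
    rw [norm_mul, norm_convKernel]
    refine (mul_le_of_le_one_left (norm_nonneg _) (Real.exp_le_one_iff.2 ?_)).trans
      (hb 0 ⟨le_rfl, ht⟩)
    have : 0 ≤ lam k * (t - 0) := by rw [sub_zero]; positivity
    linarith
  have h2 : ‖∫ s in (0 : ℝ)..t, (1 + ν * Complex.I) * lam k * convKernel ν k t s * B s‖ ≤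
      ‖1 + ν * Complex.I‖ * b := by
    have hd : ∀ s ∈ uIcc 0 t, HasDerivAt (fun s => Real.exp (-(lam k * (t - s))))
        (lam k * Real.exp (-(lam k * (t - s)))) s := fun s _ => by
      have h := ((((hasDerivAt_id s).const_sub t).const_mul (lam k)).neg).exp
      simpa [mul_comm] using h
    have hi : ∫ s in (0 : ℝ)..t, lam k * Real.exp (-(lam k * (t - s))) ≤ 1 := by
      rw [intervalIntegral.integral_eq_sub_of_hasDerivAt hd
        (Continuous.intervalIntegrable (by fun_prop) _ _)]
      simpa using (Real.exp_pos _).le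
    calc _ ≤ ∫ s in (0 : ℝ)..t,
          ‖1 + ν * Complex.I‖ * b * (lam k * Real.exp (-(lam k * (t - s)))) := by
          refine intervalIntegral.norm_integral_le_of_norm_le ht (ae_of_all _ fun s hs => ?_)
            (Continuous.intervalIntegrable (by fun_prop) _ _)
          rw [norm_mul, norm_mul, norm_mul, norm_convKernel, Complex.norm_of_nonneg hl]
          calc _ ≤ ‖1 + ν * Complex.I‖ * lam k * Real.exp (-(lam k * (t - s))) * b := by
                gcongr; exact hb s ⟨hs.1.le, hs.2⟩
            _ = _ := by ring
      _ ≤ ‖1 + ν * Complex.I‖ * b * 1 := by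
          rw [intervalIntegral.integral_const_mul]
          gcongr
      _ = _ := mul_one _
  calc _ ≤ ‖B t‖ + ‖convKernel ν k t 0 * B 0‖ +
        ‖∫ s in (0 : ℝ)..t, (1 + ν * Complex.I) * lam k * convKernel ν k t s * B s‖ :=
        (norm_sub_le _ _).trans (add_le_add_left (norm_sub_le _ _) _)
    _ ≤ b + b + ‖1 + ν * Complex.I‖ * b :=
        add_le_add (add_le_add (hb t ⟨ht, le_rfl⟩) h1) h2
    _ = _ := by ring

/-- Riemann sums with right end points of a continuous function converge to its integral. This is
an Abel summation away from the convergence of `∑_j s_j (g(s_{j+1}) - g(s_j))`. -/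
lemma tendsto_riemannSum {g : ℝ → ℝ} (hg : Continuous g) {T : ℝ} (hT : 0 ≤ T) :
    Tendsto (fun n : ℕ => ∑ j ∈ Finset.range n, T / n * g ((j + 1) * T / n)) atTop
      (𝓝 (∫ s in (0 : ℝ)..T, g s)) := by
  have h := tendsto_itoSum (f := fun s => (s : ℂ)) (f' := fun _ => 1) (B := fun s => (g s : ℂ)) hT
    (fun s => Complex.ofRealCLM.hasDerivAt) continuous_const
    (Complex.continuous_ofReal.comp hg)
  simp only [one_mul, Complex.ofReal_zero, zero_mul, sub_zero] at h
  rw [intervalIntegral.integral_ofReal] at h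
  have h2 := (Complex.continuous_re.tendsto _).comp (h.const_sub ((T * g T : ℝ) : ℂ))
  have e : ((T * g T : ℝ) - ((T : ℂ) * g T - ((∫ s in (0 : ℝ)..T, g s : ℝ) : ℂ))).re =
      ∫ s in (0 : ℝ)..T, g s := by
    rw [← Complex.ofReal_mul, ← Complex.ofReal_sub, ← Complex.ofReal_sub, Complex.ofReal_re]
    ring
  rw [e] at h2
  refine h2.congr' ?_
  filter_upwards [eventually_gt_atTop 0] with n hn
  have hn' : (n : ℝ) ≠ 0 := by positivity
  have h3 : itoSum (fun s => (s : ℂ)) (fun s => (g s : ℂ)) T n =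
      ((∑ j ∈ Finset.range n, j * T / n * (g ((j + 1) * T / n) - g (j * T / n)) : ℝ) : ℂ) := by
    simp [itoSum]
  have h4 := Finset.sum_range_sub (fun j : ℕ => j * T / n * g (j * T / n)) n
  have h5 : (n : ℝ) * T / n = T := by field_simp
  simp only [h5, Nat.cast_zero, zero_mul, zero_div, sub_zero] at h4
  simp only [Function.comp_apply]
  rw [h3, ← Complex.ofReal_sub, Complex.ofReal_re, ← h4, ← Finset.sum_sub_distrib]
  refine Finset.sum_congr rfl fun j _ => ?_
  push_cast
  ring

/-- A random variable that dominates `∫₀ᵀ |convPath|²` for continuous paths. It is written with the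
approximating sums of the stochastic integral at countably many times, so that its expectation can
be estimated. -/
def convSq (ν : ℝ) (k : ℤ) (T : ℝ) (x : ℝ≥0 → ℂ) : ℝ≥0∞ :=
  liminf (fun n : ℕ => ∑ j ∈ Finset.range n, ENNReal.ofReal (T / n) *
    liminf (fun m : ℕ => ‖itoSum (convKernel ν k ((j + 1) * T / n)) (fun s => x s.toNNReal)
      ((j + 1) * T / n) m‖ₑ ^ 2) atTop) atTop

lemma lintegral_convPath_sq_le (ν : ℝ) (k : ℤ) {T : ℝ} (hT : 0 ≤ T) {x : ℝ≥0 → ℂ}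
    (hx : Continuous x) :
    ∫⁻ t in Icc 0 T, ENNReal.ofReal (‖convPath ν k (fun s => x s.toNNReal) t‖ ^ 2) ≤
      convSq ν k T x := by
  have hB : Continuous fun s : ℝ => x s.toNNReal := hx.comp continuous_real_toNNReal
  have hg : Continuous fun t => ‖convPath ν k (fun s => x s.toNNReal) t‖ ^ 2 :=
    (continuous_convPath ν k hB).norm.pow 2
  rw [setLIntegral_congr Ioc_ae_eq_Icc.symm, ← ofReal_integral_eq_lintegral_ofReal
    (hg.integrableOn_Icc.mono_set Ioc_subset_Icc_self) (ae_of_all _ fun t => sq_nonneg _),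
    ← intervalIntegral.integral_of_le hT]
  have h := (ENNReal.continuous_ofReal.tendsto _).comp (tendsto_riemannSum hg hT)
  rw [← h.liminf_eq, convSq]
  refine (liminf_congr (Eventually.of_forall fun n => ?_)).le
  simp only [Function.comp_apply]
  rw [ENNReal.ofReal_sum_of_nonneg fun j _ => by positivity]
  refine Finset.sum_congr rfl fun j _ => ?_
  have hs : 0 ≤ ((j : ℝ) + 1) * T / n := by positivity
  have h2 := ((ENNReal.continuous_pow 2).tendsto _).comp
    (tendsto_itoSum_convKernel ν k hB hs).enorm
  rw [ENNReal.ofReal_mul (by positivity), ENNReal.ofReal_pow (norm_nonneg _), ofReal_norm,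
    ← h2.liminf_eq]
  rfl

section Mode

variable {Ω : Type*} [MeasurableSpace Ω] {P : Measure Ω} {X : ℝ≥0 → Ω → ℂ}

lemma measurable_itoSum (hX : ∀ t, Measurable (X t)) (f : ℝ → ℂ) (t : ℝ) (n : ℕ) :
    Measurable fun ω => itoSum f (fun s => X s.toNNReal ω) t n := by
  unfold itoSum
  exact Finset.measurable_fun_sum _ fun j _ => ((hX _).sub (hX _)).const_mul _

lemma measurable_convSq (hX : ∀ t, Measurable (X t)) (ν : ℝ) (k : ℤ) (T : ℝ) :
    Measurable fun ω => convSq ν k T (X · ω) := by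
  refine Measurable.liminf fun n => Finset.measurable_fun_sum _ fun j _ => ?_
  exact (Measurable.liminf fun m => (measurable_itoSum hX _ _ m).enorm.pow_const 2).const_mul _

lemma lintegral_convSq_le [IsProbabilityMeasure P] {β₀ β₁ : ℝ≥0 → Ω → ℝ} {q : ℝ}
    (hβ₀ : IsPreBrownianReal β₀ P) (hβ₁ : IsPreBrownianReal β₁ P)
    (hq : 0 ≤ q) (hX : ∀ t, Measurable (X t))
    (hXβ : ∀ t, ∀ᵐ ω ∂P, X t ω = (√q : ℂ) * ((β₀ t ω : ℂ) + Complex.I * (β₁ t ω : ℂ)))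
    (ν : ℝ) (k : ℤ) {T : ℝ} (hT : 0 ≤ T) :
    ENNReal.ofReal (1 + lam k) * ∫⁻ ω, convSq ν k T (X · ω) ∂P ≤
      ENNReal.ofReal (4 * T * (T + 1) * q) := by
  have hl := lam_nonneg k
  have hm : ∀ t m, Measurable fun ω =>
      ‖itoSum (convKernel ν k t) (fun s => X s.toNNReal ω) t m‖ₑ ^ 2 := fun t m =>
    (measurable_itoSum hX _ _ m).enorm.pow_const 2
  set c := 4 * (T + 1) * q / (1 + lam k) with hc
  have hc0 : 0 ≤ c := by positivity
  have h1 : ∀ t ∈ Icc 0 T, ∫⁻ ω, liminf (fun m : ℕ =>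
      ‖itoSum (convKernel ν k t) (fun s => X s.toNNReal ω) t m‖ₑ ^ 2) atTop ∂P ≤
      ENNReal.ofReal c := fun t ht => by
    refine (lintegral_liminf_le (hm t)).trans (liminf_le_of_forall_le fun n => ?_)
    refine (lintegral_itoSum_sq_le hβ₀ hβ₁ hq hXβ _ ht.1 n).trans (ENNReal.ofReal_le_ofReal ?_)
    rw [hc, le_div_iff₀ (by positivity)]
    have h3 := one_add_lam_mul_sum_le ν k ht.1 n
    calc _ = 4 * q * ((1 + lam k) * ∑ j ∈ Finset.range n,
          ‖convKernel ν k t (j * t / n)‖ ^ 2 * (t / n)) := by ring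
      _ ≤ 4 * q * (T + 1) := by
          gcongr
          exact h3.trans (by linarith [ht.2])
      _ = _ := by ring
  have h2 : ∫⁻ ω, convSq ν k T (X · ω) ∂P ≤ ENNReal.ofReal (T * c) := by
    unfold convSq
    refine (lintegral_liminf_le fun n => Finset.measurable_fun_sum _ fun j _ =>
      (Measurable.liminf fun m => hm _ m).const_mul _).trans (liminf_le_of_forall_le fun n => ?_)
    rw [lintegral_finsetSum _ fun j _ => (Measurable.liminf fun m => hm _ m).const_mul _]
    calc _ ≤ ∑ j ∈ Finset.range n, ENNReal.ofReal (T / n * c) := by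
          refine Finset.sum_le_sum fun j hj => ?_
          have hn : (0 : ℝ) < n := by
            exact_mod_cast (Nat.zero_le j).trans_lt (Finset.mem_range.1 hj)
          have hjn : (j : ℝ) + 1 ≤ n := by exact_mod_cast Finset.mem_range.1 hj
          rw [lintegral_const_mul' _ _ ENNReal.ofReal_ne_top, ENNReal.ofReal_mul (by positivity)]
          gcongr
          refine h1 _ ⟨by positivity, ?_⟩
          rw [div_le_iff₀ hn, mul_comm]
          gcongr
      _ ≤ _ := by
          rw [← ENNReal.ofReal_sum_of_nonneg fun j _ => by positivity, Finset.sum_const,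
            Finset.card_range, nsmul_eq_mul]
          refine ENNReal.ofReal_le_ofReal ?_
          calc _ = (n / n : ℝ) * (T * c) := by ring
            _ ≤ _ := mul_le_of_le_one_left (by positivity) (div_self_le_one _)
  calc _ ≤ ENNReal.ofReal (1 + lam k) * ENNReal.ofReal (T * c) := by gcongr
    _ = _ := by
        rw [← ENNReal.ofReal_mul (by positivity), hc]
        congr 1
        field_simp

end Mode

/-! ### The stochastic convolution -/

lemma stochConvCoeff_eq {Ω : Type*} (ν σ : ℝ) {W : ℝ≥0 → Ω → L2T} {ω : Ω}
    (hW : Continuous fun t => W t ω) {t : ℝ} (ht : 0 ≤ t) (k : ℤ) :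
    stochConvCoeff ν σ W ω t k = σ * convPath ν k (fun s => coeff (W s.toNNReal ω) k) t := by
  have hB : Continuous fun s : ℝ => coeff (W s.toNNReal ω) k :=
    (continuous_coeff k).comp (hW.comp continuous_real_toNNReal)
  rw [stochConvCoeff, pathIntegral]
  exact congrArg _ (tendsto_itoSum_convKernel ν k hB ht).limUnder_eq

/-- Pathwise properties of the stochastic convolution, for a continuous path of the noise for which
two series of random variables converge. -/
lemma stochConv_regularity {Ω : Type*} (ν σ : ℝ) {T : ℝ} (hT : 0 < T) {W : ℝ≥0 → Ω → L2T} {ω : Ω}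
    (hW : Continuous fun t => W t ω)
    (hsup : ∑' k, pathSup T (fun t => coeff (W t ω) k) ≠ ∞)
    (hsq : ∑' k, ENNReal.ofReal (1 + lam k) * convSq ν k T (fun t => coeff (W t ω) k) ≠ ∞) :
    ∃ b : ℤ → ℝ, (Summable fun k => b k ^ 2) ∧
      (∀ t ∈ Icc 0 T, (Summable fun k => ‖stochConvCoeff ν σ W ω t k‖ ^ 2) ∧
        ∀ k, ‖coeff (stochConv ν σ W ω t) k‖ ≤ b k) ∧
      (∀ k, ContinuousOn (fun t => coeff (stochConv ν σ W ω t) k) (Icc 0 T)) ∧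
      (⨆ t ∈ Icc 0 T, ‖stochConv ν σ W ω t‖ₑ) < ∞ ∧
      (∫⁻ t in Icc 0 T, sobolevSq 1 (stochConv ν σ W ω t)) < ∞ := by
  set x : ℤ → ℝ≥0 → ℂ := fun k t => coeff (W t ω) k with hx
  have hxc : ∀ k, Continuous (x k) := fun k => (continuous_coeff k).comp hW
  have hBc : ∀ k, Continuous fun s : ℝ => x k s.toNNReal := fun k =>
    (hxc k).comp continuous_real_toNNReal
  set A : ℝ := |σ| * (2 + ‖1 + ν * Complex.I‖) with hA
  set b : ℤ → ℝ := fun k => A * √(pathSup T (x k)).toReal with hb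
  have hcoef : ∀ t ∈ Icc 0 T, ∀ k,
      stochConvCoeff ν σ W ω t k = σ * convPath ν k (fun s => x k s.toNNReal) t := fun t ht k =>
    stochConvCoeff_eq ν σ hW ht.1 k
  have hle : ∀ t ∈ Icc 0 T, ∀ k, ‖stochConvCoeff ν σ W ω t k‖ ≤ b k := fun t ht k => by
    rw [hcoef t ht k, norm_mul, Complex.norm_real, Real.norm_eq_abs]
    simp only [hb, hA]
    rw [mul_assoc]
    refine mul_le_mul_of_nonneg_left (norm_convPath_le ν k ht.1 fun s hs => ?_) (abs_nonneg σ)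
    refine Real.le_sqrt_of_sq_le ?_
    have h := enorm_sq_le_pathSup hT (hxc k) (t := s) ⟨hs.1, hs.2.trans ht.2⟩
    have h' := ENNReal.toReal_mono (ENNReal.ne_top_of_tsum_ne_top hsup k) h
    rwa [ENNReal.toReal_pow, toReal_enorm] at h'
  have hbsq : ∀ k, b k ^ 2 = A ^ 2 * (pathSup T (x k)).toReal := fun k => by
    rw [hb, mul_pow, Real.sq_sqrt ENNReal.toReal_nonneg]
  have hbs : Summable fun k => b k ^ 2 := by
    simp_rw [hbsq]
    exact (ENNReal.summable_toReal hsup).mul_left _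
  have hsum : ∀ t ∈ Icc 0 T, Summable fun k => ‖stochConvCoeff ν σ W ω t k‖ ^ 2 := fun t ht =>
    Summable.of_nonneg_of_le (fun k => sq_nonneg _)
      (fun k => pow_le_pow_left₀ (norm_nonneg _) (hle t ht k) 2) hbs
  have hcs : ∀ t ∈ Icc 0 T, ∀ k, coeff (stochConv ν σ W ω t) k =
      σ * convPath ν k (fun s => x k s.toNNReal) t := fun t ht k => by
    rw [stochConv, coeff_ofCoeff (hsum t ht), hcoef t ht]
  have hcle : ∀ t ∈ Icc 0 T, ∀ k, ‖coeff (stochConv ν σ W ω t) k‖ ≤ b k := fun t ht k => by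
    rw [hcs t ht, ← hcoef t ht]
    exact hle t ht k
  refine ⟨b, hbs, fun t ht => ⟨hsum t ht, hcle t ht⟩, fun k => ?_, ?_, ?_⟩
  · exact (continuous_const.mul (continuous_convPath ν k (hBc k))).continuousOn.congr
      fun t ht => hcs t ht k
  · refine (iSup₂_le fun t ht => ?_ : _ ≤ ENNReal.ofReal √(∑' k, b k ^ 2)).trans_lt
      ENNReal.ofReal_lt_top
    rw [← ofReal_norm]
    refine ENNReal.ofReal_le_ofReal (Real.le_sqrt_of_sq_le ?_)
    rw [← (hasSum_norm_coeff_sq (stochConv ν σ W ω t)).tsum_eq]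
    exact (summable_norm_coeff_sq _).tsum_le_tsum
      (fun k => pow_le_pow_left₀ (norm_nonneg _) (hcle t ht k) 2) hbs
  · have e : ∀ t ∈ Icc 0 T, sobolevSq 1 (stochConv ν σ W ω t) =
        ∑' k, ENNReal.ofReal (σ ^ 2) * (ENNReal.ofReal (1 + lam k) *
          ENNReal.ofReal (‖convPath ν k (fun s => x k s.toNNReal) t‖ ^ 2)) := fun t ht => by
      rw [sobolevSq_one]
      refine tsum_congr fun k => ?_
      have hk := lam_nonneg k
      rw [← ENNReal.ofReal_mul (by positivity), ← ENNReal.ofReal_mul (by positivity), hcs t ht,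
        norm_mul, Complex.norm_real, mul_pow, Real.norm_eq_abs, sq_abs]
      congr 1
      ring
    have hm : ∀ k, Measurable fun t =>
        ENNReal.ofReal (‖convPath ν k (fun s => x k s.toNNReal) t‖ ^ 2) := fun k =>
      ((continuous_convPath ν k (hBc k)).norm.pow 2).measurable.ennreal_ofReal
    rw [setLIntegral_congr_fun measurableSet_Icc e,
      lintegral_tsum fun k => (((hm k).const_mul _).const_mul _).aemeasurable]
    have h : ∀ k, ∫⁻ t in Icc 0 T, ENNReal.ofReal (σ ^ 2) * (ENNReal.ofReal (1 + lam k) *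
        ENNReal.ofReal (‖convPath ν k (fun s => x k s.toNNReal) t‖ ^ 2)) ≤
        ENNReal.ofReal (σ ^ 2) * (ENNReal.ofReal (1 + lam k) * convSq ν k T (x k)) := fun k => by
      rw [lintegral_const_mul' _ _ ENNReal.ofReal_ne_top,
        lintegral_const_mul' _ _ ENNReal.ofReal_ne_top]
      gcongr
      exact lintegral_convPath_sq_le ν k hT.le (hxc k)
    refine (ENNReal.tsum_le_tsum h).trans_lt ?_
    rw [ENNReal.tsum_mul_left]
    exact ENNReal.mul_lt_top ENNReal.ofReal_lt_top hsq.lt_top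

lemma summable_of_le_rpow {q : ℤ → ℝ} (hq : ∀ k, 0 < q k) {K p : ℝ} (hp : 1 < p)
    (hK : ∀ k : ℤ, k ≠ 0 → q k ≤ K * |(k : ℝ)| ^ (-p)) : Summable q := by
  refine Summable.of_norm_bounded_eventually ((Real.summable_abs_int_rpow hp).mul_left K) ?_
  filter_upwards [(finite_singleton (0 : ℤ)).compl_mem_cofinite] with k hk
  rw [Real.norm_of_nonneg (hq k).le]
  exact hK k hk

section Noise

variable {Ω : Type*} [mΩ : MeasurableSpace Ω] {P : Measure Ω}

lemma ae_tsum_ne_top {f : ℤ → Ω → ℝ≥0∞} (hf : ∀ k, Measurable (f k)) {q : ℤ → ℝ}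
    (hq0 : ∀ k, 0 ≤ q k) (hq : Summable q) {c : ℝ} (hc : 0 ≤ c)
    (h : ∀ k, ∫⁻ ω, f k ω ∂P ≤ ENNReal.ofReal (c * q k)) : ∀ᵐ ω ∂P, ∑' k, f k ω ≠ ∞ := by
  have hle : ∫⁻ ω, ∑' k, f k ω ∂P < ∞ := by
    rw [lintegral_tsum fun k => (hf k).aemeasurable]
    refine (ENNReal.tsum_le_tsum h).trans_lt ?_
    rw [← ENNReal.ofReal_tsum_of_nonneg (fun k => mul_nonneg hc (hq0 k)) (hq.mul_left c)]
    exact ENNReal.ofReal_lt_top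
  filter_upwards [ae_lt_top (Measurable.tsum hf) hle.ne] with ω hω using hω.ne

/-- The paths of the stochastic convolution are almost surely admissible forcing paths. -/
theorem ae_stochConv_regularity [IsProbabilityMeasure P] (ν σ : ℝ) {T r : ℝ} (hT : 0 < T) (hr : 0 ≤ r)
    {𝓕 : Filtration ℝ≥0 mΩ} {W : ℝ≥0 → Ω → L2T} (hW : IsComplexNoise P 𝓕 r W) :
    ∀ᵐ ω ∂P, ∃ b : ℤ → ℝ, (Summable fun k => b k ^ 2) ∧
      (∀ t ∈ Icc 0 T, (Summable fun k => ‖stochConvCoeff ν σ W ω t k‖ ^ 2) ∧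
        ∀ k, ‖coeff (stochConv ν σ W ω t) k‖ ≤ b k) ∧
      (∀ k, ContinuousOn (fun t => coeff (stochConv ν σ W ω t) k) (Icc 0 T)) ∧
      (⨆ t ∈ Icc 0 T, ‖stochConv ν σ W ω t‖ₑ) < ∞ ∧
      (∫⁻ t in Icc 0 T, sobolevSq 1 (stochConv ν σ W ω t)) < ∞ := by
  obtain ⟨ε, hε, q, hq, ⟨K, hK⟩, β, hβ, -, hrep⟩ := hW.representation
  have hqs : Summable q := summable_of_le_rpow hq (K := K) (p := 2 * r + 1 + 2 * ε)
    (by linarith [hε.1]) fun k hk => by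
      rw [show -(2 * r + 1 + 2 * ε) = -2 * r - 1 - 2 * ε by ring]
      exact hK k hk
  have hX : ∀ k t, Measurable fun ω => coeff (W t ω) k := fun k t =>
    ((continuous_coeff k).comp_stronglyMeasurable
      ((hW.adapted t).mono (𝓕.le t))).measurable
  have hXβ : ∀ k t, ∀ᵐ ω ∂P, coeff (W t ω) k =
      (√(q k) : ℂ) * ((β (k, 0) t ω : ℂ) + Complex.I * (β (k, 1) t ω : ℂ)) := fun k t => by
    filter_upwards [hrep t] with ω hω
    have h := (hω.mapL (coeffL k)).unique (hasSum_single k fun j hj => by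
      rw [coeffL_apply, coeff_smul, coeff_phi, if_neg hj, mul_zero])
    simpa [coeffL_apply, coeff_smul, coeff_phi] using h
  have h1 : ∀ᵐ ω ∂P, ∑' k, pathSup T (fun t => coeff (W t ω) k) ≠ ∞ :=
    ae_tsum_ne_top (fun k => measurable_pathSup (hX k) T) (fun k => (hq k).le) hqs
      (c := 16 * T) (by positivity) fun k =>
      lintegral_pathSup_le (hβ (k, 0)).toIsPreBrownianReal (hβ (k, 1)).toIsPreBrownianReal
        (hq k).le (hX k) (hXβ k) hT.le
  have h2 : ∀ᵐ ω ∂P,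
      ∑' k, ENNReal.ofReal (1 + lam k) * convSq ν k T (fun t => coeff (W t ω) k) ≠ ∞ :=
    ae_tsum_ne_top (fun k => (measurable_convSq (hX k) ν k T).const_mul _) (fun k => (hq k).le) hqs
      (c := 4 * T * (T + 1)) (by positivity) fun k => by
      rw [lintegral_const_mul' _ _ ENNReal.ofReal_ne_top]
      exact lintegral_convSq_le (hβ (k, 0)).toIsPreBrownianReal (hβ (k, 1)).toIsPreBrownianReal
        (hq k).le (hX k) (hXβ k) ν k hT.le
  filter_upwards [hW.continuous_paths, h1, h2] with ω hω h3 h4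
  exact stochConv_regularity ν σ hT hω h3 h4

end Noise

end CGL

end

theorem theorem3p3 (R ν μ T : ℝ) (hR : 0 < R) (hT : 0 < T) (M : ℝ) :
    ∃ C : ℝ≥0, 0 < C ∧
      ∀ (u₀ : L2T), sobolevSq 1 u₀ < ∞ → ‖u₀‖ ≤ M →
      ∀ {Ω : Type*} [mΩ : MeasurableSpace Ω] (P : Measure Ω) [IsProbabilityMeasure P]
        (𝓕 : Filtration ℝ≥0 mΩ)
        (r σ : ℝ) (W : ℝ≥0 → Ω → L2T), 0 ≤ r → IsComplexNoise P 𝓕 r W →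
      ∀ᵐ ω ∂P,
        (∀ t ∈ Icc 0 T,
          HasSum (fun k => stochConvCoeff ν σ W ω t k • phi k) (stochConv ν σ W ω t)) ∧
        (⨆ t ∈ Icc 0 T, ‖stochConv ν σ W ω t‖ₑ) < ∞ ∧
        (∫⁻ t in Icc 0 T, sobolevSq 1 (stochConv ν σ W ω t)) < ∞ ∧
        ∃ v : ℝ → L2T,
          IsMildSolution R ν μ T u₀ (stochConv ν σ W ω) v ∧
          (⨆ t ∈ Icc 0 T, sobolevSq 1 (v t)) + (∫⁻ t in Icc 0 T, sobolevSq 2 (v t)) ≤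
            C * (1 + sobolevSq 1 u₀ + (⨆ t ∈ Icc 0 T, ‖stochConv ν σ W ω t‖ₑ) ^ 12 +
              (∫⁻ t in Icc 0 T, sobolevSq 1 (stochConv ν σ W ω t)) ^ 6) ∧
          ∀ v' : ℝ → L2T, IsMildSolution R ν μ T u₀ (stochConv ν σ W ω) v' →
            EqOn v' v (Icc 0 T) := by
  have hC := aprioriConst_pos (R := R) (μ := μ) (M := M) hT.le
  refine ⟨(aprioriConst R μ T M).toNNReal, Real.toNNReal_pos.2 hC, ?_⟩
  intro u₀ hu hM Ω mΩ P _ 𝓕 r σ W hr hW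
  filter_upwards [ae_stochConv_regularity ν σ hT hr hW] with ω hω
  obtain ⟨b, hb, hη, hc, hS, hI⟩ := hω
  exact ⟨fun t ht => hasSum_ofCoeff (hη t ht).1, hS, hI,
    exists_isMildSolution hR.le hT.le hu hM hc hb (fun t ht => (hη t ht).2) hS hI⟩
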